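/- **Setting (Ghatak–Sherrington model).** Fix an integer $\mathcal S\ge 1$. For $N\ge 1$ let $\Sigma_N=\{0,\pm1,\dots,\pm\mathcal S\}^N$ and, for $\beta\ge 0$, $h\ge 0$, $D\in\mathbb R$, and i.i.d. standard Gaussians $g_{i,j}$ $(1\le i<j\le N)$, let $$H_N(\sigma)=\frac{\beta}{\sqrt N}\sum_{i<j}g_{i,j}\sigma_i\sigma_j+D\sum_i\sigma_i^2+h\sum_i\sigma_i .$$ Let $G(\sigma)=e^{H_N(\sigma)}/\sum_{\tau\in\Sigma_N} e^{H_N(\tau)}$ be the Gibbs measure, let $\langle f\rangle$ be the average of a function $f$ of $n$ replicas $\sigma^1,\dots,\sigma^n$ under $G^{\otimes n}$, and let $\nu(f)=\mathbb E\langle f\rangle$, the expectation being over the $g_{i,j}$. Let $R_{k,l}=\frac1N\sum_i\sigma^k_i\sigma^l_i$. For $p,q\in\mathbb R$, $q\ge 0$, and a function $f$ of $\epsilon_1,\dots,\epsilon_n\in\{0,\pm1,\dots,\pm\mathcal S\}$, let $\nu_0(f)=\mathbb E_\eta\langle f\rangle_0$, where $\eta\sim N(0,1)$ and, given $\eta$,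 $\langle\cdot\rangle_0$ is the average over independent $\epsilon_1,\dots,\epsilon_n$, each with probability weights proportional to $$\exp\Bigl(\beta\eta\sqrt q\,\epsilon+\tfrac{\beta^2}{2}(p-q)\epsilon^2+D\epsilon^2+h\epsilon\Bigr).$$ Put $A=\nu_0\bigl((\epsilon_1-\epsilon_3)(\epsilon_2-\epsilon_4)\epsilon_1\epsilon_2\bigr)$. With $b_i=\langle\sigma_i\rangle$ and $\tilde b_i=\langle\sigma_i^2\rangle$ (functions of the $g_{i,j}$), define $$T_{k,l}=\frac1N\sum_i(\sigma^k_i-b_i)(\sigma^l_i-b_i),\quad T_k=\frac1N\sum_i(\sigma^k_i-b_i)b_i,\quad T=\frac1N\sum_i b_i^2-q,$$ $$S_k=\frac1N\sum_i\bigl((\sigma^k_i)^2-\tilde b_i\bigr),\quad S=\frac1N\sum_i\tilde b_i-p,$$ so that $R_{k,l}-q=T_{k,l}+T_k+T_l+T$ for $k\neq l$ and $R_{k,k}-p=S_k+S$. **Theorem.** There is $\beta'>0$, depending only on $\mathcal S$, such that for all $0\le\beta<\beta'$, $h\ge 0$ and $D\in\mathbb R$ the following holds. There is a unique pair $(p,q)$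 with $p=\nu_0(\epsilon_1^2)$ and $q=\nu_0(\epsilon_1\epsilon_2)$. For this pair, $\nu((R_{1,2}-q)^2)$ and $\nu((R_{1,1}-p)^2)$ are at most $C/N$ for all $N\ge 1$ with some $C$ not depending on $N$; moreover $A\ge 0$ and $\beta^2A<1$, so that $$A_2=\sqrt{\frac{A}{N(1-\beta^2A)}}$$ is well defined. For every $n$ and all nonnegative integers $h(k,l)$ $(1\le k<l\le n)$, $h(k)$, $h'(k)$ $(1\le k\le n)$, $h_0$, $h_0'$, with $$H=\sum_{k<l}h(k,l)+\sum_kh(k)+\sum_kh'(k)+h_0+h_0',$$ there is a constant $K$ not depending on $N$ such that for all $N\ge1$ $$\left|\,\nu\Bigl(\prod_{k<l}T_{k,l}^{h(k,l)}\prod_kT_k^{h(k)}\,T^{h_0}\prod_kS_k^{h'(k)}\,S^{h_0'}\Bigr)-\prod_{k<l}a(h(k,l))\,A_2^{h(k,l)}\;\nu\Bigl(\prod_kT_k^{h(k)}\,T^{h_0}\prod_kS_k^{h'(k)}\,S^{h_0'}\Bigr)\right|\le K\,N^{-(H+1)/2},$$ where $a(x)=\mathbb E[g^x]$ with $g\sim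 N(0,1)$. -/

import Mathlib

open MeasureTheory ProbabilityTheory

noncomputable section

namespace GS

/-! ### Gibbs measures on finite sets and replica averages -/

/-- Gibbs probability of `x` for the (log-)weight `E` on a finite set. -/
def gibbsProb {α : Type} [Fintype α] (E : α → ℝ) (x : α) : ℝ :=
  Real.exp (E x) / ∑ y, Real.exp (E y)

/-- Average of a function of `n` replicas under the `n`-fold product Gibbs measure. -/
def replicaAvg {α : Type} [Fintype α] (E : α → ℝ) (n : ℕ) (f : (Fin n → α) → ℝ) : ℝ :=
  ∑ x : Fin n → α, f x * ∏ k, gibbsProb E (x k)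

/-- Average of a function of one replica under the Gibbs measure. -/
def gibbsAvg {α : Type} [Fintype α] (E : α → ℝ) (f : α → ℝ) : ℝ :=
  ∑ x, f x * gibbsProb E x

/-! ### The Ghatak-Sherrington model -/

/-- The set of spin values `{0, ±1, …, ±S}`. -/
abbrev Spin (S : ℕ) : Type := {z : ℤ // z ∈ Finset.Icc (-(S : ℤ)) (S : ℤ)}

/-- A spin as a real number. -/
def Spin.toReal {S : ℕ} (s : Spin S) : ℝ := ((s : ℤ) : ℝ)

/-- Configurations of `N` spins. -/
abbrev Config (S N : ℕ) : Type := Fin N → Spin S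

/-- Couplings `g i j`, one for each pair of sites `i < j`. -/
abbrev Disorder (N : ℕ) : Type := {e : Fin N × Fin N // e.1 < e.2} → ℝ

/-- The couplings are i.i.d. standard Gaussian. -/
def disorderLaw (N : ℕ) : Measure (Disorder N) :=
  Measure.pi fun _ => gaussianReal 0 1

/-- The Hamiltonian
`β / √N * ∑_{i<j} g i j σ i σ j + D * ∑ i, σ i ^ 2 + h * ∑ i, σ i`;
the Gibbs measure has weights proportional to its exponential. -/
def hamiltonian (S N : ℕ) (β h D : ℝ) (g : Disorder N) (σ : Config S N) : ℝ :=
  β / Real.sqrt N * (∑ e, g e * (σ e.1.1).toReal * (σ e.1.2).toReal)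
    + D * ∑ i, (σ i).toReal ^ 2 + h * ∑ i, (σ i).toReal

/-- `ν(f) = 𝔼⟨f⟩` for a function `f` of the couplings and of `n` replicas. -/
def nu (S N : ℕ) (β h D : ℝ) (n : ℕ) (f : Disorder N → (Fin n → Config S N) → ℝ) : ℝ :=
  ∫ g, replicaAvg (hamiltonian S N β h D g) n (f g) ∂disorderLaw N

/-- The overlap `N⁻¹ ∑ i, σ i τ i`; the self-overlap when `σ = τ`. -/
def overlap {S N : ℕ} (σ τ : Config S N) : ℝ :=
  (1 / (N : ℝ)) * ∑ i, (σ i).toReal * (τ i).toReal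

/-! ### The decoupled last spin (the cavity system at time `0`) -/

/-- The energy of the last spin at time `0` of the cavity interpolation, where it is independent
of all other spins; `η` is the Gaussian variable of the interpolation. -/
def cavityEnergy (S : ℕ) (β h D p q η : ℝ) (s : Spin S) : ℝ :=
  s.toReal * (β * η * Real.sqrt q) + β ^ 2 / 2 * (p - q) * s.toReal ^ 2
    + D * s.toReal ^ 2 + h * s.toReal

/-- `ν₀(f)` for a function `f` of the last spins of `n` replicas. -/
def nu0 (S : ℕ) (β h D p q : ℝ) (n : ℕ) (f : (Fin n → ℝ) → ℝ) : ℝ :=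
  ∫ η, replicaAvg (cavityEnergy S β h D p q η) n (fun ε => f fun k => (ε k).toReal)
    ∂gaussianReal 0 1

/-- The replica symmetric equations `p = ν₀(ε₁²)`, `q = ν₀(ε₁ ε₂)`. -/
def IsFixedPoint (S : ℕ) (β h D p q : ℝ) : Prop :=
  p = nu0 S β h D p q 1 (fun ε => ε 0 ^ 2) ∧ q = nu0 S β h D p q 2 (fun ε => ε 0 * ε 1)

/-- The constant `A = ν₀((ε₁ - ε₃) (ε₂ - ε₄) ε₁ ε₂)`. -/
def constA (S : ℕ) (β h D p q : ℝ) : ℝ :=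
  nu0 S β h D p q 4 fun ε => (ε 0 - ε 2) * (ε 1 - ε 3) * (ε 0 * ε 1)

/-- `A₂`, the nonnegative square root of `A / (N (1 - β² A))`. -/
def A₂ (S N : ℕ) (β h D p q : ℝ) : ℝ :=
  Real.sqrt (constA S β h D p q / (N * (1 - β ^ 2 * constA S β h D p q)))

/-- The moment `a(x) = 𝔼 g ^ x` of a standard Gaussian. -/
def gaussMoment (x : ℕ) : ℝ := ∫ g, g ^ x ∂gaussianReal 0 1

/-! ### The basis variables, as functions of the energy `E` of the system -/

/-- `b i = ⟨σ i⟩`. -/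
def spinMean {S N : ℕ} (E : Config S N → ℝ) (i : Fin N) : ℝ :=
  gibbsAvg E fun σ => (σ i).toReal

/-- `⟨(σ i)²⟩`. -/
def spinSqMean {S N : ℕ} (E : Config S N → ℝ) (i : Fin N) : ℝ :=
  gibbsAvg E fun σ => (σ i).toReal ^ 2

/-- `T_{k,l} = N⁻¹ ∑ i, (σᵏ i - b i) (σˡ i - b i)`. -/
def Tpair {S N n : ℕ} (E : Config S N → ℝ) (k l : Fin n) (σ : Fin n → Config S N) : ℝ :=
  (1 / (N : ℝ)) * ∑ i, ((σ k i).toReal - spinMean E i) * ((σ l i).toReal - spinMean E i)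

/-- `T_k = N⁻¹ ∑ i, (σᵏ i - b i) b i`. -/
def Tone {S N n : ℕ} (E : Config S N → ℝ) (k : Fin n) (σ : Fin n → Config S N) : ℝ :=
  (1 / (N : ℝ)) * ∑ i, ((σ k i).toReal - spinMean E i) * spinMean E i

/-- `T = N⁻¹ ∑ i, (b i)² - q`. -/
def Tzero {S N : ℕ} (E : Config S N → ℝ) (q : ℝ) : ℝ :=
  (1 / (N : ℝ)) * ∑ i, spinMean E i ^ 2 - q

/-- `S_k = N⁻¹ ∑ i, ((σᵏ i)² - ⟨(σ i)²⟩)`. -/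
def Sone {S N n : ℕ} (E : Config S N → ℝ) (k : Fin n) (σ : Fin n → Config S N) : ℝ :=
  (1 / (N : ℝ)) * ∑ i, ((σ k i).toReal ^ 2 - spinSqMean E i)

/-- `S = N⁻¹ ∑ i, ⟨(σ i)²⟩ - p`. -/
def Szero {S N : ℕ} (E : Config S N → ℝ) (p : ℝ) : ℝ :=
  (1 / (N : ℝ)) * ∑ i, spinSqMean E i - p

/-- The pairs `(k, l)` of replicas with `k < l`. -/
def pairs (n : ℕ) : Finset (Fin n × Fin n) := Finset.univ.filter fun e => e.1 < e.2

/-- The exponents of a mixed moment; `pair (k, l)` is used for `k < l` only. -/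
structure Exponents (n : ℕ) where
  /-- The exponent of `T_{k,l}`. -/
  pair : Fin n × Fin n → ℕ
  /-- The exponent of `T_k`. -/
  T₁ : Fin n → ℕ
  /-- The exponent of `S_k`. -/
  S₁ : Fin n → ℕ
  /-- The exponent of `T`. -/
  T₀ : ℕ
  /-- The exponent of `S`. -/
  S₀ : ℕ

/-- The total degree `H` of a mixed moment. -/
def Exponents.total {n : ℕ} (m : Exponents n) : ℕ :=
  ∑ e ∈ pairs n, m.pair e + ∑ k, m.T₁ k + ∑ k, m.S₁ k + m.T₀ + m.S₀

/-- `∏_{k<l} T_{k,l} ^ h(k,l)`. -/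
def pairMonomial {S N n : ℕ} (E : Config S N → ℝ) (m : Exponents n)
    (σ : Fin n → Config S N) : ℝ :=
  ∏ e ∈ pairs n, Tpair E e.1 e.2 σ ^ m.pair e

/-- `(∏ k, T_k ^ h(k)) T ^ h (∏ k, S_k ^ h'(k)) S ^ h'`. -/
def restMonomial {S N n : ℕ} (E : Config S N → ℝ) (p q : ℝ) (m : Exponents n)
    (σ : Fin n → Config S N) : ℝ :=
  (∏ k, Tone E k σ ^ m.T₁ k) * Tzero E q ^ m.T₀
    * (∏ k, Sone E k σ ^ m.S₁ k) * Szero E p ^ m.S₀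

end GS

end

/-!
The proof is a cavity computation, carried out to first order for an arbitrary product of linear
forms in the overlaps.

*Replicas instead of Gibbs means.* A variable such as `T_{k,l}` contains the means `⟨σ i⟩`. Giving
it two private replicas `a`, `b` replaces it by the linear form
`R_{k,l} - R_{k,b} - R_{a,l} + R_{a,b}`, whose average over `a` and `b` is `T_{k,l}`; the variables
`T_k`, `S_k`, `T`, `S` are averages of linear forms in the same way (`gibbsAvg_lin_factorForm`). With
two private replicas for every factor, a mixed moment is the average of a product of linear forms
in the centered overlaps (`nuAvg_prod_mixedForm`).

*Cavity interpolation.* For a site `i`, the couplings of `i` are multiplied by `sin θ` and an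
independent Gaussian field on the spin `i` by `cos θ`. At `θ = π / 2` this is the original
system; at `θ = 0` the site `i` is independent of the rest and distributed according to `ν₀`
(`cavNu_zero_mul`). Gaussian integration by parts gives the derivative in `θ` of an average: a factor
`β²`, and a combination of products of spins at `i` with centered overlaps (`hasDerivAt_cavNu`).
Each derivative therefore gains an overlap fluctuation, a factor of order `N ^ (-1 / 2)`.

*Concentration.* In an even moment of a centered overlap, one overlap is replaced by its
contribution from a single site. At `θ = 0` this has mean zero up to the dependence of the other
overlaps on the site, by the replica symmetric equations. The derivative is at most `β²` times a
moment of the same order, which is absorbed at high temperature. By induction on the order, the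
moment of order `2 r` is at most `C N ^ (-r)` (`exists_moment_le`).

*Recursion for the mixed moments.* Let one factor be `T_{k,l}` and replace it by its contribution
`(ε_k - ε_a) (ε_l - ε_b)` from one site. Since `a` and `b` occur in no other factor, exchanging `k`
with `a` or `l` with `b` changes the sign, which annihilates all the decoupled covariances but
those that produce the constant `A` (`nu0Avg_quartic`). To the order considered, the first
derivative reproduces `β² A` times the original moment, and the dependence of the other factors on
the site gives `A / N` for each other copy of `T_{k,l}`. Hence
`(1 - β² A) ν(T_{k,l} F) = (A / N) ∑ ν(F without one factor T_{k,l}) + O(N ^ (-(H + 1) / 2))`,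
where `H` is the degree of `T_{k,l} F` (`HighTemp.exists_recursion`). As
`A₂² (1 - β² A) = A / N`, this is the recursion `a(x + 2) = (x + 1) a(x)` of the Gaussian moments,
and induction on the number of factors gives the factorization (`HighTemp.exists_factorization`).

*The replica symmetric equations.* The same Gaussian interpolation, between two decoupled spins with
parameters `(p, q)` and `(p', q')`, shows that `ν₀` is Lipschitz in `(p, q)` with a constant of order
`β²`, so that the equations are a contraction (`exists_unique_isFixedPoint`).
-/

open MeasureTheory ProbabilityTheory

noncomputable section

namespace GS

/-! ### Replica averages over an arbitrary finite set of replicas -/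

theorem gibbsProb_nonneg {α : Type} [Fintype α] (E : α → ℝ) (x : α) : 0 ≤ gibbsProb E x := by
  unfold gibbsProb; positivity

theorem avg_weight_nonneg {α κ : Type} [Fintype α] [Fintype κ] (E : α → ℝ) (x : κ → α) :
    0 ≤ ∏ k, gibbsProb E (x k) :=
  Finset.prod_nonneg fun _ _ => gibbsProb_nonneg _ _

section Avg

variable {α : Type} [Fintype α] {κ κ' : Type} [Fintype κ] [DecidableEq κ] [Fintype κ']
  [DecidableEq κ']

/-- Average under the product Gibbs measure of a function of replicas that are indexed by an
arbitrary finite type; for `κ = Fin n` this is `replicaAvg`. -/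
def avg (E : α → ℝ) (f : (κ → α) → ℝ) : ℝ :=
  ∑ x : κ → α, f x * ∏ k, gibbsProb E (x k)

theorem sum_exp_pos [Nonempty α] (E : α → ℝ) : 0 < ∑ y, Real.exp (E y) :=
  Finset.sum_pos (fun _ _ => Real.exp_pos _) Finset.univ_nonempty

theorem sum_gibbsProb [Nonempty α] (E : α → ℝ) : ∑ x, gibbsProb E x = 1 := by
  simp only [gibbsProb, ← Finset.sum_div]
  exact div_self (sum_exp_pos E).ne'

theorem avg_add (E : α → ℝ) (f g : (κ → α) → ℝ) :
    avg E (fun x => f x + g x) = avg E f + avg E g := by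
  simp only [avg, add_mul, Finset.sum_add_distrib]

theorem avg_sub (E : α → ℝ) (f g : (κ → α) → ℝ) :
    avg E (fun x => f x - g x) = avg E f - avg E g := by
  simp only [avg, sub_mul, Finset.sum_sub_distrib]

theorem avg_const_mul (E : α → ℝ) (c : ℝ) (f : (κ → α) → ℝ) :
    avg E (fun x => c * f x) = c * avg E f := by
  simp only [avg, Finset.mul_sum, mul_assoc]

theorem avg_sum {ι : Type*} (s : Finset ι) (E : α → ℝ) (f : ι → (κ → α) → ℝ) :
    avg E (fun x => ∑ i ∈ s, f i x) = ∑ i ∈ s, avg E (f i) := by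
  simp only [avg, Finset.sum_mul]
  exact Finset.sum_comm

theorem avg_mono {E : α → ℝ} {f g : (κ → α) → ℝ} (h : ∀ x, f x ≤ g x) : avg E f ≤ avg E g :=
  Finset.sum_le_sum fun x _ => mul_le_mul_of_nonneg_right (h x) (avg_weight_nonneg E x)

theorem abs_avg_le (E : α → ℝ) (f : (κ → α) → ℝ) : |avg E f| ≤ avg E fun x => |f x| := by
  refine (Finset.abs_sum_le_sum_abs _ _).trans (le_of_eq ?_)
  refine Finset.sum_congr rfl fun x _ => ?_
  rw [abs_mul, abs_of_nonneg (avg_weight_nonneg E x)]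

/-- Under the product measure, the replicas are independent. -/
theorem avg_prod (E : α → ℝ) (f : κ → α → ℝ) :
    avg E (fun x => ∏ k, f k (x k)) = ∏ k, gibbsAvg E (f k) := by
  simp only [avg, gibbsAvg, ← Finset.prod_mul_distrib, Finset.prod_univ_sum, Fintype.piFinset_univ]

theorem avg_const [Nonempty α] (E : α → ℝ) (c : ℝ) : avg E (fun _ : κ → α => c) = c := by
  have := avg_prod E (fun (_ : κ) (_ : α) => (1 : ℝ))
  have h1 : gibbsAvg E (fun _ => (1 : ℝ)) = 1 := by simp [gibbsAvg, sum_gibbsProb]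
  have h2 := avg_const_mul E c (fun _ : κ → α => (1 : ℝ))
  simp only [Finset.prod_const_one, h1, mul_one] at this h2
  rw [h2, this, mul_one]

theorem abs_avg_le_of_abs_le [Nonempty α] {E : α → ℝ} {f : (κ → α) → ℝ} {C : ℝ}
    (h : ∀ x, |f x| ≤ C) : |avg E f| ≤ C :=
  (abs_avg_le E f).trans ((avg_mono h).trans (avg_const E C).le)

/-- A function of some of the replicas only has the same average if the others are discarded. -/
theorem avg_comp_injective [Nonempty α] (E : α → ℝ) {e : κ' → κ} (he : Function.Injective e)
    (f : (κ' → α) → ℝ) : avg E (fun x : κ → α => f (x ∘ e)) = avg E f := by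
  classical
  have key : ∀ y : κ' → α, ∑ x : κ → α with x ∘ e = y, ∏ k, gibbsProb E (x k)
      = ∏ j, gibbsProb E (y j) := by
    intro y
    let t : κ → Finset α := fun k => Finset.univ.filter fun a => ∀ j, e j = k → a = y j
    have h1 : (Finset.univ.filter fun x : κ → α => x ∘ e = y) = Fintype.piFinset t := by
      ext x
      simp only [Finset.mem_filter, Finset.mem_univ, true_and, Fintype.mem_piFinset, t]
      constructor
      · rintro h k j rfl
        exact congrFun h j
      · intro h
        funext j
        exact h (e j) j rfl
    rw [h1, ← Finset.prod_univ_sum]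
    have h2 : ∀ j, ∑ a ∈ t (e j), gibbsProb E a = gibbsProb E (y j) := by
      intro j
      have : t (e j) = {y j} := by
        ext a
        simp only [t, Finset.mem_filter, Finset.mem_univ, true_and, Finset.mem_singleton]
        constructor
        · intro h; exact h j rfl
        · rintro rfl j' hj'; rw [he hj']
      rw [this, Finset.sum_singleton]
    rw [← Finset.prod_congr rfl fun j _ => h2 j, ← Finset.prod_image (s := Finset.univ) (g := e)
      (f := fun k => ∑ a ∈ t k, gibbsProb E a) (fun _ _ _ _ h => he h)]
    refine (Finset.prod_subset (Finset.subset_univ _) fun k _ hk => ?_).symm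
    have : t k = Finset.univ := by
      ext a
      simp only [t, Finset.mem_filter, Finset.mem_univ, true_and, iff_true]
      intro j hj
      exact absurd (Finset.mem_image.2 ⟨j, Finset.mem_univ _, hj⟩) hk
    rw [this, sum_gibbsProb]
  unfold avg
  rw [← Finset.sum_fiberwise (s := Finset.univ) (g := fun x : κ → α => x ∘ e)]
  refine Finset.sum_congr rfl fun y _ => ?_
  rw [← key y, Finset.mul_sum]
  refine Finset.sum_congr rfl fun x hx => ?_
  show f (x ∘ e) * _ = _
  rw [(Finset.mem_filter.1 hx).2]

/-- One replica of `Option κ` may be averaged out first. -/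
theorem avg_option (E : α → ℝ) (F : (κ → α) → α → ℝ) :
    avg E (fun x : Option κ → α => F (fun k => x (some k)) (x none))
      = avg E (fun x : κ → α => gibbsAvg E (F x)) := by
  unfold avg gibbsAvg
  rw [Fintype.sum_equiv (Equiv.piOptionEquivProd (β := fun _ => α)) _
    (fun z => F z.2 z.1 * (gibbsProb E z.1 * ∏ k, gibbsProb E (z.2 k)))]
  · rw [Fintype.sum_prod_type_right]
    refine Finset.sum_congr rfl fun x _ => ?_
    rw [Finset.sum_mul]
    refine Finset.sum_congr rfl fun y _ => ?_
    ring
  · intro x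
    rw [Fintype.prod_option]
    rfl

/-- Derivative of a replica average along a family of energies with derivative `E'`: each replica
contributes `E'` and one new replica compensates for the normalization. -/
theorem hasDerivAt_avg [Nonempty α] {E : ℝ → α → ℝ} {E' : α → ℝ} {θ : ℝ}
    (hE : ∀ x, HasDerivAt (fun t => E t x) (E' x) θ) (f : (κ → α) → ℝ) :
    HasDerivAt (fun t => avg (E t) f)
      (avg (E θ) fun x : Option κ → α => f (fun k => x (some k)) *
        (∑ k, E' (x (some k)) - Fintype.card κ * E' (x none))) θ := by
  have hZ : HasDerivAt (fun t => ∑ y, Real.exp (E t y)) (∑ y, Real.exp (E θ y) * E' y) θ :=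
    HasDerivAt.fun_sum fun y _ => (hE y).exp
  have hlog : HasDerivAt (fun t => Real.log (∑ y, Real.exp (E t y))) (gibbsAvg (E θ) E') θ := by
    convert hZ.log (sum_exp_pos _).ne' using 1
    simp only [gibbsAvg, gibbsProb, Finset.sum_div]
    exact Finset.sum_congr rfl fun _ _ => by ring
  have hw : ∀ (t : ℝ) (x : κ → α), ∏ k, gibbsProb (E t) (x k)
      = Real.exp (∑ k, (E t (x k) - Real.log (∑ y, Real.exp (E t y)))) := by
    intro t x
    rw [Real.exp_sum]
    refine Finset.prod_congr rfl fun k _ => ?_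
    rw [Real.exp_sub, Real.exp_log (sum_exp_pos _), gibbsProb]
  have hd : ∀ x : κ → α, HasDerivAt (fun t => ∏ k, gibbsProb (E t) (x k))
      ((∏ k, gibbsProb (E θ) (x k)) * ∑ k, (E' (x k) - gibbsAvg (E θ) E')) θ := by
    intro x
    simp only [hw]
    exact (HasDerivAt.fun_sum fun k _ => (hE (x k)).sub hlog).exp
  rw [avg_option (E θ) (fun (x : κ → α) y => f x * (∑ k, E' (x k) - Fintype.card κ * E' y))]
  unfold avg
  have hs : HasDerivAt (fun t => ∑ x : κ → α, f x * ∏ k, gibbsProb (E t) (x k))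
      (∑ x : κ → α, f x * ((∏ k, gibbsProb (E θ) (x k)) * ∑ k, (E' (x k) - gibbsAvg (E θ) E'))) θ :=
    HasDerivAt.fun_sum fun x _ => (hd x).const_mul (f x)
  convert hs using 1
  refine Finset.sum_congr rfl fun x _ => ?_
  have : gibbsAvg (E θ) (fun y => f x * (∑ k, E' (x k) - Fintype.card κ * E' y))
      = f x * ∑ k, (E' (x k) - gibbsAvg (E θ) E') := by
    simp only [gibbsAvg, Finset.sum_sub_distrib, Finset.sum_const, Finset.card_univ, nsmul_eq_mul]
    generalize ∑ k, E' (x k) = c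
    calc _ = (f x * c) * ∑ y, gibbsProb (E θ) y
          - f x * (Fintype.card κ * ∑ y, E' y * gibbsProb (E θ) y) := by
          simp only [Finset.mul_sum, ← Finset.sum_sub_distrib]
          exact Finset.sum_congr rfl fun _ _ => by ring
      _ = _ := by rw [sum_gibbsProb]; ring
  show gibbsAvg (E θ) (fun y => f x * (∑ k, E' (x k) - Fintype.card κ * E' y)) * _ = _
  rw [this]; ring

/-- The replica average is continuous in the energy. -/
theorem continuous_avg [Nonempty α] {X : Type*} [TopologicalSpace X] {E : X → α → ℝ}
    (hE : ∀ x, Continuous fun t => E t x) (f : (κ → α) → ℝ) :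
    Continuous fun t => avg (E t) f := by
  unfold avg gibbsProb
  refine continuous_finsetSum _ fun x _ => continuous_const.mul
    (continuous_finsetProd _ fun k _ => ?_)
  exact (Real.continuous_exp.comp (hE _)).div
    (continuous_finsetSum _ fun y _ => Real.continuous_exp.comp (hE y)) fun t => (sum_exp_pos _).ne'

end Avg

/-- If the energy of a system with two independent components is a sum, averages of products
factorize. -/
theorem avg_prod_mul {α α₁ α₂ κ : Type} [Fintype α] [Fintype α₁] [Fintype α₂] [Fintype κ]
    [DecidableEq κ] (e : α ≃ α₁ × α₂) (E₁ : α₁ → ℝ) (E₂ : α₂ → ℝ) {E : α → ℝ}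
    (hE : ∀ x, E x = E₁ (e x).1 + E₂ (e x).2) (f₁ : (κ → α₁) → ℝ) (f₂ : (κ → α₂) → ℝ) :
    avg E (fun x => f₁ (fun k => (e (x k)).1) * f₂ (fun k => (e (x k)).2))
      = avg E₁ f₁ * avg E₂ f₂ := by
  have hg : ∀ x, gibbsProb E x = gibbsProb E₁ (e x).1 * gibbsProb E₂ (e x).2 := by
    intro x
    have : ∑ y, Real.exp (E y) = (∑ y, Real.exp (E₁ y)) * ∑ y, Real.exp (E₂ y) := by
      rw [Fintype.sum_mul_sum, ← Fintype.sum_prod_type']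
      exact Fintype.sum_equiv e _ _ fun y => by rw [hE, Real.exp_add]
    rw [gibbsProb, this, hE, Real.exp_add, gibbsProb, gibbsProb, mul_div_mul_comm]
  let e' : (κ → α) ≃ (κ → α₁) × (κ → α₂) :=
    (Equiv.arrowCongr (Equiv.refl κ) e).trans (Equiv.arrowProdEquivProdArrow κ (fun _ => α₁) (fun _ => α₂))
  unfold avg
  rw [Fintype.sum_mul_sum, ← Fintype.sum_prod_type']
  refine Fintype.sum_equiv e' _ _ fun x => ?_
  simp only [hg, Finset.prod_mul_distrib]
  show _ = f₁ (fun k => (e (x k)).1) * (∏ k, gibbsProb E₁ (e (x k)).1)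
    * (f₂ (fun k => (e (x k)).2) * ∏ k, gibbsProb E₂ (e (x k)).2)
  ring

/-! ### Gaussian integration by parts -/

/-- Gaussian integration by parts (Stein's identity) on the line. -/
theorem integral_id_mul_gaussianReal {ψ ψ' : ℝ → ℝ} (hψ : ∀ y, HasDerivAt ψ (ψ' y) y)
    (h₀ : Integrable ψ (gaussianReal 0 1)) (h₁ : Integrable (fun y => y * ψ y) (gaussianReal 0 1))
    (h₂ : Integrable ψ' (gaussianReal 0 1)) :
    ∫ y, y * ψ y ∂gaussianReal 0 1 = ∫ y, ψ' y ∂gaussianReal 0 1 := by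
  have hpdf : ∀ y, gaussianPDFReal 0 1 y = (Real.sqrt (2 * Real.pi))⁻¹ * Real.exp (-(1 / 2) * y ^ 2) := by
    intro y
    simp only [gaussianPDFReal, NNReal.coe_one, mul_one, sub_zero]
    congr 2; ring
  have hder : ∀ y, HasDerivAt (gaussianPDFReal 0 1) (-(y * gaussianPDFReal 0 1 y)) y := by
    intro y
    have h := ((hasDerivAt_pow 2 y).const_mul (-(1 / 2 : ℝ))).exp.const_mul
      (Real.sqrt (2 * Real.pi))⁻¹
    rw [← funext hpdf] at h
    refine h.congr_deriv ?_
    rw [hpdf]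
    simp only [Nat.cast_ofNat, Nat.add_one_sub_one, pow_one]
    ring
  have hiff : ∀ F : ℝ → ℝ, Integrable F (gaussianReal 0 1) →
      Integrable fun y => gaussianPDFReal 0 1 y * F y := by
    intro F hF
    rw [gaussianReal_of_var_ne_zero 0 one_ne_zero, integrable_withDensity_iff_integrable_smul'
      (measurable_gaussianPDF 0 1) (Filter.Eventually.of_forall fun y => gaussianPDF_lt_top)] at hF
    simpa only [toReal_gaussianPDF, smul_eq_mul] using hF
  have key := integral_mul_deriv_eq_deriv_mul_of_integrable (u := ψ) (v := gaussianPDFReal 0 1)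
    (u' := ψ') (v' := fun y => -(y * gaussianPDFReal 0 1 y)) (fun y _ => hψ y) (fun y _ => hder y)
    ((hiff _ h₁).neg.congr (Filter.Eventually.of_forall fun y => by
      simp only [Pi.neg_apply, Pi.mul_apply]; ring))
    ((hiff _ h₂).congr (Filter.Eventually.of_forall fun y => mul_comm _ _))
    ((hiff _ h₀).congr (Filter.Eventually.of_forall fun y => mul_comm _ _))
  rw [integral_gaussianReal_eq_integral_smul one_ne_zero,
    integral_gaussianReal_eq_integral_smul one_ne_zero]
  have e1 : ∫ y, gaussianPDFReal 0 1 y • (y * ψ y)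
      = -∫ y, ψ y * -(y * gaussianPDFReal 0 1 y) := by
    rw [← integral_neg]
    exact integral_congr_ae (Filter.Eventually.of_forall fun y => by simp; ring)
  rw [e1, key, neg_neg]
  exact integral_congr_ae (Filter.Eventually.of_forall fun y => by simp; ring)

/-- The law of a family of independent standard Gaussian variables. -/
abbrev stdGaussian (ι : Type) [Fintype ι] : Measure (ι → ℝ) := Measure.pi fun _ => gaussianReal 0 1

section Pi

variable {ι : Type} [Fintype ι]

/-- Resampling one coordinate preserves the product measure. -/
theorem measurePreserving_update [DecidableEq ι] (i : ι) :
    MeasurePreserving (fun z : (ι → ℝ) × ℝ => Function.update z.1 i z.2)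
      ((stdGaussian ι).prod (gaussianReal 0 1)) (stdGaussian ι) := by
  have hm : Measurable fun z : (ι → ℝ) × ℝ => Function.update z.1 i z.2 := by
    rw [measurable_pi_iff]
    intro j
    by_cases h : j = i
    · subst h; simpa using measurable_snd
    · simp only [Function.update_of_ne h]
      exact (measurable_pi_apply j).comp measurable_fst
  refine ⟨hm, ?_⟩
  refine (Measure.pi_eq fun s hs => ?_).symm
  rw [Measure.map_apply hm (MeasurableSet.univ_pi hs)]
  have : (fun z : (ι → ℝ) × ℝ => Function.update z.1 i z.2) ⁻¹' Set.univ.pi s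
      = (Set.univ.pi (Function.update s i Set.univ)) ×ˢ s i := by
    ext z
    simp only [Set.mem_preimage, Set.mem_pi, Set.mem_univ, true_implies, Set.mem_prod]
    constructor
    · intro h
      refine ⟨fun j => ?_, by simpa using h i⟩
      by_cases hj : j = i
      · subst hj; simp
      · simpa [Function.update_of_ne hj] using h j
    · rintro ⟨h1, h2⟩ j
      by_cases hj : j = i
      · subst hj; simpa using h2
      · simpa [Function.update_of_ne hj] using h1 j
  rw [this, Measure.prod_prod, Measure.pi_pi, ← Finset.prod_erase_mul _ _ (Finset.mem_univ i),
    ← Finset.prod_erase_mul _ _ (Finset.mem_univ i)]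
  simp only [Function.update_self, measure_univ, mul_one]
  congr 1
  refine Finset.prod_congr rfl fun j hj => ?_
  rw [Function.update_of_ne (Finset.ne_of_mem_erase hj)]

theorem integrable_eval_stdGaussian (i : ι) : Integrable (fun g : ι → ℝ => g i) (stdGaussian ι) := by
  have h : Integrable (id : ℝ → ℝ) (gaussianReal 0 1) :=
    memLp_one_iff_integrable.1 (memLp_id_gaussianReal 1)
  exact (measurePreserving_eval (fun _ : ι => gaussianReal 0 1) i).integrable_comp_of_integrable h

theorem integrable_of_continuous_of_abs_le {X : Type*} [TopologicalSpace X] [MeasurableSpace X]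
    [OpensMeasurableSpace X] {μ : Measure X} [IsFiniteMeasure μ] {ψ : X → ℝ} (hψ : Continuous ψ)
    {C : ℝ} (hC : ∀ g, |ψ g| ≤ C) : Integrable ψ μ :=
  Integrable.of_bound hψ.measurable.aestronglyMeasurable C (Filter.Eventually.of_forall hC)

theorem integrable_eval_mul_stdGaussian (i : ι) {ψ : (ι → ℝ) → ℝ} (hψ : Continuous ψ) {C : ℝ}
    (hC : ∀ g, |ψ g| ≤ C) : Integrable (fun g => g i * ψ g) (stdGaussian ι) :=
  (integrable_eval_stdGaussian i).mul_bdd hψ.measurable.aestronglyMeasurable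
    (Filter.Eventually.of_forall hC)

/-- Gaussian integration by parts with respect to one of several independent variables. -/
theorem integral_eval_mul_stdGaussian [DecidableEq ι] (i : ι) {ψ ψ' : (ι → ℝ) → ℝ}
    (hd : ∀ g y, HasDerivAt (fun t => ψ (Function.update g i t)) (ψ' (Function.update g i y)) y)
    (hψ : Continuous ψ) (hψ' : Continuous ψ') {C C' : ℝ} (hC : ∀ g, |ψ g| ≤ C)
    (hC' : ∀ g, |ψ' g| ≤ C') :
    ∫ g, g i * ψ g ∂stdGaussian ι = ∫ g, ψ' g ∂stdGaussian ι := by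
  have hmp := measurePreserving_update i
  have hcu : Continuous fun z : (ι → ℝ) × ℝ => Function.update z.1 i z.2 :=
    continuous_fst.update i continuous_snd
  have h1 := integrable_eval_mul_stdGaussian i hψ hC
  have h2 : Integrable ψ' (stdGaussian ι) := integrable_of_continuous_of_abs_le hψ' hC'
  have h1' : Integrable (fun z : (ι → ℝ) × ℝ => Function.update z.1 i z.2 i *
      ψ (Function.update z.1 i z.2)) ((stdGaussian ι).prod (gaussianReal 0 1)) :=
    hmp.integrable_comp_of_integrable h1
  have h2' : Integrable (fun z : (ι → ℝ) × ℝ => ψ' (Function.update z.1 i z.2))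
      ((stdGaussian ι).prod (gaussianReal 0 1)) :=
    hmp.integrable_comp_of_integrable h2
  rw [← hmp.map_eq, integral_map hmp.measurable.aemeasurable (by rw [hmp.map_eq]; exact h1.1),
    integral_map hmp.measurable.aemeasurable (by rw [hmp.map_eq]; exact h2.1),
    integral_prod _ h1',
    integral_prod _ h2']
  refine integral_congr_ae (Filter.Eventually.of_forall fun g => ?_)
  simp only [Function.update_self]
  have hcy : Continuous fun y : ℝ => Function.update g i y := continuous_const.update i continuous_id
  have hid : Integrable (fun y : ℝ => y) (gaussianReal 0 1) :=
    memLp_one_iff_integrable.1 (memLp_id_gaussianReal 1)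
  exact integral_id_mul_gaussianReal (hd g)
    (integrable_of_continuous_of_abs_le (hψ.comp hcy) fun y => hC _)
    (hid.mul_bdd (hψ.comp hcy).measurable.aestronglyMeasurable
      (Filter.Eventually.of_forall fun y => hC _))
    (integrable_of_continuous_of_abs_le (hψ'.comp hcy) fun y => hC' _)

end Pi

theorem integrable_pow_gaussianReal (n : ℕ) : Integrable (fun y : ℝ => y ^ n) (gaussianReal 0 1) :=
  integrable_pow_of_mem_interior_integrableExpSet
    (by rw [integrableExpSet_fun_id_gaussianReal]; simp) n

theorem gaussMoment_zero : gaussMoment 0 = 1 := by simp [gaussMoment]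

theorem gaussMoment_one : gaussMoment 1 = 0 := by
  simp [gaussMoment, integral_id_gaussianReal]

theorem gaussMoment_add_two (n : ℕ) : gaussMoment (n + 2) = (n + 1) * gaussMoment n := by
  have h := integral_id_mul_gaussianReal (ψ := fun y => y ^ (n + 1))
    (ψ' := fun y => ((n : ℝ) + 1) * y ^ n) (fun y => by simpa using hasDerivAt_pow (n + 1) y)
    (integrable_pow_gaussianReal _)
    (by simpa only [← pow_succ'] using integrable_pow_gaussianReal (n + 1 + 1))
    ((integrable_pow_gaussianReal n).const_mul _)
  rw [integral_const_mul] at h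
  simpa only [gaussMoment, ← pow_succ'] using h

/-! ### Gaussian interpolation of Gibbs averages -/

section Interpolation

/-- The energy `∑ i, c i * g i * φ i x + b x`, which is Gaussian in the disorder `g`. -/
def gaussEnergy {α ι : Type} [Fintype ι] (c : ι → ℝ) (φ : ι → α → ℝ) (b : α → ℝ) (g : ι → ℝ) (x : α) : ℝ :=
  ∑ i, c i * g i * φ i x + b x

/-- Coefficients of the first new replica in the derivative of a Gaussian interpolation: the
replicas `some (some k)` are the original ones, `some none` comes from differentiating the
energy. -/
def leftCoef (κ : Type) [Fintype κ] : Option (Option κ) → ℝ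
  | none => 0
  | some none => -(Fintype.card κ : ℝ)
  | some (some _) => 1

/-- Coefficients of the second new replica `none` in the derivative of a Gaussian interpolation,
which comes from integrating by parts. -/
def rightCoef (κ : Type) [Fintype κ] : Option (Option κ) → ℝ
  | none => -((Fintype.card κ : ℝ) + 1)
  | some _ => 1

theorem sum_leftCoef_mul {κ : Type} [Fintype κ] (F : Option (Option κ) → ℝ) :
    ∑ k, leftCoef κ k * F k = ∑ k, F (some (some k)) - Fintype.card κ * F (some none) := by
  simp [Fintype.sum_option, leftCoef]; ring

theorem sum_rightCoef_mul {κ : Type} [Fintype κ] (F : Option (Option κ) → ℝ) :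
    ∑ k, rightCoef κ k * F k
      = ∑ k, F (some k) - Fintype.card (Option κ) * F none := by
  simp [Fintype.sum_option, rightCoef]; ring

theorem leftCoef_mul_rightCoef {κ : Type} [Fintype κ] (k : Option (Option κ)) :
    leftCoef κ k * rightCoef κ k = leftCoef κ k := by
  rcases k with _ | _ | k <;> simp [leftCoef, rightCoef]

variable {α ι κ : Type} [Fintype α] [Fintype ι] [Fintype κ] [DecidableEq κ]

/-- Extension of a function of the replicas `κ` to two more replicas. -/
def lift₂ (f : (κ → α) → ℝ) (x : Option (Option κ) → α) : ℝ := f fun k => x (some (some k))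

theorem continuous_avg_gaussEnergy [Nonempty α] (c : ι → ℝ) (φ : ι → α → ℝ) (b : α → ℝ)
    (f : (κ → α) → ℝ) : Continuous fun g => avg (gaussEnergy c φ b g) f :=
  continuous_avg (fun x => by unfold gaussEnergy; fun_prop) f

theorem abs_avg_le_sum [Nonempty α] (E : α → ℝ) (f : (κ → α) → ℝ) : |avg E f| ≤ ∑ x, |f x| :=
  abs_avg_le_of_abs_le fun x =>
    Finset.single_le_sum (f := fun x => |f x|) (fun _ _ => abs_nonneg _) (Finset.mem_univ x)

theorem integrable_avg_gaussEnergy [Nonempty α] (c : ι → ℝ) (φ : ι → α → ℝ) (b : α → ℝ)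
    (f : (κ → α) → ℝ) : Integrable (fun g => avg (gaussEnergy c φ b g) f) (stdGaussian ι) :=
  integrable_of_continuous_of_abs_le (continuous_avg_gaussEnergy c φ b f)
    fun _ => abs_avg_le_sum _ f

/-- Integration by parts in a Gibbs average: one more replica appears. -/
theorem integral_eval_mul_avg [Nonempty α] [DecidableEq ι] (c : ι → ℝ) (φ : ι → α → ℝ)
    (b : α → ℝ) (i : ι) (f : (κ → α) → ℝ) :
    ∫ g, g i * avg (gaussEnergy c φ b g) f ∂stdGaussian ι
      = ∫ g, avg (gaussEnergy c φ b g) (fun x : Option κ → α => f (fun k => x (some k)) *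
        (c i * (∑ k, φ i (x (some k)) - Fintype.card κ * φ i (x none)))) ∂stdGaussian ι := by
  refine integral_eval_mul_stdGaussian i (fun g y => ?_) (continuous_avg_gaussEnergy c φ b _)
    (continuous_avg_gaussEnergy c φ b _) (fun g => abs_avg_le_sum _ _)
    (fun g => abs_avg_le_sum _ _)
  have hE : ∀ x, HasDerivAt (fun t => gaussEnergy c φ b (Function.update g i t) x)
      (c i * φ i x) y := by
    intro x
    have h : ∀ j, HasDerivAt (fun t => c j * Function.update g i t j * φ j x)
        (if j = i then c j * φ j x else 0) y := by
      intro j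
      by_cases hj : j = i
      · subst hj
        simpa using ((hasDerivAt_id y).const_mul (c j)).mul_const (φ j x)
      · simpa [Function.update_of_ne hj, hj] using hasDerivAt_const y (c j * g j * φ j x)
    simpa [gaussEnergy] using (HasDerivAt.fun_sum fun j (_ : j ∈ Finset.univ) => h j).add_const (b x)
  refine (hasDerivAt_avg hE f).congr_deriv ?_
  congr 1
  funext x
  rw [← Finset.mul_sum]
  ring

/-- Derivative of `𝔼⟨f⟩` along a Gaussian interpolation. The Gaussian part of the energy enters
through the derivative of its covariance, the deterministic part on the diagonal only. -/
theorem hasDerivAt_integral_avg [Nonempty α] {c c' : ι → ℝ → ℝ} (φ : ι → α → ℝ)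
    {b b' : ℝ → α → ℝ} (hc : ∀ i t, HasDerivAt (c i) (c' i t) t) (hc' : ∀ i t, |c' i t| ≤ 1)
    (hb : ∀ x t, HasDerivAt (fun s => b s x) (b' t x) t) {B : ℝ} (hb' : ∀ t x, |b' t x| ≤ B)
    (f : (κ → α) → ℝ) (θ : ℝ) :
    HasDerivAt (fun t => ∫ g, avg (gaussEnergy (fun i => c i t) φ (b t) g) f ∂stdGaussian ι)
      (∫ g, avg (gaussEnergy (fun i => c i θ) φ (b θ) g) (fun x : Option (Option κ) → α =>
        lift₂ f x * ∑ k, ∑ l, leftCoef κ k * rightCoef κ l *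
          (∑ i, c i θ * c' i θ * φ i (x k) * φ i (x l) + if k = l then b' θ (x k) else 0))
        ∂stdGaussian ι) θ := by
  classical
  set n : ℝ := (Fintype.card κ : ℝ) with hn
  let Lin : (α → ℝ) → (Option κ → α) → ℝ := fun ψ x =>
    f (fun k => x (some k)) * (∑ k, ψ (x (some k)) - n * ψ (x none))
  let E' : ℝ → (ι → ℝ) → α → ℝ := fun t g x => ∑ i, c' i t * g i * φ i x + b' t x
  have hE : ∀ g x t, HasDerivAt (fun s => gaussEnergy (fun i => c i s) φ (b s) g x) (E' t g x) t :=
    fun g x t => (HasDerivAt.fun_sum fun i _ => ((hc i t).mul_const (g i)).mul_const (φ i x)).add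
      (hb x t)
  have hlin : ∀ t g x, Lin (E' t g) x = ∑ i, c' i t * g i * Lin (φ i) x + Lin (b' t) x := by
    intro t g x
    simp only [Lin, E', Finset.sum_add_distrib]
    rw [Finset.sum_comm]
    simp only [← Finset.mul_sum]
    have : ∑ i, c' i t * g i * (f (fun k => x (some k)) * (∑ k, φ i (x (some k)) - n * φ i (x none)))
        = f (fun k => x (some k)) * (∑ i, c' i t * g i * ∑ k, φ i (x (some k))
          - n * ∑ i, c' i t * g i * φ i (x none)) := by
      rw [Finset.mul_sum, ← Finset.sum_sub_distrib, Finset.mul_sum]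
      exact Finset.sum_congr rfl fun i _ => by ring
    rw [this]; ring
  have havg : ∀ t g, avg (gaussEnergy (fun i => c i t) φ (b t) g) (Lin (E' t g))
      = ∑ i, c' i t * (g i * avg (gaussEnergy (fun i => c i t) φ (b t) g) (Lin (φ i)))
        + avg (gaussEnergy (fun i => c i t) φ (b t) g) (Lin (b' t)) := by
    intro t g
    rw [show Lin (E' t g) = fun x => ∑ i, c' i t * g i * Lin (φ i) x + Lin (b' t) x from
      funext (hlin t g), avg_add, avg_sum]
    simp only [avg_const_mul, mul_assoc]
  have hcts : ∀ t, Continuous fun g => avg (gaussEnergy (fun i => c i t) φ (b t) g) (Lin (E' t g)) := by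
    intro t
    simp only [havg]
    exact (continuous_finsetSum _ fun i _ => continuous_const.mul ((continuous_apply i).mul
      (continuous_avg_gaussEnergy _ _ _ _))).add (continuous_avg_gaussEnergy _ _ _ _)
  let Cf : ℝ := ∑ x, |f x|
  have hCf : ∀ x, |f x| ≤ Cf := fun x =>
    Finset.single_le_sum (f := fun x => |f x|) (fun _ _ => abs_nonneg _) (Finset.mem_univ x)
  have hCf0 : 0 ≤ Cf := Finset.sum_nonneg fun _ _ => abs_nonneg _
  have hn0 : 0 ≤ n := Nat.cast_nonneg _
  have hLinB : ∀ t x, |Lin (b' t) x| ≤ Cf * (n * B + n * B) := by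
    intro t x
    simp only [Lin, abs_mul]
    refine mul_le_mul (hCf _) ((abs_sub _ _).trans (add_le_add ?_ ?_)) (abs_nonneg _) hCf0
    · refine (Finset.abs_sum_le_sum_abs _ _).trans ((Finset.sum_le_sum fun k _ => hb' t _).trans ?_)
      simp [hn]
    · rw [abs_mul, abs_of_nonneg hn0]
      exact mul_le_mul_of_nonneg_left (hb' _ _) hn0
  have main := hasDerivAt_integral_of_dominated_loc_of_deriv_le (μ := stdGaussian ι)
    (F := fun t g => avg (gaussEnergy (fun i => c i t) φ (b t) g) f)
    (F' := fun t g => avg (gaussEnergy (fun i => c i t) φ (b t) g) (Lin (E' t g)))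
    (bound := fun g => ∑ i, |g i| * (∑ x, |Lin (φ i) x|) + Cf * (n * B + n * B))
    (x₀ := θ) (s := Set.univ) Filter.univ_mem
    (Filter.Eventually.of_forall fun t => (integrable_avg_gaussEnergy _ φ _ f).1)
    (integrable_avg_gaussEnergy _ φ _ f) (hcts θ).measurable.aestronglyMeasurable
    (Filter.Eventually.of_forall fun g t _ => ?_) ?_
    (Filter.Eventually.of_forall fun g t _ => hasDerivAt_avg (fun x => hE g x t) f)
  · refine main.2.congr_deriv ?_
    simp only [havg]
    rw [integral_add (integrable_finsetSum _ fun i _ => (integrable_eval_mul_stdGaussian i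
      (continuous_avg_gaussEnergy _ _ _ _) fun g => abs_avg_le_sum _ _).const_mul _)
      (integrable_avg_gaussEnergy _ _ _ _), integral_finsetSum _ fun i _ =>
      (integrable_eval_mul_stdGaussian i
      (continuous_avg_gaussEnergy _ _ _ _) fun g => abs_avg_le_sum _ _).const_mul _]
    simp only [integral_const_mul, integral_eval_mul_avg]
    simp only [← integral_const_mul, ← avg_const_mul]
    rw [← integral_finsetSum _ fun i _ => integrable_avg_gaussEnergy _ _ _ _,
      ← integral_add (integrable_finsetSum _ fun i _ => integrable_avg_gaussEnergy _ _ _ _)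
      (integrable_avg_gaussEnergy _ _ _ _)]
    congr 1
    funext g
    rw [← avg_sum, ← avg_comp_injective _ (Option.some_injective (Option κ)) (Lin (b' θ)), ← avg_add]
    congr 1
    funext x
    have e1 : ∑ k, ∑ l, leftCoef κ k * rightCoef κ l *
          (∑ i, c i θ * c' i θ * φ i (x k) * φ i (x l) + if k = l then b' θ (x k) else 0)
        = ∑ i, c i θ * c' i θ * ((∑ k, leftCoef κ k * φ i (x k)) * ∑ l, rightCoef κ l * φ i (x l))
          + ∑ k, leftCoef κ k * b' θ (x k) := by
      simp only [mul_add, Finset.sum_add_distrib]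
      congr 1
      · simp only [Finset.sum_mul_sum]
        simp only [Finset.mul_sum]
        rw [Finset.sum_congr rfl fun k _ => Finset.sum_comm, Finset.sum_comm]
        refine Finset.sum_congr rfl fun i _ => Finset.sum_congr rfl fun k _ =>
          Finset.sum_congr rfl fun l _ => by ring
      · refine Finset.sum_congr rfl fun k _ => ?_
        simp only [mul_ite, mul_zero, Finset.sum_ite_eq, Finset.mem_univ, if_true]
        rw [leftCoef_mul_rightCoef]
    rw [e1]
    simp only [sum_leftCoef_mul, sum_rightCoef_mul, lift₂, Lin, Function.comp, mul_add,
      Finset.mul_sum]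
    congr 1
    refine Finset.sum_congr rfl fun i _ => ?_
    ring
  · rw [havg]
    refine (abs_add_le _ _).trans (add_le_add ((Finset.abs_sum_le_sum_abs _ _).trans
      (Finset.sum_le_sum fun i _ => ?_)) (abs_avg_le_of_abs_le (hLinB t)))
    rw [abs_mul, abs_mul]
    calc _ ≤ 1 * (|g i| * ∑ x, |Lin (φ i) x|) := by
          gcongr
          · exact hc' i t
          · exact abs_avg_le_sum _ _
      _ = _ := one_mul _
  · exact (integrable_finsetSum _ fun i _ => (integrable_eval_stdGaussian i).abs.mul_const _).add
      (integrable_const _)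

end Interpolation

/-! ### Two estimates from a differential inequality -/

theorem abs_sub_le_of_abs_deriv_le {F F' : ℝ → ℝ} (hF : ∀ t, HasDerivAt F (F' t) t) {M : ℝ}
    (hM : ∀ t ∈ Set.Icc 0 (Real.pi / 2), |F' t| ≤ M) {t : ℝ} (ht : t ∈ Set.Icc 0 (Real.pi / 2)) :
    |F t - F 0| ≤ 2 * M := by
  have h0 : (0 : ℝ) ∈ Set.Icc 0 (Real.pi / 2) := ⟨le_rfl, by positivity⟩
  have h := (convex_Icc (0 : ℝ) (Real.pi / 2)).norm_image_sub_le_of_norm_hasDerivWithin_le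
    (fun x _ => (hF x).hasDerivWithinAt) hM h0 ht
  have hM0 : 0 ≤ M := (abs_nonneg _).trans (hM 0 h0)
  refine h.trans ?_
  rw [sub_zero, Real.norm_eq_abs, abs_of_nonneg ht.1, mul_comm]
  exact mul_le_mul_of_nonneg_right (by linarith [ht.2, Real.pi_le_four]) hM0

theorem le_exp_mul_of_abs_deriv_le {F F' : ℝ → ℝ} (hF : ∀ t, HasDerivAt F (F' t) t) {M : ℝ}
    (hM : ∀ t, |F' t| ≤ M * F t) {t s : ℝ} (hts : t ≤ s) : F t ≤ Real.exp (M * (s - t)) * F s := by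
  have hG : ∀ u, HasDerivAt (fun u => Real.exp (M * u) * F u)
      (Real.exp (M * u) * M * F u + Real.exp (M * u) * F' u) u := by
    intro u
    have h1 : HasDerivAt (fun u => Real.exp (M * u)) (Real.exp (M * u) * M) u := by
      simpa using ((hasDerivAt_id u).const_mul M).exp
    exact h1.mul (hF u)
  have hmono : Monotone fun u => Real.exp (M * u) * F u := by
    refine monotone_of_deriv_nonneg (fun u => (hG u).differentiableAt) fun u => ?_
    rw [(hG u).deriv]
    have := (abs_le.1 (hM u)).1
    have := Real.exp_pos (M * u)
    nlinarith
  have h := hmono hts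
  simp only at h
  rw [mul_sub, Real.exp_sub, div_mul_eq_mul_div, le_div_iff₀ (Real.exp_pos _)]
  linarith

/-! ### The cavity interpolation -/

/-- The spin `0`. -/
def Spin.zero (S : ℕ) : Spin S := ⟨0, by simp⟩

instance Spin.instNonempty (S : ℕ) : Nonempty (Spin S) := ⟨Spin.zero S⟩

theorem Spin.toReal_zero (S : ℕ) : (Spin.zero S).toReal = 0 := by simp [Spin.zero, Spin.toReal]

theorem Spin.abs_toReal_le {S : ℕ} (s : Spin S) : |s.toReal| ≤ S := by
  have h := Finset.mem_Icc.1 s.2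
  rw [abs_le, Spin.toReal]
  exact ⟨by exact_mod_cast h.1, by exact_mod_cast h.2⟩

/-- The pairs of sites `i < j`, which carry the couplings. -/
abbrev Edge (N : ℕ) : Type := {e : Fin N × Fin N // e.1 < e.2}

/-- The average over the couplings and over replicas indexed by an arbitrary finite type. -/
def nuAvg (S N : ℕ) (β h D : ℝ) {κ : Type} [Fintype κ] [DecidableEq κ]
    (f : (κ → Config S N) → ℝ) : ℝ :=
  ∫ g, avg (hamiltonian S N β h D g) f ∂stdGaussian (Edge N)

/-- The average at the decoupled site, over replicas indexed by an arbitrary finite type. -/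
def nu0Avg (S : ℕ) (β h D p q : ℝ) {κ : Type} [Fintype κ] [DecidableEq κ]
    (φ : (κ → ℝ) → ℝ) : ℝ :=
  ∫ η, avg (cavityEnergy S β h D p q η) (fun ε : κ → Spin S => φ fun k => (ε k).toReal)
    ∂gaussianReal 0 1

/-- The value at which the overlap of the replicas `k` and `l` concentrates. -/
def overlapLimit {κ : Type} [DecidableEq κ] (p q : ℝ) (k l : κ) : ℝ := if k = l then p else q

/-- The centered overlap of two replicas. -/
def rho {S N : ℕ} {κ : Type} [DecidableEq κ] (p q : ℝ) (k l : κ) (x : κ → Config S N) : ℝ :=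
  overlap (x k) (x l) - overlapLimit p q k l

/-- The centered overlap of two replicas without the contribution of the site `i`. -/
def rhoCav {S N : ℕ} {κ : Type} [DecidableEq κ] (p q : ℝ) (i : Fin N) (k l : κ)
    (x : κ → Config S N) : ℝ :=
  (1 / (N : ℝ)) * ∑ j ∈ Finset.univ.erase i, (x k j).toReal * (x l j).toReal - overlapLimit p q k l

/-- Functions of the replicas that do not depend on the spins at the site `i`. -/
def IndepSite {S N : ℕ} {κ : Type} (i : Fin N) (f : (κ → Config S N) → ℝ) : Prop :=
  ∀ x y, (∀ k j, j ≠ i → x k j = y k j) → f x = f y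

section Cavity

variable {S N : ℕ} (β h D p q : ℝ) (i : Fin N)

/-- Coefficients of the cavity interpolation: as `θ` decreases from `π / 2` to `0`, the couplings
of the site `i` are switched off and an independent Gaussian field at `i` is switched on. -/
def cavCoef : Edge N ⊕ Unit → ℝ → ℝ
  | Sum.inl e, θ => if e.1.1 = i ∨ e.1.2 = i then Real.sin θ else 1
  | Sum.inr _, θ => Real.cos θ

/-- The derivatives of the coefficients of the cavity interpolation. -/
def cavCoef' : Edge N ⊕ Unit → ℝ → ℝ
  | Sum.inl e, θ => if e.1.1 = i ∨ e.1.2 = i then Real.cos θ else 0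
  | Sum.inr _, θ => -Real.sin θ

/-- The functions of the spins that multiply the Gaussian variables. -/
def cavField : Edge N ⊕ Unit → Config S N → ℝ
  | Sum.inl e, x => β / Real.sqrt N * ((x e.1.1).toReal * (x e.1.2).toReal)
  | Sum.inr _, x => β * Real.sqrt q * (x i).toReal

/-- The deterministic part of the energy along the cavity interpolation. -/
def cavDet (θ : ℝ) (x : Config S N) : ℝ :=
  Real.cos θ ^ 2 * (β ^ 2 / 2 * (p - q) * (x i).toReal ^ 2)
    + (D * ∑ j, (x j).toReal ^ 2 + h * ∑ j, (x j).toReal)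

/-- The energy along the cavity interpolation. -/
def cavEnergy (θ : ℝ) (g : Edge N ⊕ Unit → ℝ) : Config S N → ℝ :=
  gaussEnergy (fun j => cavCoef i j θ) (cavField β q i) (cavDet β h D p q i θ) g

/-- The average `𝔼⟨f⟩` along the cavity interpolation: at `θ = π / 2` the original system, at
`θ = 0` a system whose site `i` is independent of all other sites. -/
def cavNu {κ : Type} [Fintype κ] [DecidableEq κ] (θ : ℝ) (f : (κ → Config S N) → ℝ) : ℝ :=
  ∫ g, avg (cavEnergy β h D p q i θ g) f ∂stdGaussian (Edge N ⊕ Unit)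

variable {κ κ' : Type} [Fintype κ] [DecidableEq κ] [Fintype κ'] [DecidableEq κ']

theorem cavNu_integrable (θ : ℝ) (f : (κ → Config S N) → ℝ) :
    Integrable (fun g => avg (cavEnergy β h D p q i θ g) f) (stdGaussian (Edge N ⊕ Unit)) :=
  integrable_avg_gaussEnergy _ _ _ f

theorem cavNu_add (θ : ℝ) (f g : (κ → Config S N) → ℝ) :
    cavNu β h D p q i θ (fun x => f x + g x) = cavNu β h D p q i θ f + cavNu β h D p q i θ g := by
  simp only [cavNu, avg_add]
  exact integral_add (cavNu_integrable _ _ _ _ _ _ _ _) (cavNu_integrable _ _ _ _ _ _ _ _)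

theorem cavNu_sub (θ : ℝ) (f g : (κ → Config S N) → ℝ) :
    cavNu β h D p q i θ (fun x => f x - g x) = cavNu β h D p q i θ f - cavNu β h D p q i θ g := by
  simp only [cavNu, avg_sub]
  exact integral_sub (cavNu_integrable _ _ _ _ _ _ _ _) (cavNu_integrable _ _ _ _ _ _ _ _)

theorem cavNu_const_mul (θ c : ℝ) (f : (κ → Config S N) → ℝ) :
    cavNu β h D p q i θ (fun x => c * f x) = c * cavNu β h D p q i θ f := by
  simp only [cavNu, avg_const_mul, integral_const_mul]

theorem cavNu_sum {J : Type*} (s : Finset J) (θ : ℝ) (f : J → (κ → Config S N) → ℝ) :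
    cavNu β h D p q i θ (fun x => ∑ j ∈ s, f j x) = ∑ j ∈ s, cavNu β h D p q i θ (f j) := by
  simp only [cavNu, avg_sum]
  exact integral_finsetSum _ fun j _ => cavNu_integrable _ _ _ _ _ _ _ _

theorem cavNu_mono (θ : ℝ) {f g : (κ → Config S N) → ℝ} (hfg : ∀ x, f x ≤ g x) :
    cavNu β h D p q i θ f ≤ cavNu β h D p q i θ g :=
  integral_mono (cavNu_integrable _ _ _ _ _ _ _ _) (cavNu_integrable _ _ _ _ _ _ _ _)
    fun _ => avg_mono hfg

theorem cavNu_const (θ c : ℝ) : cavNu β h D p q i θ (fun _ : κ → Config S N => c) = c := by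
  simp [cavNu, avg_const]

theorem abs_cavNu_le (θ : ℝ) {f g : (κ → Config S N) → ℝ} (hfg : ∀ x, |f x| ≤ g x) :
    |cavNu β h D p q i θ f| ≤ cavNu β h D p q i θ g := by
  rw [abs_le]
  constructor
  · have := cavNu_mono β h D p q i θ (f := fun x => (-1) * f x) (g := g)
      fun x => by linarith [(abs_le.1 (hfg x)).1]
    rw [cavNu_const_mul] at this
    linarith
  · exact cavNu_mono β h D p q i θ fun x => (abs_le.1 (hfg x)).2

theorem cavNu_nonneg (θ : ℝ) {f : (κ → Config S N) → ℝ} (hf : ∀ x, 0 ≤ f x) :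
    0 ≤ cavNu β h D p q i θ f := by
  rw [← cavNu_const β h D p q i (κ := κ) (S := S) θ 0]
  exact cavNu_mono β h D p q i θ hf

theorem cavNu_comp_injective (θ : ℝ) {e : κ' → κ} (he : Function.Injective e)
    (f : (κ' → Config S N) → ℝ) :
    cavNu β h D p q i θ (fun x : κ → Config S N => f (x ∘ e)) = cavNu β h D p q i θ f := by
  simp only [cavNu, avg_comp_injective _ he]

/-- The Gaussian variable `inr ()` is independent of the others. -/
theorem integral_stdGaussian_sum {ι : Type} [Fintype ι] (F : (ι → ℝ) → ℝ) (G : ℝ → ℝ) :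
    ∫ g, F (fun e => g (Sum.inl e)) * G (g (Sum.inr ())) ∂stdGaussian (ι ⊕ Unit)
      = (∫ g, F g ∂stdGaussian ι) * ∫ η, G η ∂gaussianReal 0 1 := by
  have h1 := (measurePreserving_sumPiEquivProdPi (X := fun _ : ι ⊕ Unit => ℝ)
    (fun _ => gaussianReal 0 1)).integral_comp' (g := fun z => F z.1 * G (z.2 ()))
  have h2 := (measurePreserving_funUnique (gaussianReal 0 1) Unit).integral_comp' (g := G)
  rw [← h2]
  refine Eq.trans ?_ (h1.trans (integral_prod_mul F fun z : Unit → ℝ => G (z ())))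
  rfl

theorem cavNu_pi_div_two (f : (κ → Config S N) → ℝ) :
    cavNu β h D p q i (Real.pi / 2) f = nuAvg S N β h D f := by
  have hE : ∀ g : Edge N ⊕ Unit → ℝ, cavEnergy (S := S) β h D p q i (Real.pi / 2) g
      = hamiltonian S N β h D fun e => g (Sum.inl e) := by
    intro g
    funext x
    simp only [cavEnergy, gaussEnergy, Fintype.sum_sum_type, cavCoef, cavField, cavDet, hamiltonian,
      Real.cos_pi_div_two, Real.sin_pi_div_two, ite_self, Finset.mul_sum]
    simp only [zero_mul, one_mul, Finset.sum_const_zero, add_zero, ne_eq, OfNat.ofNat_ne_zero,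
      not_false_eq_true, zero_pow, zero_add, add_assoc]
    congr 1
    exact Finset.sum_congr rfl fun e _ => by ring
  have := integral_stdGaussian_sum (fun g => avg (hamiltonian S N β h D g) f) (fun _ => 1)
  simp only [mul_one, integral_const, probReal_univ, smul_eq_mul] at this
  simp only [cavNu, hE, this, nuAvg]

theorem nu0Avg_one : nu0Avg S β h D p q (fun _ : κ → ℝ => 1) = 1 := by
  simp [nu0Avg, avg_const]

/-- At `θ = 0`, the site `i` is independent of the other sites, and its spins are distributed
according to `ν₀`. -/
theorem cavNu_zero_mul {f : (κ → Config S N) → ℝ} (hf : IndepSite i f) (φ : (κ → ℝ) → ℝ) :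
    cavNu β h D p q i 0 (fun x => f x * φ fun k => (x k i).toReal)
      = cavNu β h D p q i 0 f * nu0Avg S β h D p q φ := by
  let e : Config S N ≃ Spin S × ({j // j ≠ i} → Spin S) := Equiv.funSplitAt i (Spin S)
  let ext : ({j // j ≠ i} → Spin S) → Config S N := fun y => e.symm (Spin.zero S, y)
  have hext : ∀ x j, j ≠ i → ext (e x).2 j = x j := by
    intro x j hj
    simp [ext, e, Equiv.funSplitAt, Equiv.piSplitAt, hj]
  have hexti : ∀ x, (ext (e x).2 i).toReal = 0 := by
    intro x
    simp [ext, e, Equiv.funSplitAt, Equiv.piSplitAt, Spin.toReal_zero]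
  let f' : (κ → {j // j ≠ i} → Spin S) → ℝ := fun y => f fun k => ext (y k)
  have hf' : ∀ x, f x = f' fun k => (e (x k)).2 := fun x =>
    hf _ _ fun k j hj => (hext (x k) j hj).symm
  let E₂ : (Edge N → ℝ) → ({j // j ≠ i} → Spin S) → ℝ := fun g y =>
    cavEnergy β h D p q i 0 (Sum.elim g fun _ => 0) (ext y)
  have hE : ∀ (g : Edge N ⊕ Unit → ℝ) (x : Config S N), cavEnergy β h D p q i 0 g x
      = cavityEnergy S β h D p q (g (Sum.inr ())) (e x).1 + E₂ (fun e => g (Sum.inl e)) (e x).2 := by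
    intro g x
    have hx : (e x).1 = x i := rfl
    have hs1 : ∑ j, (x j).toReal = (x i).toReal + ∑ j, (ext (e x).2 j).toReal := by
      rw [← Finset.add_sum_erase _ _ (Finset.mem_univ i),
        ← Finset.add_sum_erase _ (fun j => (ext (e x).2 j).toReal) (Finset.mem_univ i), hexti, zero_add]
      exact congrArg _ (Finset.sum_congr rfl fun j hj => by rw [hext x j (Finset.ne_of_mem_erase hj)])
    have hs2 : ∑ j, (x j).toReal ^ 2 = (x i).toReal ^ 2 + ∑ j, (ext (e x).2 j).toReal ^ 2 := by
      rw [← Finset.add_sum_erase _ _ (Finset.mem_univ i),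
        ← Finset.add_sum_erase _ (fun j => (ext (e x).2 j).toReal ^ 2) (Finset.mem_univ i), hexti]
      simp only [ne_eq, OfNat.ofNat_ne_zero, not_false_eq_true, zero_pow, zero_add]
      exact congrArg _ (Finset.sum_congr rfl fun j hj => by rw [hext x j (Finset.ne_of_mem_erase hj)])
    have hs3 : ∑ d : Edge N, (if d.1.1 = i ∨ d.1.2 = i then (0 : ℝ) else 1) * g (Sum.inl d) *
          (β / Real.sqrt N * ((x d.1.1).toReal * (x d.1.2).toReal))
        = ∑ d : Edge N, (if d.1.1 = i ∨ d.1.2 = i then (0 : ℝ) else 1) * g (Sum.inl d) *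
          (β / Real.sqrt N * ((ext (e x).2 d.1.1).toReal * (ext (e x).2 d.1.2).toReal)) := by
      refine Finset.sum_congr rfl fun d _ => ?_
      by_cases hd : d.1.1 = i ∨ d.1.2 = i
      · simp [hd]
      · push Not at hd
        rw [hext x _ hd.1, hext x _ hd.2]
    simp only [E₂, cavEnergy, gaussEnergy, Fintype.sum_sum_type, cavCoef, cavField, cavDet,
      Real.cos_zero, Real.sin_zero, hs3, cavityEnergy, hx, hexti, Sum.elim_inl, Sum.elim_inr]
    rw [hs1, hs2]
    simp only [Finset.univ_unique, Finset.sum_singleton]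
    have : (default : Unit) = () := rfl
    rw [this]
    ring
  have key : ∀ φ : (κ → ℝ) → ℝ, cavNu β h D p q i 0 (fun x => f x * φ fun k => (x k i).toReal)
      = (∫ g, avg (E₂ g) f' ∂stdGaussian (Edge N)) * nu0Avg S β h D p q φ := by
    intro φ
    rw [nu0Avg, ← integral_stdGaussian_sum, cavNu]
    refine integral_congr_ae (Filter.Eventually.of_forall fun g => ?_)
    simp only
    rw [mul_comm, ← avg_prod_mul e _ _ (hE g)]
    congr 1
    funext x
    rw [hf' x, mul_comm]
    rfl
  have h1 := key fun _ => 1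
  rw [nu0Avg_one] at h1
  simp only [mul_one] at h1
  rw [key, h1]

theorem sum_edges_eq (u : Fin N → ℝ) :
    ∑ e : Edge N, (if e.1.1 = i ∨ e.1.2 = i then u e.1.1 * u e.1.2 else 0)
      = u i * ∑ j ∈ Finset.univ.erase i, u j := by
  rw [← Finset.sum_subtype (Finset.univ.filter fun e : Fin N × Fin N => e.1 < e.2) (by simp)
    (fun e : Fin N × Fin N => if e.1 = i ∨ e.2 = i then u e.1 * u e.2 else 0), Finset.sum_filter,
    Fintype.sum_prod_type]
  have h1 : ∀ a b : Fin N, (if a < b then (if a = i ∨ b = i then u a * u b else 0) else 0)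
      = (if a = i then (if i < b then u i * u b else 0) else 0)
        + (if b = i then (if a < i then u i * u a else 0) else 0) := by
    intro a b
    by_cases ha : a = i
    · subst ha
      by_cases hb : b = a
      · subst hb; simp
      · simp [hb]
    · by_cases hb : b = i
      · subst hb; simp [ha, mul_comm]
      · simp [ha, hb]
  simp only [h1, Finset.sum_add_distrib]
  rw [Finset.sum_comm]
  simp only [Finset.sum_ite_eq', Finset.mem_univ, if_true]
  rw [← Finset.sum_add_distrib, Finset.mul_sum, ← Finset.add_sum_erase _ _ (Finset.mem_univ i)]
  simp only [lt_self_iff_false, if_false, zero_add]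
  refine Finset.sum_congr rfl fun j hj => ?_
  rcases lt_or_gt_of_ne (Finset.ne_of_mem_erase hj) with hji | hji
  · simp [hji, hji.not_gt]
  · simp [hji, hji.not_gt]

/-- The function whose average is the derivative of the average of `f` along the cavity
interpolation, up to the factor `β ^ 2 * (sin θ * cos θ)`. -/
def cavDeriv (f : (κ → Config S N) → ℝ) (x : Option (Option κ) → Config S N) : ℝ :=
  lift₂ f x * ∑ k, ∑ l, leftCoef κ k * rightCoef κ l *
    ((x k i).toReal * (x l i).toReal * rhoCav p q i k l x)

variable {q} in
theorem hasDerivAt_cavNu (hq : 0 ≤ q) (f : (κ → Config S N) → ℝ) (θ : ℝ) :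
    HasDerivAt (fun t => cavNu β h D p q i t f)
      (β ^ 2 * (Real.sin θ * Real.cos θ) * cavNu β h D p q i θ (cavDeriv p q i f)) θ := by
  have hc : ∀ j t, HasDerivAt (cavCoef i j) (cavCoef' i j t) t := by
    rintro (e | u) t
    · show HasDerivAt (fun t => if e.1.1 = i ∨ e.1.2 = i then Real.sin t else 1) _ t
      by_cases he : e.1.1 = i ∨ e.1.2 = i
      · simpa only [cavCoef', he, if_true] using Real.hasDerivAt_sin t
      · simpa only [cavCoef', he, if_false] using hasDerivAt_const t (1 : ℝ)
    · exact Real.hasDerivAt_cos t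
  have hc' : ∀ j t, |cavCoef' i j t| ≤ 1 := by
    rintro (e | u) t
    · by_cases he : e.1.1 = i ∨ e.1.2 = i
      · simpa only [cavCoef', he, if_true] using Real.abs_cos_le_one t
      · simp [cavCoef', he]
    · simpa [cavCoef'] using Real.abs_sin_le_one t
  have hb : ∀ (x : Config S N) t, HasDerivAt (fun s => cavDet β h D p q i s x)
      (-(Real.sin t * Real.cos t) * (β ^ 2 * (p - q) * (x i).toReal ^ 2)) t := by
    intro x t
    refine ((((Real.hasDerivAt_cos t).pow 2).mul_const
      (β ^ 2 / 2 * (p - q) * (x i).toReal ^ 2)).add_const _).congr_deriv ?_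
    simp only [Nat.cast_ofNat, Nat.add_one_sub_one, pow_one]
    ring
  have hb' : ∀ t (x : Config S N), |-(Real.sin t * Real.cos t) * (β ^ 2 * (p - q) * (x i).toReal ^ 2)|
      ≤ ∑ y : Config S N, |β ^ 2 * (p - q) * (y i).toReal ^ 2| := by
    intro t x
    rw [abs_mul, abs_neg, abs_mul]
    refine le_trans ?_ (Finset.single_le_sum (f := fun y : Config S N =>
      |β ^ 2 * (p - q) * (y i).toReal ^ 2|) (fun _ _ => abs_nonneg _) (Finset.mem_univ x))
    exact mul_le_of_le_one_left (abs_nonneg _) (mul_le_one₀ (Real.abs_sin_le_one t) (abs_nonneg _)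
      (Real.abs_cos_le_one t))
  refine (hasDerivAt_integral_avg (cavField β q i) hc hc' hb hb' f θ).congr_deriv ?_
  rw [← cavNu_const_mul]
  simp only [cavNu, cavEnergy]
  congr 1
  funext g
  congr 1
  funext x
  rw [cavDeriv, mul_left_comm]
  congr 1
  rw [Finset.mul_sum]
  refine Finset.sum_congr rfl fun k _ => ?_
  rw [Finset.mul_sum]
  refine Finset.sum_congr rfl fun l _ => ?_
  rw [mul_left_comm (β ^ 2 * (Real.sin θ * Real.cos θ))]
  congr 1
  have hN : (0 : ℝ) < N := by exact_mod_cast i.pos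
  have h1 : ∑ e : Edge N, cavCoef i (Sum.inl e) θ * cavCoef' i (Sum.inl e) θ *
      cavField β q i (Sum.inl e) (x k) * cavField β q i (Sum.inl e) (x l)
      = Real.sin θ * Real.cos θ * (β ^ 2 / N) * ((x k i).toReal * (x l i).toReal *
        ∑ j ∈ Finset.univ.erase i, (x k j).toReal * (x l j).toReal) := by
    rw [← sum_edges_eq i fun j => (x k j).toReal * (x l j).toReal, Finset.mul_sum]
    refine Finset.sum_congr rfl fun e _ => ?_
    by_cases he : e.1.1 = i ∨ e.1.2 = i
    · simp only [cavCoef, cavCoef', cavField, he, if_true]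
      have hs : β ^ 2 / N = β / Real.sqrt N * (β / Real.sqrt N) := by
        rw [div_mul_div_comm, Real.mul_self_sqrt hN.le, sq]
      rw [hs]
      ring
    · simp [cavCoef, cavCoef', he]
  rw [Fintype.sum_sum_type, h1]
  have hsq : Real.sqrt q ^ 2 = q := Real.sq_sqrt hq
  simp only [cavCoef, cavCoef', cavField, Finset.univ_unique, Finset.sum_const,
    Finset.card_singleton, one_smul, rhoCav, overlapLimit]
  by_cases hkl : k = l
  · subst hkl
    simp only [if_true]
    linear_combination (-(Real.sin θ * Real.cos θ) * β ^ 2 * (x k i).toReal * (x k i).toReal) * hsq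
  · simp only [hkl, if_false]
    linear_combination (-(Real.sin θ * Real.cos θ) * β ^ 2 * (x k i).toReal * (x l i).toReal) * hsq

end Cavity

/-! ### Bounds on the centered overlaps and stability of the cavity interpolation -/

section Bounds

variable {S N : ℕ} {κ : Type}

theorem abs_spin_mul_le (s t : Spin S) : |s.toReal * t.toReal| ≤ (S : ℝ) ^ 2 := by
  rw [abs_mul, sq]
  exact mul_le_mul s.abs_toReal_le t.abs_toReal_le (abs_nonneg _) (Nat.cast_nonneg _)

theorem abs_overlapLimit_le [DecidableEq κ] {p q B : ℝ} (hp : |p| ≤ B) (hq : |q| ≤ B) (k l : κ) :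
    |overlapLimit p q k l| ≤ B := by
  unfold overlapLimit; split_ifs <;> assumption

theorem abs_rhoCav_le [DecidableEq κ] {p q : ℝ} (hp : |p| ≤ (S : ℝ) ^ 2) (hq : |q| ≤ (S : ℝ) ^ 2)
    (i : Fin N) (k l : κ) (x : κ → Config S N) : |rhoCav p q i k l x| ≤ 2 * (S : ℝ) ^ 2 := by
  have hN : (0 : ℝ) < N := by exact_mod_cast i.pos
  unfold rhoCav
  refine (abs_sub _ _).trans ?_
  rw [two_mul]
  refine add_le_add ?_ (abs_overlapLimit_le hp hq k l)
  rw [abs_mul, abs_of_nonneg (by positivity : 0 ≤ 1 / (N : ℝ)), one_div, inv_mul_le_iff₀ hN]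
  refine (Finset.abs_sum_le_sum_abs _ _).trans ((Finset.sum_le_sum fun j _ =>
    abs_spin_mul_le _ _).trans ?_)
  rw [Finset.sum_const, nsmul_eq_mul]
  refine mul_le_mul_of_nonneg_right ?_ (by positivity)
  exact_mod_cast (Finset.card_erase_le).trans (by simp)

theorem rho_eq [DecidableEq κ] (p q : ℝ) (i : Fin N) (k l : κ) (x : κ → Config S N) :
    rho p q k l x = rhoCav p q i k l x + 1 / N * ((x k i).toReal * (x l i).toReal) := by
  unfold rho rhoCav overlap
  rw [← Finset.add_sum_erase _ _ (Finset.mem_univ i)]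
  ring

theorem abs_rho_sub_rhoCav_le [DecidableEq κ] (p q : ℝ) (i : Fin N) (k l : κ) (x : κ → Config S N) :
    |rho p q k l x - rhoCav p q i k l x| ≤ (S : ℝ) ^ 2 / N := by
  rw [rho_eq p q i, add_sub_cancel_left, abs_mul, abs_of_nonneg (by positivity), one_div,
    div_eq_inv_mul]
  exact mul_le_mul_of_nonneg_left (abs_spin_mul_le _ _) (by positivity)

theorem abs_rho_le [DecidableEq κ] {p q : ℝ} (hp : |p| ≤ (S : ℝ) ^ 2) (hq : |q| ≤ (S : ℝ) ^ 2)
    (hN : 1 ≤ N) (k l : κ) (x : κ → Config S N) : |rho p q k l x| ≤ 3 * (S : ℝ) ^ 2 := by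
  have hN1 : (1 : ℝ) ≤ N := by exact_mod_cast hN
  have h1 := abs_rho_sub_rhoCav_le p q (⟨0, hN⟩ : Fin N) k l x
  have h2 := abs_rhoCav_le hp hq (⟨0, hN⟩ : Fin N) k l x
  have h3 : (S : ℝ) ^ 2 / N ≤ (S : ℝ) ^ 2 := div_le_self (by positivity) hN1
  have := abs_sub_abs_le_abs_sub (rho p q k l x) (rhoCav p q ⟨0, hN⟩ k l x)
  linarith

theorem rhoCav_indepSite [DecidableEq κ] (p q : ℝ) (i : Fin N) (k l : κ) :
    IndepSite (S := S) i (rhoCav p q i k l) := by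
  intro x y hxy
  unfold rhoCav
  congr 2
  exact Finset.sum_congr rfl fun j hj => by
    rw [hxy k j (Finset.ne_of_mem_erase hj), hxy l j (Finset.ne_of_mem_erase hj)]

theorem abs_leftCoef_mul_rightCoef_le [Fintype κ] (k l : Option (Option κ)) :
    |leftCoef κ k * rightCoef κ l| ≤ ((Fintype.card κ : ℝ) + 1) ^ 2 := by
  have hn : (0 : ℝ) ≤ Fintype.card κ := Nat.cast_nonneg _
  have h1 : |leftCoef κ k| ≤ (Fintype.card κ : ℝ) + 1 := by
    rcases k with _ | _ | k <;> (simp [leftCoef]; try linarith)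
  have h2 : |rightCoef κ l| ≤ (Fintype.card κ : ℝ) + 1 := by
    rcases l with _ | l
    · simp only [rightCoef, abs_neg]; rw [abs_of_nonneg (by linarith)]
    · simp [rightCoef]
  rw [abs_mul, sq]
  exact mul_le_mul h1 h2 (abs_nonneg _) (by linarith)

/-- A bound on the coefficients in the derivative along the cavity interpolation. -/
def derivConst (S n : ℕ) : ℝ := ((n : ℝ) + 1) ^ 2 * (S : ℝ) ^ 2

theorem derivConst_nonneg (S n : ℕ) : 0 ≤ derivConst S n := by unfold derivConst; positivity

variable [Fintype κ] [DecidableEq κ]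

theorem abs_cavDeriv_le (p q : ℝ) (i : Fin N) (f : (κ → Config S N) → ℝ)
    (x : Option (Option κ) → Config S N) :
    |cavDeriv p q i f x|
      ≤ |lift₂ f x| * (derivConst S (Fintype.card κ) * ∑ k, ∑ l, |rhoCav p q i k l x|) := by
  unfold cavDeriv derivConst
  rw [abs_mul, Finset.mul_sum]
  refine mul_le_mul_of_nonneg_left ((Finset.abs_sum_le_sum_abs _ _).trans
    (Finset.sum_le_sum fun k _ => ?_)) (abs_nonneg _)
  rw [Finset.mul_sum]
  refine (Finset.abs_sum_le_sum_abs _ _).trans (Finset.sum_le_sum fun l _ => ?_)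
  rw [abs_mul, abs_mul (_ * _) (rhoCav _ _ _ _ _ _), ← mul_assoc]
  gcongr
  · exact abs_leftCoef_mul_rightCoef_le k l
  · exact abs_spin_mul_le _ _

/-- The rate in the differential inequality for nonnegative functions. -/
def growthConst (S n : ℕ) : ℝ := derivConst S n * (((n : ℝ) + 2) ^ 2 * (2 * (S : ℝ) ^ 2))

variable {β p q : ℝ} (h D : ℝ)

theorem cavNu_lift₂ (i : Fin N) (θ : ℝ) (f : (κ → Config S N) → ℝ) :
    cavNu β h D p q i θ (lift₂ f) = cavNu β h D p q i θ f :=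
  cavNu_comp_injective β h D p q i θ (e := fun k : κ => some (some k))
    (fun _ _ hab => Option.some_injective _ (Option.some_injective _ hab)) f

/-- Along the cavity interpolation, averages of nonnegative functions are controlled by averages
in the original system. -/
theorem cavNu_le_nuAvg (hp : |p| ≤ (S : ℝ) ^ 2) (hq : |q| ≤ (S : ℝ) ^ 2) (hq0 : 0 ≤ q) (i : Fin N)
    {f : (κ → Config S N) → ℝ} (hf : ∀ x, 0 ≤ f x) {θ : ℝ} (hθ : θ ∈ Set.Icc 0 (Real.pi / 2)) :
    cavNu β h D p q i θ f
      ≤ Real.exp (2 * (β ^ 2 * growthConst S (Fintype.card κ))) * nuAvg S N β h D f := by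
  have hG : 0 ≤ growthConst S (Fintype.card κ) := by
    unfold growthConst
    exact mul_nonneg (derivConst_nonneg _ _) (by positivity)
  have hd : ∀ t, |cavNu β h D p q i t (cavDeriv p q i f)|
      ≤ growthConst S (Fintype.card κ) * cavNu β h D p q i t f := by
    intro t
    rw [← cavNu_lift₂ h D i t f, ← cavNu_const_mul]
    refine abs_cavNu_le β h D p q i t fun x => (abs_cavDeriv_le p q i f x).trans ?_
    have hl : 0 ≤ lift₂ f x := hf _
    rw [abs_of_nonneg hl, mul_comm]
    refine mul_le_mul_of_nonneg_right ?_ hl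
    unfold growthConst
    refine mul_le_mul_of_nonneg_left ?_ (derivConst_nonneg _ _)
    calc _ ≤ ∑ _k : Option (Option κ), ∑ _l : Option (Option κ), 2 * (S : ℝ) ^ 2 :=
          Finset.sum_le_sum fun k _ => Finset.sum_le_sum fun l _ => abs_rhoCav_le hp hq i k l x
      _ = _ := by
          simp only [Finset.sum_const, Finset.card_univ, Fintype.card_option, nsmul_eq_mul]
          push_cast
          ring
  have hsc : ∀ t : ℝ, |Real.sin t * Real.cos t| ≤ 1 := fun t => by
    rw [abs_mul]
    exact mul_le_one₀ (Real.abs_sin_le_one t) (abs_nonneg _) (Real.abs_cos_le_one t)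
  have h1 := le_exp_mul_of_abs_deriv_le (fun t => hasDerivAt_cavNu β h D p i hq0 f t)
    (M := β ^ 2 * growthConst S (Fintype.card κ)) (fun t => ?_) hθ.2
  · rw [cavNu_pi_div_two] at h1
    refine h1.trans (mul_le_mul_of_nonneg_right (Real.exp_le_exp.2 ?_) ?_)
    · rw [mul_comm]
      refine mul_le_mul_of_nonneg_right ?_ (mul_nonneg (sq_nonneg _) hG)
      linarith [hθ.1, Real.pi_le_four]
    · rw [← cavNu_pi_div_two β h D p q i]
      exact cavNu_nonneg _ _ _ _ _ _ _ hf
  · rw [abs_mul, abs_mul, abs_of_nonneg (sq_nonneg β), mul_assoc, mul_assoc]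
    refine mul_le_mul_of_nonneg_left ?_ (sq_nonneg _)
    exact (mul_le_of_le_one_left (abs_nonneg _) (hsc t)).trans (hd t)

/-- First-order comparison along the cavity interpolation. -/
theorem abs_cavNu_sub_le (hp : |p| ≤ (S : ℝ) ^ 2) (hq : |q| ≤ (S : ℝ) ^ 2) (hq0 : 0 ≤ q) (i : Fin N)
    {f : (κ → Config S N) → ℝ} {g : (Option (Option κ) → Config S N) → ℝ}
    (hfg : ∀ x, |cavDeriv p q i f x| ≤ g x) {θ : ℝ} (hθ : θ ∈ Set.Icc 0 (Real.pi / 2)) :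
    |cavNu β h D p q i θ f - cavNu β h D p q i 0 f|
      ≤ 2 * (β ^ 2 * (Real.exp (2 * (β ^ 2 * growthConst S (Fintype.card κ + 2)))
        * nuAvg S N β h D g)) := by
  refine abs_sub_le_of_abs_deriv_le (fun t => hasDerivAt_cavNu β h D p i hq0 f t) (fun t ht => ?_) hθ
  rw [abs_mul, abs_mul, abs_of_nonneg (sq_nonneg β), mul_assoc]
  refine mul_le_mul_of_nonneg_left ?_ (sq_nonneg _)
  have hsc : |Real.sin t * Real.cos t| ≤ 1 := by
    rw [abs_mul]
    exact mul_le_one₀ (Real.abs_sin_le_one t) (abs_nonneg _) (Real.abs_cos_le_one t)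
  refine (mul_le_of_le_one_left (abs_nonneg _) hsc).trans ((abs_cavNu_le β h D p q i t hfg).trans ?_)
  have := cavNu_le_nuAvg (β := β) h D hp hq hq0 i (f := g)
    (fun x => (abs_nonneg _).trans (hfg x)) ht
  simpa [Fintype.card_option, add_assoc] using this

end Bounds

/-! ### Averages over the couplings -/

section NuAvg

variable {S N : ℕ} {β h D : ℝ} {κ κ' : Type} [Fintype κ] [DecidableEq κ] [Fintype κ']
  [DecidableEq κ']

theorem exists_nuAvg_eq (hN : 1 ≤ N) : ∃ i : Fin N, ∀ {κ : Type} [Fintype κ] [DecidableEq κ]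
    (f : (κ → Config S N) → ℝ), nuAvg S N β h D f = cavNu β h D 0 0 i (Real.pi / 2) f :=
  ⟨⟨0, hN⟩, fun f => (cavNu_pi_div_two _ _ _ _ _ _ f).symm⟩

theorem nuAvg_add (hN : 1 ≤ N) (f g : (κ → Config S N) → ℝ) :
    nuAvg S N β h D (fun x => f x + g x) = nuAvg S N β h D f + nuAvg S N β h D g := by
  obtain ⟨i, hi⟩ := exists_nuAvg_eq (S := S) (β := β) (h := h) (D := D) hN
  simp only [hi, cavNu_add]

theorem nuAvg_sub (hN : 1 ≤ N) (f g : (κ → Config S N) → ℝ) :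
    nuAvg S N β h D (fun x => f x - g x) = nuAvg S N β h D f - nuAvg S N β h D g := by
  obtain ⟨i, hi⟩ := exists_nuAvg_eq (S := S) (β := β) (h := h) (D := D) hN
  simp only [hi, cavNu_sub]

theorem nuAvg_const_mul (c : ℝ) (f : (κ → Config S N) → ℝ) :
    nuAvg S N β h D (fun x => c * f x) = c * nuAvg S N β h D f := by
  simp only [nuAvg, avg_const_mul, integral_const_mul]

theorem nuAvg_const (c : ℝ) : nuAvg S N β h D (fun _ : κ → Config S N => c) = c := by
  simp [nuAvg, avg_const]

theorem nuAvg_sum (hN : 1 ≤ N) {J : Type*} (s : Finset J) (f : J → (κ → Config S N) → ℝ) :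
    nuAvg S N β h D (fun x => ∑ j ∈ s, f j x) = ∑ j ∈ s, nuAvg S N β h D (f j) := by
  obtain ⟨i, hi⟩ := exists_nuAvg_eq (S := S) (β := β) (h := h) (D := D) hN
  simp only [hi, cavNu_sum]

theorem nuAvg_mono (hN : 1 ≤ N) {f g : (κ → Config S N) → ℝ} (hfg : ∀ x, f x ≤ g x) :
    nuAvg S N β h D f ≤ nuAvg S N β h D g := by
  obtain ⟨i, hi⟩ := exists_nuAvg_eq (S := S) (β := β) (h := h) (D := D) hN
  simp only [hi]
  exact cavNu_mono _ _ _ _ _ _ _ hfg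

theorem abs_nuAvg_le (hN : 1 ≤ N) {f g : (κ → Config S N) → ℝ} (hfg : ∀ x, |f x| ≤ g x) :
    |nuAvg S N β h D f| ≤ nuAvg S N β h D g := by
  obtain ⟨i, hi⟩ := exists_nuAvg_eq (S := S) (β := β) (h := h) (D := D) hN
  simp only [hi]
  exact abs_cavNu_le _ _ _ _ _ _ _ hfg

theorem nuAvg_nonneg (hN : 1 ≤ N) {f : (κ → Config S N) → ℝ} (hf : ∀ x, 0 ≤ f x) :
    0 ≤ nuAvg S N β h D f := by
  rw [← nuAvg_const (S := S) (N := N) (β := β) (h := h) (D := D) (κ := κ) 0]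
  exact nuAvg_mono hN hf

theorem nuAvg_comp_injective {e : κ' → κ} (he : Function.Injective e)
    (f : (κ' → Config S N) → ℝ) :
    nuAvg S N β h D (fun x : κ → Config S N => f (x ∘ e)) = nuAvg S N β h D f := by
  simp only [nuAvg, avg_comp_injective _ he]

end NuAvg

/-! ### Moments of the centered overlaps -/

section Moments

theorem abs_pow_odd_sub_le {a b η : ℝ} (hab : |a - b| ≤ η) (r : ℕ) :
    |a ^ (2 * r + 1) - b ^ (2 * r + 1)| ≤ (2 * r + 1) * 4 ^ r * (η * (a ^ (2 * r) + η ^ (2 * r))) := by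
  have hη : 0 ≤ η := (abs_nonneg _).trans hab
  have hmax : max |a| |b| ≤ |a| + η := by
    refine max_le (by linarith) ?_
    have := abs_sub_abs_le_abs_sub b a
    rw [abs_sub_comm] at this
    linarith
  have h1 : (|a| + η) ^ (2 * r) ≤ 4 ^ r * (a ^ (2 * r) + η ^ (2 * r)) := by
    refine (add_pow_le (abs_nonneg a) hη (2 * r)).trans ?_
    rw [pow_abs, abs_of_nonneg (by rw [pow_mul]; positivity : 0 ≤ a ^ (2 * r))]
    refine mul_le_mul_of_nonneg_right ?_ (by rw [pow_mul, pow_mul]; positivity)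
    calc (2 : ℝ) ^ (2 * r - 1) ≤ 2 ^ (2 * r) := pow_le_pow_right₀ one_le_two (Nat.sub_le _ _)
      _ = 4 ^ r := by rw [pow_mul]; norm_num
  refine (abs_pow_sub_pow_le a b (2 * r + 1)).trans ?_
  calc |a - b| * ((2 * r + 1 : ℕ) : ℝ) * max |a| |b| ^ (2 * r + 1 - 1)
      ≤ η * ((2 * r + 1 : ℕ) : ℝ) * (|a| + η) ^ (2 * r) := by
        simp only [Nat.add_sub_cancel]; gcongr
    _ ≤ η * ((2 * r + 1 : ℕ) : ℝ) * (4 ^ r * (a ^ (2 * r) + η ^ (2 * r))) := by gcongr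
    _ = _ := by push_cast; ring

theorem abs_pow_even_sub_le {a b η B : ℝ} (hab : |a - b| ≤ η) (hB : |a| + η ≤ B) (r : ℕ) :
    |a ^ (2 * r + 2) - b ^ (2 * r + 2)|
      ≤ (2 * r + 2) * B * 4 ^ r * (η * (a ^ (2 * r) + η ^ (2 * r))) := by
  have hη : 0 ≤ η := (abs_nonneg _).trans hab
  have hmax : max |a| |b| ≤ |a| + η := by
    refine max_le (by linarith) ?_
    have := abs_sub_abs_le_abs_sub b a
    rw [abs_sub_comm] at this
    linarith
  have h1 : (|a| + η) ^ (2 * r) ≤ 4 ^ r * (a ^ (2 * r) + η ^ (2 * r)) := by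
    refine (add_pow_le (abs_nonneg a) hη (2 * r)).trans ?_
    rw [pow_abs, abs_of_nonneg (by rw [pow_mul]; positivity : 0 ≤ a ^ (2 * r))]
    refine mul_le_mul_of_nonneg_right ?_ (by rw [pow_mul, pow_mul]; positivity)
    calc (2 : ℝ) ^ (2 * r - 1) ≤ 2 ^ (2 * r) := pow_le_pow_right₀ one_le_two (Nat.sub_le _ _)
      _ = 4 ^ r := by rw [pow_mul]; norm_num
  have h0 : 0 ≤ |a| + η := by positivity
  refine (abs_pow_sub_pow_le a b (2 * r + 2)).trans ?_
  calc |a - b| * ((2 * r + 2 : ℕ) : ℝ) * max |a| |b| ^ (2 * r + 2 - 1)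
      ≤ η * ((2 * r + 2 : ℕ) : ℝ) * (|a| + η) ^ (2 * r + 1) := by
        simp only [show 2 * r + 2 - 1 = 2 * r + 1 by omega]; gcongr
    _ = η * ((2 * r + 2 : ℕ) : ℝ) * ((|a| + η) ^ (2 * r) * (|a| + η)) := by rw [pow_succ]
    _ ≤ η * ((2 * r + 2 : ℕ) : ℝ) * (4 ^ r * (a ^ (2 * r) + η ^ (2 * r)) * B) := by
        have : 0 ≤ 4 ^ r * (a ^ (2 * r) + η ^ (2 * r)) := (pow_nonneg h0 _).trans h1
        gcongr
    _ = _ := by push_cast; ring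

/-- Young's inequality for the exponents `(m + 1) / m` and `m + 1`, with a crude constant. -/
theorem pow_mul_le_add_pow {a b : ℝ} (ha : 0 ≤ a) (hb : 0 ≤ b) (m : ℕ) :
    a ^ m * b ≤ a ^ (m + 1) + b ^ (m + 1) := by
  rcases le_total a b with hab | hab
  · have : a ^ m * b ≤ b ^ m * b := by gcongr
    rw [← pow_succ] at this
    linarith [pow_nonneg ha (m + 1)]
  · have : a ^ m * b ≤ a ^ m * a := by gcongr
    rw [← pow_succ] at this
    linarith [pow_nonneg hb (m + 1)]

theorem injective_pair {κ : Type} {k l : κ} (hkl : k ≠ l) : Function.Injective ![k, l] := by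
  intro a b hab
  fin_cases a <;> fin_cases b <;> simp_all [eq_comm]

variable {S : ℕ} {β h D p q : ℝ} {κ κ' : Type} [Fintype κ] [DecidableEq κ] [Fintype κ']
  [DecidableEq κ']

theorem nu0Avg_comp_injective {e : κ' → κ} (he : Function.Injective e) (φ : (κ' → ℝ) → ℝ) :
    nu0Avg S β h D p q (fun ε : κ → ℝ => φ (ε ∘ e)) = nu0Avg S β h D p q φ := by
  unfold nu0Avg
  congr 1
  funext η
  exact avg_comp_injective _ he fun ε : κ' → Spin S => φ fun k => (ε k).toReal

theorem continuous_avg_cavityEnergy (f : (κ → Spin S) → ℝ) :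
    Continuous fun η => avg (cavityEnergy S β h D p q η) f :=
  continuous_avg (fun x => by unfold cavityEnergy; fun_prop) f

theorem integrable_avg_cavityEnergy (f : (κ → Spin S) → ℝ) :
    Integrable (fun η => avg (cavityEnergy S β h D p q η) f) (gaussianReal 0 1) :=
  integrable_of_continuous_of_abs_le (continuous_avg_cavityEnergy f) fun _ => abs_avg_le_sum _ f

theorem nu0Avg_sub (φ ψ : (κ → ℝ) → ℝ) :
    nu0Avg S β h D p q (fun ε => φ ε - ψ ε) = nu0Avg S β h D p q φ - nu0Avg S β h D p q ψ := by
  simp only [nu0Avg, avg_sub]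
  exact integral_sub (integrable_avg_cavityEnergy _) (integrable_avg_cavityEnergy _)

theorem nu0Avg_const_mul (c : ℝ) (φ : (κ → ℝ) → ℝ) :
    nu0Avg S β h D p q (fun ε => c * φ ε) = c * nu0Avg S β h D p q φ := by
  simp only [nu0Avg, avg_const_mul, integral_const_mul]

theorem nu0Avg_sum {J : Type*} (s : Finset J) (φ : J → (κ → ℝ) → ℝ) :
    nu0Avg S β h D p q (fun ε => ∑ j ∈ s, φ j ε) = ∑ j ∈ s, nu0Avg S β h D p q (φ j) := by
  simp only [nu0Avg, avg_sum]
  exact integral_finsetSum _ fun j _ => integrable_avg_cavityEnergy _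

theorem nu0Avg_const (c : ℝ) : nu0Avg S β h D p q (fun _ : κ → ℝ => c) = c := by
  simp [nu0Avg, avg_const]

theorem nu0Avg_mul_eq_overlapLimit (hfp : IsFixedPoint S β h D p q) (k l : κ) :
    nu0Avg S β h D p q (fun ε : κ → ℝ => ε k * ε l) = overlapLimit p q k l := by
  unfold overlapLimit
  split_ifs with hkl
  · subst hkl
    refine Eq.trans ?_ ((nu0Avg_comp_injective (κ := κ) (e := fun _ : Fin 1 => k)
      (fun _ _ _ => Subsingleton.elim _ _) (fun ε => ε 0 ^ 2)).trans hfp.1.symm)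
    simp only [Function.comp, sq]
  · exact (nu0Avg_comp_injective (κ := κ) (injective_pair hkl) (fun ε => ε 0 * ε 1)).trans
      hfp.2.symm

/-- The sum of the moments of order `2 r` of the centered self-overlap and of the centered overlap
of two replicas. -/
def moment (S N : ℕ) (β h D p q : ℝ) (r : ℕ) : ℝ :=
  nuAvg S N β h D (κ := Fin 1) (fun x => rho p q 0 0 x ^ (2 * r))
    + nuAvg S N β h D (κ := Fin 2) (fun x => rho p q 0 1 x ^ (2 * r))

variable {N : ℕ}

theorem nuAvg_rho_pow_le (hN : 1 ≤ N) (r : ℕ) (k l : κ) :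
    nuAvg S N β h D (fun x => rho p q k l x ^ (2 * r)) ≤ moment S N β h D p q r := by
  have h1 : 0 ≤ nuAvg S N β h D (κ := Fin 1) (fun x => rho p q 0 0 x ^ (2 * r)) :=
    nuAvg_nonneg hN fun x => by rw [pow_mul]; positivity
  have h2 : 0 ≤ nuAvg S N β h D (κ := Fin 2) (fun x => rho p q 0 1 x ^ (2 * r)) :=
    nuAvg_nonneg hN fun x => by rw [pow_mul]; positivity
  unfold moment
  by_cases hkl : k = l
  · subst hkl
    have : nuAvg S N β h D (fun x => rho p q k k x ^ (2 * r))
        = nuAvg S N β h D (κ := Fin 1) (fun x => rho p q 0 0 x ^ (2 * r)) := by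
      rw [← nuAvg_comp_injective (κ := κ) (e := fun _ : Fin 1 => k)
        (fun _ _ _ => Subsingleton.elim _ _)]
      simp [rho, overlapLimit]
    linarith
  · have : nuAvg S N β h D (fun x => rho p q k l x ^ (2 * r))
        = nuAvg S N β h D (κ := Fin 2) (fun x => rho p q 0 1 x ^ (2 * r)) := by
      rw [← nuAvg_comp_injective (κ := κ) (injective_pair hkl)]
      simp [rho, overlapLimit, hkl]
    linarith

/-- The error made by dropping one site from an overlap in a moment of order `2 r + 2`. -/
def siteError (S N : ℕ) (β h D p q : ℝ) (r : ℕ) : ℝ :=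
  (S : ℝ) ^ 2 / N * (moment S N β h D p q r + ((S : ℝ) ^ 2 / N) ^ (2 * r))

theorem nuAvg_siteError_le (hN : 1 ≤ N) (r : ℕ) (k l : κ) :
    nuAvg S N β h D (fun x => (S : ℝ) ^ 2 / N * (rho p q k l x ^ (2 * r) + ((S : ℝ) ^ 2 / N) ^ (2 * r)))
      ≤ siteError S N β h D p q r := by
  rw [nuAvg_const_mul, nuAvg_add hN, nuAvg_const]
  unfold siteError
  gcongr
  exact nuAvg_rho_pow_le hN r k l

theorem nuAvg_rhoCav_pow_le (hp : |p| ≤ (S : ℝ) ^ 2) (hq : |q| ≤ (S : ℝ) ^ 2) (hN : 1 ≤ N) (r : ℕ)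
    (i : Fin N) (k l : κ) :
    nuAvg S N β h D (fun x => rhoCav p q i k l x ^ (2 * r + 2))
      ≤ moment S N β h D p q (r + 1)
        + (2 * r + 2) * (4 * (S : ℝ) ^ 2) * 4 ^ r * siteError S N β h D p q r := by
  have hN1 : (1 : ℝ) ≤ N := by exact_mod_cast hN
  calc _ ≤ nuAvg S N β h D (fun x => rho p q k l x ^ (2 * (r + 1)) + (2 * r + 2) * (4 * (S : ℝ) ^ 2)
        * 4 ^ r * ((S : ℝ) ^ 2 / N * (rho p q k l x ^ (2 * r) + ((S : ℝ) ^ 2 / N) ^ (2 * r)))) := by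
        refine nuAvg_mono hN fun x => ?_
        have h1 := abs_pow_even_sub_le (abs_rho_sub_rhoCav_le p q i k l x) (B := 4 * (S : ℝ) ^ 2)
          (by
            have := abs_rho_le hp hq hN k l x
            have : (S : ℝ) ^ 2 / N ≤ (S : ℝ) ^ 2 := div_le_self (by positivity) hN1
            linarith) r
        have := (abs_le.1 h1).1
        rw [show 2 * (r + 1) = 2 * r + 2 by ring]
        linarith
    _ ≤ _ := by
        rw [nuAvg_add hN, nuAvg_const_mul]
        gcongr
        · exact nuAvg_rho_pow_le hN (r + 1) k l
        · exact nuAvg_siteError_le hN r k l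

/-- The constant in the recursive estimate of the moments. -/
def momentConst (S n : ℕ) : ℝ := 24 * ((S : ℝ) ^ 2 * derivConst S n * ((n : ℝ) + 2) ^ 2)

/-- One step of the recursive estimate of the moments: one factor is written as an average over
the sites `i`, and the site `i` is decoupled from the others. At the fixed point the decoupled
average vanishes, and the derivative is again a moment of the same order, with a factor `β ^ 2`. -/
theorem nuAvg_rho_pow_succ_le (hfp : IsFixedPoint S β h D p q) (hp : |p| ≤ (S : ℝ) ^ 2)
    (hq : |q| ≤ (S : ℝ) ^ 2) (hq0 : 0 ≤ q)
    (hβ : 2 * (β ^ 2 * growthConst S (Fintype.card κ + 2)) ≤ 1) (hN : 1 ≤ N) (r : ℕ) (k l : κ) :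
    nuAvg S N β h D (fun x => rho p q k l x ^ (2 * (r + 1)))
      ≤ β ^ 2 * momentConst S (Fintype.card κ) * (moment S N β h D p q (r + 1)
          + (2 * r + 2) * (4 * (S : ℝ) ^ 2) * 4 ^ r * siteError S N β h D p q r)
        + 2 * (S : ℝ) ^ 2 * ((2 * r + 1) * 4 ^ r) * siteError S N β h D p q r := by
  have hN0 : (0 : ℝ) < N := by exact_mod_cast hN
  set M := moment S N β h D p q (r + 1)
          + (2 * r + 2) * (4 * (S : ℝ) ^ 2) * 4 ^ r * siteError S N β h D p q r with hM
  let ψ : Fin N → (κ → Config S N) → ℝ := fun i x =>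
    (x k i).toReal * (x l i).toReal - overlapLimit p q k l
  have hψ : ∀ i x, |ψ i x| ≤ 2 * (S : ℝ) ^ 2 := fun i x => by
    refine (abs_sub _ _).trans ?_
    have := abs_spin_mul_le (x k i) (x l i)
    have := abs_overlapLimit_le hp hq k l
    linarith
  have hsplit : ∀ x, rho p q k l x ^ (2 * (r + 1))
      = 1 / N * ∑ i, ψ i x * rho p q k l x ^ (2 * r + 1) := by
    intro x
    rw [show 2 * (r + 1) = 2 * r + 1 + 1 by ring, pow_succ', ← Finset.sum_mul, ← mul_assoc]
    congr 1
    simp only [ψ, rho, overlap, Finset.sum_sub_distrib, Finset.sum_const, Finset.card_univ,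
      Fintype.card_fin, nsmul_eq_mul]
    field_simp
  have hper : ∀ i, nuAvg S N β h D (fun x => ψ i x * rho p q k l x ^ (2 * r + 1))
      ≤ β ^ 2 * momentConst S (Fintype.card κ) * M
        + 2 * (S : ℝ) ^ 2 * ((2 * r + 1) * 4 ^ r) * siteError S N β h D p q r := by
    intro i
    let f : (κ → Config S N) → ℝ := fun x => rhoCav p q i k l x ^ (2 * r + 1) * ψ i x
    have h1 : nuAvg S N β h D (fun x => ψ i x * rho p q k l x ^ (2 * r + 1))
        ≤ nuAvg S N β h D f
          + 2 * (S : ℝ) ^ 2 * ((2 * r + 1) * 4 ^ r) * siteError S N β h D p q r := by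
      calc _ ≤ nuAvg S N β h D (fun x => f x + 2 * (S : ℝ) ^ 2 * ((2 * r + 1) * 4 ^ r) *
            ((S : ℝ) ^ 2 / N * (rho p q k l x ^ (2 * r) + ((S : ℝ) ^ 2 / N) ^ (2 * r)))) := by
            refine nuAvg_mono hN fun x => ?_
            have e1 := abs_pow_odd_sub_le (abs_rho_sub_rhoCav_le p q i k l x) r
            have e2 : |ψ i x * (rho p q k l x ^ (2 * r + 1) - rhoCav p q i k l x ^ (2 * r + 1))|
                ≤ 2 * (S : ℝ) ^ 2 * ((2 * r + 1) * 4 ^ r * ((S : ℝ) ^ 2 / N *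
                  (rho p q k l x ^ (2 * r) + ((S : ℝ) ^ 2 / N) ^ (2 * r)))) := by
              rw [abs_mul]
              exact mul_le_mul (hψ i x) e1 (abs_nonneg _) (by positivity)
            have e3 := (abs_le.1 e2).2
            simp only [f]
            linarith
        _ ≤ _ := by
            rw [nuAvg_add hN, nuAvg_const_mul]
            gcongr
            exact nuAvg_siteError_le hN r k l
    have h0 : cavNu β h D p q i 0 f = 0 := by
      have hind : IndepSite i fun x : κ → Config S N => rhoCav p q i k l x ^ (2 * r + 1) :=
        fun x y hxy => congrArg (· ^ (2 * r + 1)) (rhoCav_indepSite p q i k l x y hxy)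
      have := cavNu_zero_mul β h D p q i hind (fun ε => ε k * ε l - overlapLimit p q k l)
      rw [nu0Avg_sub, nu0Avg_mul_eq_overlapLimit hfp, nu0Avg_const, sub_self, mul_zero] at this
      exact this
    let g : (Option (Option κ) → Config S N) → ℝ := fun x =>
      2 * (S : ℝ) ^ 2 * derivConst S (Fintype.card κ) * ∑ a, ∑ b,
        (rhoCav p q i (some (some k)) (some (some l)) x ^ (2 * r + 2)
          + rhoCav p q i a b x ^ (2 * r + 2))
    have hfg : ∀ x, |cavDeriv p q i f x| ≤ g x := by
      intro x
      refine (abs_cavDeriv_le p q i f x).trans ?_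
      have hl : lift₂ f x = rhoCav p q i (some (some k)) (some (some l)) x ^ (2 * r + 1)
          * ψ i (fun k => x (some (some k))) := by
        simp [lift₂, f, rhoCav, overlapLimit]
      rw [hl, abs_mul, abs_pow]
      simp only [g]
      generalize rhoCav p q i (some (some k)) (some (some l)) x = y
      have heven : ∀ z : ℝ, |z| ^ (2 * r + 1 + 1) = z ^ (2 * r + 2) := fun z =>
        (even_two_mul (r + 1)).pow_abs z
      calc _ ≤ |y| ^ (2 * r + 1) * (2 * (S : ℝ) ^ 2) * (derivConst S (Fintype.card κ) *
            ∑ a, ∑ b, |rhoCav p q i a b x|) := by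
            have := derivConst_nonneg S (Fintype.card κ)
            gcongr
            exact hψ i fun k => x (some (some k))
        _ = 2 * (S : ℝ) ^ 2 * derivConst S (Fintype.card κ) * ∑ a, ∑ b, |y| ^ (2 * r + 1)
            * |rhoCav p q i a b x| := by
            simp only [← Finset.mul_sum]; ring
        _ ≤ _ := by
            refine mul_le_mul_of_nonneg_left (Finset.sum_le_sum fun a _ => Finset.sum_le_sum
              fun b _ => ?_) (mul_nonneg (by positivity) (derivConst_nonneg _ _))
            refine (pow_mul_le_add_pow (abs_nonneg _) (abs_nonneg _) _).trans (le_of_eq ?_)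
            rw [heven, heven]
    have hg : nuAvg S N β h D g ≤ 2 * (S : ℝ) ^ 2 * derivConst S (Fintype.card κ) *
        (((Fintype.card κ : ℝ) + 2) ^ 2 * (2 * M)) := by
      simp only [g]
      rw [nuAvg_const_mul]
      refine mul_le_mul_of_nonneg_left ?_ (mul_nonneg (by positivity) (derivConst_nonneg _ _))
      simp only [nuAvg_sum hN, nuAvg_add hN]
      calc _ ≤ ∑ _a : Option (Option κ), ∑ _b : Option (Option κ), (M + M) :=
            Finset.sum_le_sum fun a _ => Finset.sum_le_sum fun b _ =>
              add_le_add (nuAvg_rhoCav_pow_le hp hq hN r i _ _) (nuAvg_rhoCav_pow_le hp hq hN r i _ _)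
        _ = _ := by
            simp only [Finset.sum_const, Finset.card_univ, Fintype.card_option, nsmul_eq_mul]
            push_cast
            ring
    have h2 := abs_cavNu_sub_le (β := β) h D hp hq hq0 i hfg
      (Set.right_mem_Icc.2 (by positivity : (0 : ℝ) ≤ Real.pi / 2))
    rw [cavNu_pi_div_two, h0, sub_zero] at h2
    have hexp : Real.exp (2 * (β ^ 2 * growthConst S (Fintype.card κ + 2))) ≤ 3 :=
      (Real.exp_le_exp.2 hβ).trans (by linarith [Real.exp_one_lt_d9])
    have hg0 : 0 ≤ nuAvg S N β h D g := nuAvg_nonneg hN fun x => (abs_nonneg _).trans (hfg x)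
    have h3 : nuAvg S N β h D f ≤ β ^ 2 * momentConst S (Fintype.card κ) * M := by
      calc _ ≤ _ := (le_abs_self _).trans h2
        _ ≤ 2 * (β ^ 2 * (3 * (2 * (S : ℝ) ^ 2 * derivConst S (Fintype.card κ) *
            (((Fintype.card κ : ℝ) + 2) ^ 2 * (2 * M))))) := by gcongr
        _ = _ := by unfold momentConst; ring
    linarith
  simp only [hsplit]
  rw [nuAvg_const_mul, nuAvg_sum hN, one_div, inv_mul_le_iff₀ hN0]
  refine (Finset.sum_le_sum fun i _ => hper i).trans (le_of_eq ?_)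
  rw [Finset.sum_const, Finset.card_univ, Fintype.card_fin, nsmul_eq_mul]

/-- The centered overlaps are of order `N ^ (-1 / 2)` in every moment. -/
theorem exists_moment_le (hfp : IsFixedPoint S β h D p q) (hp : |p| ≤ (S : ℝ) ^ 2)
    (hq : |q| ≤ (S : ℝ) ^ 2) (hq0 : 0 ≤ q)
    (hβ3 : 2 * (β ^ 2 * growthConst S 3) ≤ 1) (hβ4 : 2 * (β ^ 2 * growthConst S 4) ≤ 1)
    (hβ : β ^ 2 * (momentConst S 1 + momentConst S 2) ≤ 1 / 2) (r : ℕ) :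
    ∃ C : ℝ, 0 ≤ C ∧ ∀ N : ℕ, 1 ≤ N → moment S N β h D p q r ≤ C * (1 / (N : ℝ)) ^ r := by
  induction r with
  | zero =>
    refine ⟨2, by norm_num, fun N hN => ?_⟩
    simp only [moment, mul_zero, pow_zero, nuAvg_const]
    norm_num
  | succ r ih =>
    obtain ⟨C, hC, hm⟩ := ih
    set c₁ : ℝ := (2 * r + 2) * (4 * (S : ℝ) ^ 2) * 4 ^ r with hc₁
    set c₂ : ℝ := 2 * (S : ℝ) ^ 2 * ((2 * r + 1) * 4 ^ r) with hc₂
    have hc1 : 0 ≤ c₁ := by positivity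
    have hc2 : 0 ≤ c₂ := by positivity
    refine ⟨(c₁ + 4 * c₂) * ((S : ℝ) ^ 2 * (C + ((S : ℝ) ^ 2) ^ (2 * r))), by positivity,
      fun N hN => ?_⟩
    have hN0 : (0 : ℝ) < N := by exact_mod_cast hN
    have hN1 : 1 / (N : ℝ) ≤ 1 := by rw [div_le_one hN0]; exact_mod_cast hN
    have hA := nuAvg_rho_pow_succ_le (κ := Fin 1) hfp hp hq hq0 (by simpa using hβ3) hN r 0 0
    have hB := nuAvg_rho_pow_succ_le (κ := Fin 2) hfp hp hq hq0 (by simpa using hβ4) hN r 0 1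
    simp only [Fintype.card_fin, ← hc₁, ← hc₂] at hA hB
    set e := siteError S N β h D p q r with he
    have hM : moment S N β h D p q (r + 1)
        = nuAvg S N β h D (κ := Fin 1) (fun x => rho p q 0 0 x ^ (2 * (r + 1)))
          + nuAvg S N β h D (κ := Fin 2) (fun x => rho p q 0 1 x ^ (2 * (r + 1))) := rfl
    have hm0 : ∀ r, 0 ≤ moment S N β h D p q r := fun r =>
      (nuAvg_nonneg hN fun x => by rw [pow_mul]; positivity).trans
        (nuAvg_rho_pow_le (κ := Fin 1) hN r 0 0)
    have he0 : 0 ≤ e := by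
      have := hm0 r
      rw [he]; unfold siteError; rw [pow_mul]; positivity
    have heB : e ≤ (S : ℝ) ^ 2 * (C + ((S : ℝ) ^ 2) ^ (2 * r)) * (1 / (N : ℝ)) ^ (r + 1) := by
      have e1 : ((S : ℝ) ^ 2 / N) ^ (2 * r) ≤ ((S : ℝ) ^ 2) ^ (2 * r) * (1 / (N : ℝ)) ^ r := by
        rw [div_eq_mul_one_div, mul_pow]
        exact mul_le_mul_of_nonneg_left (pow_le_pow_of_le_one (by positivity) hN1 (by omega))
          (by positivity)
      calc e ≤ (S : ℝ) ^ 2 / N * (C * (1 / (N : ℝ)) ^ r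
            + ((S : ℝ) ^ 2) ^ (2 * r) * (1 / (N : ℝ)) ^ r) := by
            rw [he]; unfold siteError
            gcongr
            exact hm N hN
        _ = _ := by rw [pow_succ]; ring
    have hsum : moment S N β h D p q (r + 1)
        ≤ 1 / 2 * (moment S N β h D p q (r + 1) + c₁ * e) + 2 * (c₂ * e) := by
      have h3 : β ^ 2 * (momentConst S 1 + momentConst S 2) * (moment S N β h D p q (r + 1) + c₁ * e)
          ≤ 1 / 2 * (moment S N β h D p q (r + 1) + c₁ * e) :=
        mul_le_mul_of_nonneg_right hβ (add_nonneg (hm0 _) (mul_nonneg hc1 he0))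
      linarith
    calc moment S N β h D p q (r + 1) ≤ (c₁ + 4 * c₂) * e := by linarith
      _ ≤ _ := by rw [mul_assoc (c₁ + 4 * c₂)]; gcongr

end Moments

/-! ### Orders of magnitude -/

/-- The parameters are in the high-temperature regime: `(p, q)` solves the replica symmetric
equations, and the temperature is high enough for the recursive estimate of the moments. -/
structure HighTemp (S : ℕ) (β h D p q : ℝ) : Prop where
  fixed : IsFixedPoint S β h D p q
  abs_p_le : |p| ≤ (S : ℝ) ^ 2
  abs_q_le : |q| ≤ (S : ℝ) ^ 2
  q_nonneg : 0 ≤ q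
  growth_three : 2 * (β ^ 2 * growthConst S 3) ≤ 1
  growth_four : 2 * (β ^ 2 * growthConst S 4) ≤ 1
  moment_le : β ^ 2 * (momentConst S 1 + momentConst S 2) ≤ 1 / 2

/-- The typical size of an overlap fluctuation. -/
def fluct (N : ℕ) : ℝ := 1 / Real.sqrt N

theorem fluct_pos {N : ℕ} (hN : 1 ≤ N) : 0 < fluct N := by
  have : (0 : ℝ) < N := by exact_mod_cast hN
  unfold fluct; positivity

theorem fluct_sq (N : ℕ) : fluct N ^ 2 = 1 / N := by
  unfold fluct
  rw [div_pow, one_pow, Real.sq_sqrt (Nat.cast_nonneg _)]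

theorem fluct_le_one {N : ℕ} (hN : 1 ≤ N) : fluct N ≤ 1 := by
  unfold fluct
  rw [div_le_one (Real.sqrt_pos.2 (by exact_mod_cast hN))]
  exact Real.one_le_sqrt.2 (by exact_mod_cast hN)

section Size

variable {S N : ℕ} {β h D p q : ℝ} {κ : Type} [Fintype κ] [DecidableEq κ]

/-- A common bound for all centered overlaps of the replicas, at least `N ^ (-1 / 2)`. A function
bounded by a multiple of `size ^ d` has an average of order `N ^ (-d / 2)`. -/
def size (p q : ℝ) (x : κ → Config S N) : ℝ := ∑ k, ∑ l, |rho p q k l x| + fluct N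

theorem fluct_le_size (x : κ → Config S N) : fluct N ≤ size p q x :=
  le_add_of_nonneg_left (Finset.sum_nonneg fun _ _ => Finset.sum_nonneg fun _ _ => abs_nonneg _)

theorem size_nonneg (x : κ → Config S N) : 0 ≤ size p q x :=
  (by unfold fluct; positivity : 0 ≤ fluct N).trans (fluct_le_size x)

theorem inv_le_size_sq (x : κ → Config S N) : 1 / (N : ℝ) ≤ size p q x ^ 2 := by
  rw [← fluct_sq]
  exact pow_le_pow_left₀ (by unfold fluct; positivity) (fluct_le_size x) 2

theorem abs_rho_le_size (k l : κ) (x : κ → Config S N) : |rho p q k l x| ≤ size p q x := by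
  have h1 : |rho p q k l x| ≤ ∑ l, |rho p q k l x| :=
    Finset.single_le_sum (f := fun l => |rho p q k l x|) (fun _ _ => abs_nonneg _) (Finset.mem_univ l)
  have h2 : ∑ l, |rho p q k l x| ≤ ∑ k, ∑ l, |rho p q k l x| :=
    Finset.single_le_sum (f := fun k => ∑ l, |rho p q k l x|)
      (fun _ _ => Finset.sum_nonneg fun _ _ => abs_nonneg _) (Finset.mem_univ k)
  have : 0 ≤ fluct N := by unfold fluct; positivity
  unfold size
  linarith

theorem abs_rhoCav_le_size (i : Fin N) (k l : κ) (x : κ → Config S N) :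
    |rhoCav p q i k l x| ≤ (1 + (S : ℝ) ^ 2) * size p q x := by
  have h1 := abs_rho_sub_rhoCav_le p q i k l x
  have h2 := abs_rho_le_size (p := p) (q := q) k l x
  have h3 : 1 / (N : ℝ) ≤ size p q x := by
    rw [← fluct_sq, sq]
    exact (mul_le_of_le_one_left (by unfold fluct; positivity) (fluct_le_one i.pos)).trans
      (fluct_le_size x)
  have h4 : (S : ℝ) ^ 2 / N ≤ (S : ℝ) ^ 2 * size p q x := by
    rw [div_eq_mul_one_div]; gcongr
  have := abs_sub_abs_le_abs_sub (rhoCav p q i k l x) (rho p q k l x)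
  rw [abs_sub_comm] at this
  linarith

theorem size_lift_le (x : Option (Option κ) → Config S N) :
    size p q (fun k => x (some (some k))) ≤ size p q x := by
  unfold size
  simp only [Fintype.sum_option]
  have h0 : ∀ k l : κ, rho p q k l (fun k => x (some (some k)))
      = rho p q (some (some k)) (some (some l)) x := fun k l => by
    simp [rho, overlapLimit]
  simp only [h0]
  have e : ∀ k : κ, ∑ l : κ, |rho p q (some (some k)) (some (some l)) x|
      ≤ |rho p q (some (some k)) none x| + (|rho p q (some (some k)) (some none) x|
        + ∑ l : κ, |rho p q (some (some k)) (some (some l)) x|) := fun k => by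
    have := abs_nonneg (rho p q (some (some k)) none x)
    have := abs_nonneg (rho p q (some (some k)) (some none) x)
    linarith
  have e' := Finset.sum_le_sum fun k (_ : k ∈ Finset.univ) => e k
  have a1 : 0 ≤ |rho p q none none x| + (|rho p q none (some none) x|
      + ∑ l : κ, |rho p q none (some (some l)) x|) := by positivity
  have a2 : 0 ≤ |rho p q (some none) none x| + (|rho p q (some none) (some none) x|
      + ∑ l : κ, |rho p q (some none) (some (some l)) x|) := by positivity
  linarith

theorem abs_cavDeriv_le_size (i : Fin N) {f : (κ → Config S N) → ℝ} {C : ℝ} {d : ℕ}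
    (hf : ∀ x, |f x| ≤ C * size p q x ^ d) (hC : 0 ≤ C) (x : Option (Option κ) → Config S N) :
    |cavDeriv p q i f x| ≤ C * (derivConst S (Fintype.card κ) *
      (((Fintype.card κ : ℝ) + 2) ^ 2 * (1 + (S : ℝ) ^ 2))) * size p q x ^ (d + 1) := by
  have h0 := size_nonneg (p := p) (q := q) x
  have hd := derivConst_nonneg S (Fintype.card κ)
  calc _ ≤ |lift₂ f x| * (derivConst S (Fintype.card κ) * ∑ k, ∑ l, |rhoCav p q i k l x|) :=
        abs_cavDeriv_le p q i f x
    _ ≤ C * size p q x ^ d * (derivConst S (Fintype.card κ) *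
        ∑ _k : Option (Option κ), ∑ _l : Option (Option κ), (1 + (S : ℝ) ^ 2) * size p q x) := by
        have h1 : |lift₂ f x| ≤ C * size p q x ^ d := by
          refine (hf _).trans ?_
          have h2 := size_lift_le (p := p) (q := q) x
          have h3 := size_nonneg (p := p) (q := q) (fun k => x (some (some k)))
          gcongr
        have h2 : ∀ k l, |rhoCav p q i k l x| ≤ (1 + (S : ℝ) ^ 2) * size p q x :=
          fun k l => abs_rhoCav_le_size i k l x
        gcongr
        exact h2 _ _
    _ = _ := by
        simp only [Finset.sum_const, Finset.card_univ, Fintype.card_option, nsmul_eq_mul]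
        push_cast
        ring

theorem sum_pow_le {J : Type*} (s : Finset J) {f : J → ℝ} (hf : ∀ j ∈ s, 0 ≤ f j) (m : ℕ) :
    (∑ j ∈ s, f j) ^ (m + 1) ≤ (s.card : ℝ) ^ m * ∑ j ∈ s, f j ^ (m + 1) := by
  rcases s.eq_empty_or_nonempty with rfl | hs
  · simp
  · have hc : (0 : ℝ) < s.card := by exact_mod_cast hs.card_pos
    have := pow_sum_div_card_le_sum_pow hf m
    rwa [div_le_iff₀ (by positivity), mul_comm] at this

variable (κ) in
theorem HighTemp.exists_nuAvg_size_pow_le (H : HighTemp S β h D p q) (d : ℕ) :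
    ∃ K : ℝ, 0 ≤ K ∧ ∀ N : ℕ, 1 ≤ N →
      nuAvg S N β h D (fun x : κ → Config S N => size p q x ^ d) ≤ K * fluct N ^ d := by
  rcases d with _ | d
  · exact ⟨1, zero_le_one, fun N hN => by simp [nuAvg_const]⟩
  obtain ⟨C, hC, hm⟩ := exists_moment_le H.fixed H.abs_p_le H.abs_q_le H.q_nonneg H.growth_three
    H.growth_four H.moment_le (d + 1)
  set n : ℝ := ((Finset.univ : Finset (κ × κ)).card : ℝ) with hn
  set c : ℝ := 2 ^ (2 * d + 1) * n ^ (2 * d + 1) with hc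
  have hc0 : 0 ≤ c := by positivity
  refine ⟨1 + c * n * C + 2 ^ (2 * d + 1), by positivity, fun N hN => ?_⟩
  have hδ := fluct_pos hN
  set δ := fluct N with hδ'
  have hpt : ∀ x : κ → Config S N, size p q x ^ (d + 1) ≤ δ ^ (d + 1) + (1 / δ ^ (d + 1)) *
      (c * ∑ e : κ × κ, rho p q e.1 e.2 x ^ (2 * (d + 1)) + 2 ^ (2 * d + 1) * δ ^ (2 * (d + 1))) := by
    intro x
    set Q := size p q x with hQ
    have hQ0 : 0 ≤ Q := size_nonneg x
    have h1 : Q ^ (d + 1) ≤ δ ^ (d + 1) + (1 / δ ^ (d + 1)) * Q ^ (2 * (d + 1)) := by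
      have hu : 0 < δ ^ (d + 1) := by positivity
      have hv : 0 ≤ Q ^ (d + 1) := by positivity
      rw [show Q ^ (2 * (d + 1)) = Q ^ (d + 1) * Q ^ (d + 1) by ring]
      generalize δ ^ (d + 1) = u at hu ⊢
      generalize Q ^ (d + 1) = v at hv ⊢
      rw [one_div, ← div_eq_inv_mul]
      rcases le_total v u with hvu | hvu
      · have : 0 ≤ v * v / u := by positivity
        linarith
      · have : v ≤ v * v / u := by rw [le_div_iff₀ hu]; gcongr
        linarith
    have h2 : Q ^ (2 * (d + 1)) ≤ c * ∑ e : κ × κ, rho p q e.1 e.2 x ^ (2 * (d + 1))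
        + 2 ^ (2 * d + 1) * δ ^ (2 * (d + 1)) := by
      have hQ' : Q = ∑ e : κ × κ, |rho p q e.1 e.2 x| + δ := by
        rw [hQ, size, Fintype.sum_prod_type]
      rw [hQ', show 2 * (d + 1) = 2 * d + 1 + 1 by ring]
      refine (add_pow_le (Finset.sum_nonneg fun _ _ => abs_nonneg _) hδ.le _).trans ?_
      rw [Nat.add_sub_cancel, mul_add]
      refine add_le_add_left ?_ _
      rw [hc, mul_assoc]
      refine mul_le_mul_of_nonneg_left ((sum_pow_le _ (fun _ _ => abs_nonneg _) _).trans
        (le_of_eq ?_)) (by positivity)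
      congr 1
      refine Finset.sum_congr rfl fun e _ => ?_
      exact (even_two_mul (d + 1)).pow_abs _
    refine h1.trans ?_
    gcongr
  calc _ ≤ nuAvg S N β h D (fun x : κ → Config S N => δ ^ (d + 1) + (1 / δ ^ (d + 1)) *
      (c * ∑ e : κ × κ, rho p q e.1 e.2 x ^ (2 * (d + 1)) + 2 ^ (2 * d + 1) * δ ^ (2 * (d + 1)))) :=
        nuAvg_mono hN hpt
    _ = δ ^ (d + 1) + (1 / δ ^ (d + 1)) * (c * ∑ e : κ × κ, nuAvg S N β h D
          (fun x : κ → Config S N => rho p q e.1 e.2 x ^ (2 * (d + 1)))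
          + 2 ^ (2 * d + 1) * δ ^ (2 * (d + 1))) := by
        rw [nuAvg_add hN, nuAvg_const_mul, nuAvg_add hN, nuAvg_const_mul, nuAvg_sum hN, nuAvg_const,
          nuAvg_const]
    _ ≤ δ ^ (d + 1) + (1 / δ ^ (d + 1)) * (c * ∑ _e : κ × κ, C * δ ^ (2 * (d + 1))
          + 2 ^ (2 * d + 1) * δ ^ (2 * (d + 1))) := by
        have h3 : ∀ e : κ × κ, nuAvg S N β h D
            (fun x : κ → Config S N => rho p q e.1 e.2 x ^ (2 * (d + 1))) ≤ C * δ ^ (2 * (d + 1)) := by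
          intro e
          refine (nuAvg_rho_pow_le hN (d + 1) e.1 e.2).trans ((hm N hN).trans (le_of_eq ?_))
          rw [pow_mul, hδ', fluct_sq]
        gcongr
        exact h3 _
    _ = _ := by
        rw [Finset.sum_const, nsmul_eq_mul, ← hn,
          show δ ^ (2 * (d + 1)) = δ ^ (d + 1) * δ ^ (d + 1) by ring]
        field_simp
        ring

/-- A function bounded by `C * size ^ d` has averages of order `N ^ (-d / 2)` along the whole cavity
interpolation. -/
theorem HighTemp.exists_abs_cavNu_le (H : HighTemp S β h D p q) (κ : Type) [Fintype κ]
    [DecidableEq κ] (d : ℕ) : ∃ K : ℝ, 0 ≤ K ∧ ∀ N : ℕ, 1 ≤ N → ∀ (i : Fin N)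
      (f : (κ → Config S N) → ℝ) (C : ℝ), 0 ≤ C → (∀ x, |f x| ≤ C * size p q x ^ d) →
      ∀ θ ∈ Set.Icc 0 (Real.pi / 2), |cavNu β h D p q i θ f| ≤ C * K * fluct N ^ d := by
  obtain ⟨K, hK, hs⟩ := H.exists_nuAvg_size_pow_le κ d
  refine ⟨Real.exp (2 * (β ^ 2 * growthConst S (Fintype.card κ))) * K, by positivity,
    fun N hN i f C hC hf θ hθ => ?_⟩
  have h1 := cavNu_le_nuAvg (β := β) h D H.abs_p_le H.abs_q_le H.q_nonneg i
    (f := fun x : κ → Config S N => size p q x ^ d) (fun x => pow_nonneg (size_nonneg x) d) hθ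
  calc _ ≤ C * cavNu β h D p q i θ (fun x : κ → Config S N => size p q x ^ d) := by
        rw [← cavNu_const_mul]
        exact abs_cavNu_le _ _ _ _ _ _ _ hf
    _ ≤ C * (Real.exp (2 * (β ^ 2 * growthConst S (Fintype.card κ))) * (K * fluct N ^ d)) := by
        refine mul_le_mul_of_nonneg_left (h1.trans ?_) hC
        gcongr
        exact hs N hN
    _ = _ := by ring

/-- Decoupling one site changes the average of a function of order `N ^ (-d / 2)` by a term of
order `N ^ (-(d + 1) / 2)`. -/
theorem HighTemp.exists_abs_cavNu_sub_le (H : HighTemp S β h D p q) (κ : Type) [Fintype κ]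
    [DecidableEq κ] (d : ℕ) : ∃ K : ℝ, 0 ≤ K ∧ ∀ N : ℕ, 1 ≤ N → ∀ (i : Fin N)
      (f : (κ → Config S N) → ℝ) (C : ℝ), 0 ≤ C → (∀ x, |f x| ≤ C * size p q x ^ d) →
      ∀ θ ∈ Set.Icc 0 (Real.pi / 2),
        |cavNu β h D p q i θ f - cavNu β h D p q i 0 f| ≤ C * K * fluct N ^ (d + 1) := by
  obtain ⟨K, hK, hs⟩ := H.exists_abs_cavNu_le (Option (Option κ)) (d + 1)
  set c : ℝ := derivConst S (Fintype.card κ) *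
      (((Fintype.card κ : ℝ) + 2) ^ 2 * (1 + (S : ℝ) ^ 2)) with hc
  have hc0 : 0 ≤ c := mul_nonneg (derivConst_nonneg _ _) (by positivity)
  refine ⟨2 * (β ^ 2 * (c * K)), by positivity, fun N hN i f C hC hf θ hθ => ?_⟩
  refine (abs_sub_le_of_abs_deriv_le (fun t => hasDerivAt_cavNu β h D p i H.q_nonneg f t)
    (M := β ^ 2 * (C * c * K * fluct N ^ (d + 1))) (fun t ht => ?_) hθ).trans (le_of_eq (by ring))
  rw [abs_mul, abs_mul, abs_of_nonneg (sq_nonneg β), mul_assoc]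
  refine mul_le_mul_of_nonneg_left ?_ (sq_nonneg _)
  have hsc : |Real.sin t * Real.cos t| ≤ 1 := by
    rw [abs_mul]
    exact mul_le_one₀ (Real.abs_sin_le_one t) (abs_nonneg _) (Real.abs_cos_le_one t)
  exact (mul_le_of_le_one_left (abs_nonneg _) hsc).trans
    (hs N hN i _ (C * c) (by positivity) (abs_cavDeriv_le_size i hf hC) t ht)

/-- Second-order expansion at the decoupled system. -/
theorem HighTemp.exists_abs_nuAvg_sub_sub_le (H : HighTemp S β h D p q) (κ : Type) [Fintype κ]
    [DecidableEq κ] (d : ℕ) : ∃ K : ℝ, 0 ≤ K ∧ ∀ N : ℕ, 1 ≤ N → ∀ (i : Fin N)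
      (f : (κ → Config S N) → ℝ) (C : ℝ), 0 ≤ C → (∀ x, |f x| ≤ C * size p q x ^ d) →
        |nuAvg S N β h D f - cavNu β h D p q i 0 f
          - β ^ 2 / 2 * cavNu β h D p q i 0 (cavDeriv p q i f)| ≤ C * K * fluct N ^ (d + 2) := by
  obtain ⟨K, hK, hs⟩ := H.exists_abs_cavNu_sub_le (Option (Option κ)) (d + 1)
  set c : ℝ := derivConst S (Fintype.card κ) *
      (((Fintype.card κ : ℝ) + 2) ^ 2 * (1 + (S : ℝ) ^ 2)) with hc
  have hc0 : 0 ≤ c := mul_nonneg (derivConst_nonneg _ _) (by positivity)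
  refine ⟨2 * (β ^ 2 * (c * K)), by positivity, fun N hN i f C hC hf => ?_⟩
  set Y := cavNu β h D p q i 0 (cavDeriv p q i f) with hY
  -- `sin θ ^ 2 / 2` is the primitive of `sin θ * cos θ`
  have hd : ∀ t, HasDerivAt (fun t => cavNu β h D p q i t f - β ^ 2 / 2 * Y * Real.sin t ^ 2)
      (β ^ 2 * ((Real.sin t * Real.cos t) * (cavNu β h D p q i t (cavDeriv p q i f) - Y))) t := by
    intro t
    refine ((hasDerivAt_cavNu β h D p i H.q_nonneg f t).sub
      (((Real.hasDerivAt_sin t).pow 2).const_mul (β ^ 2 / 2 * Y))).congr_deriv ?_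
    simp only [Nat.cast_ofNat, Nat.add_one_sub_one, pow_one]
    ring
  have h1 := abs_sub_le_of_abs_deriv_le hd
    (M := β ^ 2 * (C * c * K * fluct N ^ (d + 2))) (fun t ht => ?_)
    (Set.right_mem_Icc.2 (by positivity : (0 : ℝ) ≤ Real.pi / 2))
  · rw [cavNu_pi_div_two] at h1
    simp only [Real.sin_pi_div_two, Real.sin_zero] at h1
    refine le_trans (le_of_eq ?_) (h1.trans (le_of_eq (by ring)))
    congr 1
    ring
  · rw [abs_mul, abs_of_nonneg (sq_nonneg β), abs_mul]
    refine mul_le_mul_of_nonneg_left ?_ (sq_nonneg _)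
    have hsc : |Real.sin t * Real.cos t| ≤ 1 := by
      rw [abs_mul]
      exact mul_le_one₀ (Real.abs_sin_le_one t) (abs_nonneg _) (Real.abs_cos_le_one t)
    exact (mul_le_of_le_one_left (abs_nonneg _) hsc).trans
      (hs N hN i _ (C * c) (by positivity) (abs_cavDeriv_le_size i hf hC) t ht)

end Size

/-! ### Linear forms in the overlaps and their decoupled covariances -/

section LinearForms

/-- The sum of the absolute values of the coefficients. -/
def coefNorm {κ : Type} [Fintype κ] (θ : κ → κ → ℝ) : ℝ := ∑ k, ∑ l, |θ k l|

theorem coefNorm_nonneg {κ : Type} [Fintype κ] (θ : κ → κ → ℝ) : 0 ≤ coefNorm θ :=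
  Finset.sum_nonneg fun _ _ => Finset.sum_nonneg fun _ _ => abs_nonneg _

theorem abs_sum_mul_le_coefNorm {κ : Type} [Fintype κ] {θ W : κ → κ → ℝ} {B : ℝ} (hW : ∀ k l, |W k l| ≤ B) :
    |∑ k, ∑ l, θ k l * W k l| ≤ coefNorm θ * B := by
  unfold coefNorm
  rw [Finset.sum_mul]
  refine (Finset.abs_sum_le_sum_abs _ _).trans (Finset.sum_le_sum fun k _ => ?_)
  rw [Finset.sum_mul]
  refine (Finset.abs_sum_le_sum_abs _ _).trans (Finset.sum_le_sum fun l _ => ?_)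
  rw [abs_mul]
  exact mul_le_mul_of_nonneg_left (hW k l) (abs_nonneg _)

theorem rhoCav_comm {S N : ℕ} {κ : Type} [DecidableEq κ] {p q : ℝ} (i : Fin N) (k l : κ) (x : κ → Config S N) :
    rhoCav p q i k l x = rhoCav p q i l k x := by
  simp only [rhoCav, overlapLimit, mul_comm, eq_comm]

variable {S N : ℕ} {β h D p q : ℝ} {κ : Type} [Fintype κ] [DecidableEq κ]

/-- The coefficients `1` at `k₁` and `-1` at `a`. -/
def chi (k₁ a k : κ) : ℝ := (if k = k₁ then 1 else 0) - if k = a then 1 else 0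

/-- A linear form in the centered overlaps. -/
def lin (p q : ℝ) (θ : κ → κ → ℝ) (x : κ → Config S N) : ℝ := ∑ k, ∑ l, θ k l * rho p q k l x

/-- A linear form in the centered overlaps without the contribution of the site `i`. -/
def linCav (p q : ℝ) (i : Fin N) (θ : κ → κ → ℝ) (x : κ → Config S N) : ℝ :=
  ∑ k, ∑ l, θ k l * rhoCav p q i k l x

/-- The quadratic form in the replicas of one spin. -/
def quad (θ : κ → κ → ℝ) (ε : κ → ℝ) : ℝ := ∑ k, ∑ l, θ k l * (ε k * ε l)

/-- The coefficients of `(ε k₁ - ε a) * (ε k₂ - ε b)`. -/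
def pairForm (k₁ k₂ a b : κ) (k l : κ) : ℝ := chi k₁ a k * chi k₂ b l

theorem sum_pairForm_mul (k₁ k₂ a b : κ) (W : κ → κ → ℝ) :
    ∑ k, ∑ l, pairForm k₁ k₂ a b k l * W k l = W k₁ k₂ - W k₁ b - W a k₂ + W a b := by
  have h : ∀ (c d : κ) (w : κ → ℝ), ∑ k, chi c d k * w k = w c - w d := fun c d w => by
    simp [chi, sub_mul]
  simp only [pairForm, mul_assoc, ← Finset.mul_sum, h]
  ring

theorem quad_pairForm (k₁ k₂ a b : κ) (ε : κ → ℝ) :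
    quad (pairForm k₁ k₂ a b) ε = (ε k₁ - ε a) * (ε k₂ - ε b) := by
  rw [quad, sum_pairForm_mul]; ring

theorem lin_eq (i : Fin N) (θ : κ → κ → ℝ) (x : κ → Config S N) :
    lin p q θ x = linCav p q i θ x + 1 / N * quad θ fun k => (x k i).toReal := by
  simp only [lin, linCav, quad, Finset.mul_sum, ← Finset.sum_add_distrib, rho_eq p q i]
  exact Finset.sum_congr rfl fun k _ => Finset.sum_congr rfl fun l _ => by ring

theorem linCav_indepSite (i : Fin N) (θ : κ → κ → ℝ) : IndepSite (S := S) i (linCav p q i θ) := by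
  intro x y hxy
  unfold linCav
  exact Finset.sum_congr rfl fun k _ => Finset.sum_congr rfl fun l _ => by
    rw [rhoCav_indepSite p q i k l x y hxy]

theorem prod_linCav_indepSite {J : Type*} (s : Finset J) (i : Fin N) (θ : J → κ → κ → ℝ) :
    IndepSite (S := S) i fun x => ∏ j ∈ s, linCav p q i (θ j) x :=
  fun x y hxy => Finset.prod_congr rfl fun j _ => linCav_indepSite i (θ j) x y hxy

theorem abs_lin_le (θ : κ → κ → ℝ) (x : κ → Config S N) :
    |lin p q θ x| ≤ (1 + (S : ℝ) ^ 2) * coefNorm θ * size p q x := by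
  refine (abs_sum_mul_le_coefNorm (B := size p q x) fun k l => abs_rho_le_size k l x).trans ?_
  have := mul_nonneg (coefNorm_nonneg θ) (size_nonneg (p := p) (q := q) x)
  nlinarith [mul_nonneg (sq_nonneg (S : ℝ)) this]

theorem abs_linCav_le (i : Fin N) (θ : κ → κ → ℝ) (x : κ → Config S N) :
    |linCav p q i θ x| ≤ (1 + (S : ℝ) ^ 2) * coefNorm θ * size p q x :=
  (abs_sum_mul_le_coefNorm fun k l => abs_rhoCav_le_size i k l x).trans (le_of_eq (by ring))

theorem abs_quad_le {κ : Type} [Fintype κ] (θ : κ → κ → ℝ) (i : Fin N) (x : κ → Config S N) :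
    |quad θ fun k => (x k i).toReal| ≤ (1 + (S : ℝ) ^ 2) * coefNorm θ := by
  refine (abs_sum_mul_le_coefNorm fun k l => abs_spin_mul_le (x k i) (x l i)).trans ?_
  have := coefNorm_nonneg θ
  linarith

theorem abs_lin_sub_linCav_le (i : Fin N) (θ : κ → κ → ℝ) (x : κ → Config S N) :
    |lin p q θ x - linCav p q i θ x| ≤ (1 + (S : ℝ) ^ 2) * coefNorm θ * size p q x ^ 2 := by
  rw [lin_eq i, add_sub_cancel_left, abs_mul, abs_of_nonneg (by positivity : 0 ≤ 1 / (N : ℝ)), mul_comm]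
  have := coefNorm_nonneg θ
  exact mul_le_mul (abs_quad_le θ i x) (inv_le_size_sq x) (by positivity) (by positivity)

/-- The four replicas of a factor `T_{k₁,k₂}` and of its two private replicas. -/
structure Distinct (k₁ k₂ a b : κ) : Prop where
  h12 : k₁ ≠ k₂
  h1a : k₁ ≠ a
  h1b : k₁ ≠ b
  h2a : k₂ ≠ a
  h2b : k₂ ≠ b
  hab : a ≠ b

/-- The decoupled covariances of `(ε k₁ - ε a) * (ε k₂ - ε b)`: exchanging two replicas changes the
sign of one factor, so that only products of one of `ε k₁`, `ε a` with one of `ε k₂`, `ε b` are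
correlated with it. -/
theorem nu0Avg_quartic {k₁ k₂ a b : κ} (hd : Distinct k₁ k₂ a b) (k l : κ) :
    nu0Avg S β h D p q (fun ε : κ → ℝ => (ε k₁ - ε a) * (ε k₂ - ε b) * (ε k * ε l))
      = constA S β h D p q * (pairForm k₁ k₂ a b k l + pairForm k₁ k₂ a b l k) := by
  obtain ⟨h12, h1a, h1b, h2a, h2b, hab⟩ := hd
  set Φ : κ → κ → ℝ := fun k l =>
    nu0Avg S β h D p q (fun ε : κ → ℝ => (ε k₁ - ε a) * (ε k₂ - ε b) * (ε k * ε l)) with hΦ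
  have hsymm : ∀ k l, Φ k l = Φ l k := fun k l => by simp only [hΦ, mul_comm]
  have hs1 : ∀ k l, Φ (Equiv.swap k₁ a k) (Equiv.swap k₁ a l) = -Φ k l := by
    intro k l
    have := nu0Avg_comp_injective (S := S) (β := β) (h := h) (D := D) (p := p) (q := q)
      (Equiv.swap k₁ a).injective (fun ε : κ → ℝ => (ε k₁ - ε a) * (ε k₂ - ε b) * (ε k * ε l))
    simp only [hΦ]
    rw [← this, ← neg_one_mul, ← nu0Avg_const_mul]
    congr 1
    funext ε
    simp only [Function.comp, Equiv.swap_apply_left, Equiv.swap_apply_right,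
      Equiv.swap_apply_of_ne_of_ne h12.symm h2a, Equiv.swap_apply_of_ne_of_ne h1b.symm hab.symm]
    ring
  have hs2 : ∀ k l, Φ (Equiv.swap k₂ b k) (Equiv.swap k₂ b l) = -Φ k l := by
    intro k l
    have := nu0Avg_comp_injective (S := S) (β := β) (h := h) (D := D) (p := p) (q := q)
      (Equiv.swap k₂ b).injective (fun ε : κ → ℝ => (ε k₁ - ε a) * (ε k₂ - ε b) * (ε k * ε l))
    simp only [hΦ]
    rw [← this, ← neg_one_mul, ← nu0Avg_const_mul]
    congr 1
    funext ε
    simp only [Function.comp, Equiv.swap_apply_left, Equiv.swap_apply_right,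
      Equiv.swap_apply_of_ne_of_ne h12 h1b, Equiv.swap_apply_of_ne_of_ne h2a.symm hab]
    ring
  have hz1 : ∀ k l, k ≠ k₁ → k ≠ a → l ≠ k₁ → l ≠ a → Φ k l = 0 := by
    intro k l a1 a2 a3 a4
    have := hs1 k l
    rw [Equiv.swap_apply_of_ne_of_ne a1 a2, Equiv.swap_apply_of_ne_of_ne a3 a4] at this
    linarith
  have hz2 : ∀ k l, k ≠ k₂ → k ≠ b → l ≠ k₂ → l ≠ b → Φ k l = 0 := by
    intro k l a1 a2 a3 a4
    have := hs2 k l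
    rw [Equiv.swap_apply_of_ne_of_ne a1 a2, Equiv.swap_apply_of_ne_of_ne a3 a4] at this
    linarith
  have e12 : Φ k₁ k₂ = constA S β h D p q := by
    have hinj : Function.Injective ![k₁, k₂, a, b] := by
      intro u v huv
      fin_cases u <;> fin_cases v <;> simp_all [eq_comm]
    exact nu0Avg_comp_injective hinj
      (fun ε : Fin 4 → ℝ => (ε 0 - ε 2) * (ε 1 - ε 3) * (ε 0 * ε 1))
  have ea2 : Φ a k₂ = -constA S β h D p q := by
    have := hs1 k₁ k₂
    rwa [Equiv.swap_apply_left, Equiv.swap_apply_of_ne_of_ne h12.symm h2a, e12] at this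
  have e1b : Φ k₁ b = -constA S β h D p q := by
    have := hs2 k₁ k₂
    rwa [Equiv.swap_apply_left, Equiv.swap_apply_of_ne_of_ne h12 h1b, e12] at this
  have eab : Φ a b = constA S β h D p q := by
    have := hs2 a k₂
    rwa [Equiv.swap_apply_left, Equiv.swap_apply_of_ne_of_ne h2a.symm hab, ea2, neg_neg] at this
  show Φ k l = _
  have main : ∀ k l, (k = k₁ ∨ k = a) → Φ k l
      = constA S β h D p q * (pairForm k₁ k₂ a b k l + pairForm k₁ k₂ a b l k) := by
    intro k l hk
    by_cases hl : l = k₂ ∨ l = b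
    · rcases hk with rfl | rfl <;> rcases hl with rfl | rfl <;>
        simp [pairForm, chi, e12, ea2, e1b, eab, h12, h1a, h1b, h2a, h2b, hab, h12.symm, h1a.symm,
          h1b.symm, h2a.symm, h2b.symm, hab.symm]
    · push Not at hl
      rw [hz2 k l (by rcases hk with rfl | rfl; exacts [h12, h2a.symm])
        (by rcases hk with rfl | rfl; exacts [h1b, hab]) hl.1 hl.2]
      rcases hk with rfl | rfl <;>
        simp [pairForm, chi, hl.1, hl.2, h12, h1b, hab, h2a.symm]
  by_cases hk : k = k₁ ∨ k = a
  · exact main k l hk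
  · by_cases hl : l = k₁ ∨ l = a
    · rw [hsymm, main l k hl, add_comm]
    · push Not at hk hl
      rw [hz1 k l hk.1 hk.2 hl.1 hl.2]
      simp [pairForm, chi, hk.1, hk.2, hl.1, hl.2]

theorem nu0Avg_pair_mul_quad {k₁ k₂ a b : κ} (hd : Distinct k₁ k₂ a b) {θ : κ → κ → ℝ}
    (ha : ∀ k, θ a k = 0 ∧ θ k a = 0) (hb : ∀ k, θ b k = 0 ∧ θ k b = 0) :
    nu0Avg S β h D p q (fun ε : κ → ℝ => quad (pairForm k₁ k₂ a b) ε * quad θ ε)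
      = constA S β h D p q * (θ k₁ k₂ + θ k₂ k₁) := by
  simp only [quad_pairForm]
  have h1 : ∀ ε : κ → ℝ, (ε k₁ - ε a) * (ε k₂ - ε b) * quad θ ε
      = ∑ k, ∑ l, θ k l * ((ε k₁ - ε a) * (ε k₂ - ε b) * (ε k * ε l)) := by
    intro ε
    simp only [quad, Finset.mul_sum]
    exact Finset.sum_congr rfl fun k _ => Finset.sum_congr rfl fun l _ => by ring
  simp only [h1, nu0Avg_sum, nu0Avg_const_mul, nu0Avg_quartic hd]
  have h2 : ∑ k, ∑ l, θ k l * (constA S β h D p q * (pairForm k₁ k₂ a b k l + pairForm k₁ k₂ a b l k))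
      = constA S β h D p q * (∑ k, ∑ l, pairForm k₁ k₂ a b k l * θ k l
        + ∑ l, ∑ k, pairForm k₁ k₂ a b l k * θ k l) := by
    rw [Finset.sum_comm (f := fun l k => pairForm k₁ k₂ a b l k * θ k l)]
    simp only [← Finset.sum_add_distrib, Finset.mul_sum]
    exact Finset.sum_congr rfl fun k _ => Finset.sum_congr rfl fun l _ => by ring
  rw [h2, sum_pairForm_mul, sum_pairForm_mul k₁ k₂ a b fun l k => θ k l, (hb k₁).2, (ha k₂).1,
    (ha b).1, (hb k₁).1, (ha k₂).2, (ha b).2]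
  ring

theorem nu0Avg_pair {k₁ k₂ a b : κ} (hd : Distinct k₁ k₂ a b) :
    nu0Avg S β h D p q (fun ε : κ → ℝ => quad (pairForm k₁ k₂ a b) ε) = 0 := by
  have hs := nu0Avg_comp_injective (S := S) (β := β) (h := h) (D := D) (p := p) (q := q)
      (Equiv.swap k₁ a).injective (fun ε : κ → ℝ => quad (pairForm k₁ k₂ a b) ε)
  have h1 : ∀ ε : κ → ℝ, quad (pairForm k₁ k₂ a b) (ε ∘ Equiv.swap k₁ a)
      = (-1) * quad (pairForm k₁ k₂ a b) ε := by
    intro ε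
    simp only [quad_pairForm, Function.comp, Equiv.swap_apply_left, Equiv.swap_apply_right,
      Equiv.swap_apply_of_ne_of_ne hd.h12.symm hd.h2a,
      Equiv.swap_apply_of_ne_of_ne hd.h1b.symm hd.hab.symm]
    ring
  simp only [h1, nu0Avg_const_mul] at hs
  linarith

/-- The first-order term of the cavity expansion of a function whose decoupled average vanishes. -/
theorem cavNu_zero_cavDeriv {k₁ k₂ a b : κ} (hd : Distinct k₁ k₂ a b) (i : Fin N)
    {G : (κ → Config S N) → ℝ} (hG : IndepSite i G) :
    cavNu β h D p q i 0 (cavDeriv p q i fun x =>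
        G x * quad (pairForm k₁ k₂ a b) fun k => (x k i).toReal)
      = 2 * constA S β h D p q *
        cavNu β h D p q i 0 (fun x => G x * linCav p q i (pairForm k₁ k₂ a b) x) := by
  let ι : κ → Option (Option κ) := fun k => some (some k)
  have hι : Function.Injective ι := fun _ _ hab =>
    Option.some_injective _ (Option.some_injective _ hab)
  have hd' : Distinct (ι k₁) (ι k₂) (ι a) (ι b) :=
    ⟨hι.ne hd.h12, hι.ne hd.h1a, hι.ne hd.h1b, hι.ne hd.h2a, hι.ne hd.h2b, hι.ne hd.hab⟩
  let X : Option (Option κ) → Option (Option κ) → ℝ := fun k l =>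
    cavNu β h D p q i 0 fun x => lift₂ G x * rhoCav p q i k l x
  have hX : ∀ k l, X k l = X l k := fun k l => by simp only [X, rhoCav_comm i k l]
  have h1 : ∀ x : Option (Option κ) → Config S N, cavDeriv p q i (fun x =>
        G x * quad (pairForm k₁ k₂ a b) fun k => (x k i).toReal) x
      = ∑ k, ∑ l, leftCoef κ k * rightCoef κ l * ((lift₂ G x * rhoCav p q i k l x) *
        (fun ε : Option (Option κ) → ℝ => (ε (ι k₁) - ε (ι a)) * (ε (ι k₂) - ε (ι b)) * (ε k * ε l))
          fun k => (x k i).toReal) := by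
    intro x
    simp only [cavDeriv, lift₂, quad_pairForm, Finset.mul_sum, ι]
    exact Finset.sum_congr rfl fun k _ => Finset.sum_congr rfl fun l _ => by ring
  have hind : ∀ k l, IndepSite i fun x : Option (Option κ) → Config S N =>
      lift₂ G x * rhoCav p q i k l x := by
    intro k l x y hxy
    simp only [lift₂]
    rw [hG _ _ fun k j hj => hxy (some (some k)) j hj, rhoCav_indepSite p q i k l x y hxy]
  have h0 : cavNu β h D p q i 0 (cavDeriv p q i fun x =>
        G x * quad (pairForm k₁ k₂ a b) fun k => (x k i).toReal)
      = ∑ k, ∑ l, leftCoef κ k * rightCoef κ l * (X k l * (constA S β h D p q *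
        (pairForm (ι k₁) (ι k₂) (ι a) (ι b) k l + pairForm (ι k₁) (ι k₂) (ι a) (ι b) l k))) := by
    rw [funext h1, cavNu_sum]
    refine Finset.sum_congr rfl fun k _ => (cavNu_sum _ _ _ _ _ _ _ _ _).trans
      (Finset.sum_congr rfl fun l _ => (cavNu_const_mul _ _ _ _ _ _ _ _ _).trans
        (congrArg _ ((cavNu_zero_mul β h D p q i (hind k l) fun ε =>
          (ε (ι k₁) - ε (ι a)) * (ε (ι k₂) - ε (ι b)) * (ε k * ε l)).trans ?_)))
    rw [nu0Avg_quartic hd']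
  have h2 : ∑ k, ∑ l, leftCoef κ k * rightCoef κ l * (X k l * (constA S β h D p q *
        (pairForm (ι k₁) (ι k₂) (ι a) (ι b) k l + pairForm (ι k₁) (ι k₂) (ι a) (ι b) l k)))
      = constA S β h D p q * (∑ k, ∑ l, pairForm (ι k₁) (ι k₂) (ι a) (ι b) k l *
          (leftCoef κ k * rightCoef κ l * X k l)
        + ∑ l, ∑ k, pairForm (ι k₁) (ι k₂) (ι a) (ι b) l k *
          (leftCoef κ k * rightCoef κ l * X k l)) := by
    rw [Finset.sum_comm (f := fun l k => pairForm (ι k₁) (ι k₂) (ι a) (ι b) l k *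
          (leftCoef κ k * rightCoef κ l * X k l))]
    simp only [← Finset.sum_add_distrib, Finset.mul_sum]
    exact Finset.sum_congr rfl fun k _ => Finset.sum_congr rfl fun l _ => by ring
  rw [h0, h2, sum_pairForm_mul, sum_pairForm_mul (ι k₁) (ι k₂) (ι a) (ι b) fun l k =>
    leftCoef κ k * rightCoef κ l * X k l]
  simp only [ι, leftCoef, rightCoef, one_mul]
  have h3 : ∀ k l : κ, X (some (some k)) (some (some l))
      = cavNu β h D p q i 0 fun x => G x * rhoCav p q i k l x := by
    intro k l
    refine Eq.trans ?_ (cavNu_lift₂ h D i 0 fun x : κ → Config S N => G x * rhoCav p q i k l x)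
    simp only [X]
    congr 1
    funext x
    simp [lift₂, rhoCav, overlapLimit]
  have h4 : cavNu β h D p q i 0 (fun x => G x * linCav p q i (pairForm k₁ k₂ a b) x)
      = X (ι k₁) (ι k₂) - X (ι k₁) (ι b) - X (ι a) (ι k₂) + X (ι a) (ι b) := by
    simp only [ι, h3, linCav, sum_pairForm_mul]
    rw [← cavNu_sub, ← cavNu_sub, ← cavNu_add]
    congr 1
    funext x
    ring
  rw [h4]
  linear_combination constA S β h D p q * (hX (ι k₂) (ι k₁) - hX (ι b) (ι k₁) - hX (ι k₂) (ι a)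
    + hX (ι b) (ι a))

/-- The forms `T_{k₁,k₂}` are averages over the sites of `(ε k₁ - ε a) * (ε k₂ - ε b)`. -/
theorem lin_pairForm_eq {k₁ k₂ a b : κ} (hd : Distinct k₁ k₂ a b) (x : κ → Config S N) :
    lin p q (pairForm k₁ k₂ a b) x
      = 1 / N * ∑ i, quad (pairForm k₁ k₂ a b) fun k => (x k i).toReal := by
  simp only [lin, sum_pairForm_mul, quad_pairForm, rho, overlapLimit, overlap, hd.h12, hd.h1b,
    hd.h2a.symm, hd.hab, if_false]
  have : ∑ i, ((x k₁ i).toReal - (x a i).toReal) * ((x k₂ i).toReal - (x b i).toReal)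
      = ∑ i, (x k₁ i).toReal * (x k₂ i).toReal - ∑ i, (x k₁ i).toReal * (x b i).toReal
        - ∑ i, (x a i).toReal * (x k₂ i).toReal + ∑ i, (x a i).toReal * (x b i).toReal := by
    simp only [← Finset.sum_sub_distrib, ← Finset.sum_add_distrib]
    exact Finset.sum_congr rfl fun i _ => by ring
  rw [this]
  ring

end LinearForms

/-- Comparison of two products whose factors are of order `Q` and differ by terms of order
`Q ^ 2`, to zeroth and to first order. -/
theorem exists_prod_sub_prod_le {J : Type} [DecidableEq J] (s : Finset J) {C : ℝ} (hC : 0 ≤ C) :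
    ∃ K : ℝ, 0 ≤ K ∧ ∀ (u v : J → ℝ) (Q : ℝ), 0 ≤ Q → (∀ j ∈ s, |u j| ≤ C * Q) →
      (∀ j ∈ s, |v j| ≤ C * Q) → (∀ j ∈ s, |u j - v j| ≤ C * Q ^ 2) →
      |∏ j ∈ s, u j - ∏ j ∈ s, v j| ≤ K * Q ^ (s.card + 1) ∧
      |∏ j ∈ s, u j - ∏ j ∈ s, v j - ∑ j ∈ s, (u j - v j) * ∏ l ∈ s.erase j, v l|
        ≤ K * Q ^ (s.card + 2) := by
  induction s using Finset.induction_on with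
  | empty => exact ⟨0, le_rfl, fun u v Q _ _ _ _ => by simp⟩
  | insert a s ha ih =>
    obtain ⟨K, hK, ih⟩ := ih
    refine ⟨2 * (C * K) + C * C ^ s.card, by positivity, fun u v Q hQ hu hv huv => ?_⟩
    obtain ⟨i1, i2⟩ := ih u v Q hQ (fun j hj => hu j (Finset.mem_insert_of_mem hj))
      (fun j hj => hv j (Finset.mem_insert_of_mem hj))
      (fun j hj => huv j (Finset.mem_insert_of_mem hj))
    have ua := hu a (Finset.mem_insert_self a s)
    have va := hv a (Finset.mem_insert_self a s)
    have uva := huv a (Finset.mem_insert_self a s)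
    have hP : |∏ j ∈ s, v j| ≤ (C * Q) ^ s.card := by
      rw [Finset.abs_prod, ← Finset.prod_const]
      exact Finset.prod_le_prod (fun _ _ => abs_nonneg _)
        fun j hj => hv j (Finset.mem_insert_of_mem hj)
    have hsum : ∑ j ∈ insert a s, (u j - v j) * ∏ l ∈ (insert a s).erase j, v l
        = (u a - v a) * ∏ j ∈ s, v j + v a * ∑ j ∈ s, (u j - v j) * ∏ l ∈ s.erase j, v l := by
      rw [Finset.sum_insert ha, Finset.erase_insert ha, Finset.mul_sum]
      congr 1
      refine Finset.sum_congr rfl fun j hj => ?_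
      have hja : a ≠ j := fun h => ha (h ▸ hj)
      rw [Finset.erase_insert_of_ne hja, Finset.prod_insert (fun h => ha (Finset.mem_of_mem_erase h))]
      ring
    rw [hsum, Finset.prod_insert ha, Finset.prod_insert ha, Finset.card_insert_of_notMem ha]
    generalize ∏ j ∈ s, u j = U at *
    generalize ∏ j ∈ s, v j = V at *
    generalize ∑ j ∈ s, (u j - v j) * ∏ l ∈ s.erase j, v l = W at *
    have hQp : ∀ m : ℕ, 0 ≤ Q ^ m := fun m => pow_nonneg hQ m
    constructor
    · calc |u a * U - v a * V| = |u a * (U - V) + (u a - v a) * V| := by congr 1; ring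
        _ ≤ |u a| * |U - V| + |u a - v a| * |V| := by
            rw [← abs_mul, ← abs_mul]; exact abs_add_le _ _
        _ ≤ (C * Q) * (K * Q ^ (s.card + 1)) + (C * Q ^ 2) * (C * Q) ^ s.card := by gcongr
        _ = (C * K + C * C ^ s.card) * Q ^ (s.card + 1 + 1) := by rw [mul_pow]; ring
        _ ≤ _ := by
            have : 0 ≤ C * K := by positivity
            exact mul_le_mul_of_nonneg_right (by linarith) (hQp _)
    · calc |u a * U - v a * V - ((u a - v a) * V + v a * W)|
          = |v a * (U - V - W) + (u a - v a) * (U - V)| := by congr 1; ring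
        _ ≤ |v a| * |U - V - W| + |u a - v a| * |U - V| := by
            rw [← abs_mul, ← abs_mul]; exact abs_add_le _ _
        _ ≤ (C * Q) * (K * Q ^ (s.card + 2)) + (C * Q ^ 2) * (K * Q ^ (s.card + 1)) := by gcongr
        _ = (2 * (C * K)) * Q ^ (s.card + 1 + 2) := by ring
        _ ≤ _ := by
            have : 0 ≤ C * C ^ s.card := by positivity
            exact mul_le_mul_of_nonneg_right (by linarith) (hQp _)

/-! ### The recursion for mixed moments -/

section Recursion

variable {S : ℕ} {β h D p q : ℝ}

theorem HighTemp.exists_abs_nuAvg_le (H : HighTemp S β h D p q) (κ : Type) [Fintype κ]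
    [DecidableEq κ] (d : ℕ) : ∃ K : ℝ, 0 ≤ K ∧ ∀ N : ℕ, 1 ≤ N →
      ∀ (f : (κ → Config S N) → ℝ) (C : ℝ), 0 ≤ C → (∀ x, |f x| ≤ C * size p q x ^ d) →
      |nuAvg S N β h D f| ≤ C * K * fluct N ^ d := by
  obtain ⟨K, hK, hs⟩ := H.exists_nuAvg_size_pow_le κ d
  refine ⟨K, hK, fun N hN f C hC hf => (abs_nuAvg_le hN hf).trans ?_⟩
  rw [nuAvg_const_mul, mul_assoc]
  exact mul_le_mul_of_nonneg_left (hs N hN) hC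

/-- A common bound for the coefficients of the linear forms with indices in `t`. -/
def formBound {κ J : Type} [Fintype κ] (S : ℕ) (t : Finset J) (θ : J → κ → κ → ℝ) : ℝ :=
  (1 + (S : ℝ) ^ 2) * ∑ j ∈ t, coefNorm (θ j)

theorem formBound_nonneg {κ J : Type} [Fintype κ] (t : Finset J) (θ : J → κ → κ → ℝ) : 0 ≤ formBound S t θ :=
  mul_nonneg (by positivity) (Finset.sum_nonneg fun j _ => coefNorm_nonneg (θ j))

theorem le_formBound {κ J : Type} [Fintype κ] {t : Finset J} (θ : J → κ → κ → ℝ) {j : J} (hj : j ∈ t) :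
    (1 + (S : ℝ) ^ 2) * coefNorm (θ j) ≤ formBound S t θ :=
  mul_le_mul_of_nonneg_left (Finset.single_le_sum (f := fun j => coefNorm (θ j))
    (fun j _ => coefNorm_nonneg (θ j)) hj) (by positivity)

variable {κ : Type} [Fintype κ] [DecidableEq κ] {J : Type}

theorem abs_prod_linCav_le {N : ℕ} (i : Fin N) (t : Finset J) (θ : J → κ → κ → ℝ)
    (x : κ → Config S N) :
    |∏ j ∈ t, linCav p q i (θ j) x| ≤ formBound S t θ ^ t.card * size p q x ^ t.card := by
  rw [Finset.abs_prod, ← mul_pow, ← Finset.prod_const]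
  exact Finset.prod_le_prod (fun _ _ => abs_nonneg _) fun j hj => (abs_linCav_le i (θ j) x).trans
    (mul_le_mul_of_nonneg_right (le_formBound θ hj) (size_nonneg x))

variable [DecidableEq J]

theorem exists_prod_lin_sub_le (t : Finset J) (θ : J → κ → κ → ℝ) :
    ∃ K : ℝ, 0 ≤ K ∧ ∀ (N : ℕ) (i : Fin N) (x : κ → Config S N),
      |∏ j ∈ t, lin p q (θ j) x - ∏ j ∈ t, linCav p q i (θ j) x| ≤ K * size p q x ^ (t.card + 1) ∧
      |∏ j ∈ t, lin p q (θ j) x - ∏ j ∈ t, linCav p q i (θ j) x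
        - ∑ j ∈ t, (1 / (N : ℝ) * quad (θ j) fun k => (x k i).toReal)
          * ∏ l ∈ t.erase j, linCav p q i (θ l) x| ≤ K * size p q x ^ (t.card + 2) := by
  obtain ⟨K, hK, hp⟩ := exists_prod_sub_prod_le t (formBound_nonneg (S := S) t θ)
  refine ⟨K, hK, fun N i x => ?_⟩
  have h0 := size_nonneg (p := p) (q := q) x
  have := hp (fun j => lin p q (θ j) x) (fun j => linCav p q i (θ j) x) (size p q x) h0
    (fun j hj => (abs_lin_le (θ j) x).trans
      (mul_le_mul_of_nonneg_right (le_formBound θ hj) h0))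
    (fun j hj => (abs_linCav_le i (θ j) x).trans
      (mul_le_mul_of_nonneg_right (le_formBound θ hj) h0))
    (fun j hj => (abs_lin_sub_linCav_le i (θ j) x).trans
      (mul_le_mul_of_nonneg_right (le_formBound θ hj) (by positivity)))
  refine ⟨this.1, ?_⟩
  have h1 := this.2
  have h2 : ∀ j, lin p q (θ j) x - linCav p q i (θ j) x
      = 1 / (N : ℝ) * quad (θ j) fun k => (x k i).toReal := fun j => by
    rw [lin_eq i, add_sub_cancel_left]
  simpa only [h2] using h1

/-- The part of the factor `θ` that comes from the site `i` is contracted with the part of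
`T_{k₁,k₂}` that comes from the same site, which gives the constant `A`. -/
theorem HighTemp.exists_site_correction (H : HighTemp S β h D p q) {k₁ k₂ a b : κ}
    (hd : Distinct k₁ k₂ a b) (t : Finset J) (θs : J → κ → κ → ℝ) {θ : κ → κ → ℝ}
    (ha : ∀ k, θ a k = 0 ∧ θ k a = 0) (hb : ∀ k, θ b k = 0 ∧ θ k b = 0) :
    ∃ K : ℝ, 0 ≤ K ∧ ∀ N : ℕ, 1 ≤ N → ∀ i : Fin N,
      |nuAvg S N β h D (fun x : κ → Config S N => (∏ j ∈ t, linCav p q i (θs j) x) *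
          (quad (pairForm k₁ k₂ a b) (fun k => (x k i).toReal) * quad θ fun k => (x k i).toReal))
        - constA S β h D p q * (θ k₁ k₂ + θ k₂ k₁) *
          nuAvg S N β h D (fun x : κ → Config S N => ∏ j ∈ t, lin p q (θs j) x)|
        ≤ K * fluct N ^ (t.card + 1) := by
  obtain ⟨K₁, hK₁, h1⟩ := H.exists_abs_cavNu_sub_le κ t.card
  obtain ⟨K₂, hK₂, h2⟩ := H.exists_abs_nuAvg_le κ (t.card + 1)
  obtain ⟨K₃, hK₃, h3⟩ := exists_prod_lin_sub_le (S := S) (p := p) (q := q) t θs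
  set c : ℝ := constA S β h D p q * (θ k₁ k₂ + θ k₂ k₁) with hc
  set B : ℝ := formBound S t θs ^ t.card with hB
  have hB0 : 0 ≤ B := pow_nonneg (formBound_nonneg t θs) _
  set m : ℝ := (1 + (S : ℝ) ^ 2) * coefNorm (pairForm k₁ k₂ a b) * ((1 + (S : ℝ) ^ 2) * coefNorm θ)
    with hm
  have hm0 : 0 ≤ m := by
    have := coefNorm_nonneg (pairForm k₁ k₂ a b)
    have := coefNorm_nonneg θ
    positivity
  refine ⟨B * m * K₁ + |c| * (B * K₁ + K₃ * K₂), by positivity, fun N hN i => ?_⟩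
  have hπ : Real.pi / 2 ∈ Set.Icc 0 (Real.pi / 2) := Set.right_mem_Icc.2 (by positivity)
  set P : (κ → Config S N) → ℝ := fun x => ∏ j ∈ t, linCav p q i (θs j) x with hP
  have e1 := h1 N hN i (fun x => P x * (quad (pairForm k₁ k₂ a b) (fun k => (x k i).toReal) *
    quad θ fun k => (x k i).toReal)) (B * m) (by positivity) (fun x => by
      rw [abs_mul, abs_mul]
      calc _ ≤ (B * size p q x ^ t.card) * m := by
            rw [hm]
            have := size_nonneg (p := p) (q := q) x
            have := coefNorm_nonneg (pairForm k₁ k₂ a b)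
            gcongr
            · exact abs_prod_linCav_le i t θs x
            · exact abs_quad_le _ i x
            · exact abs_quad_le _ i x
        _ = _ := by ring) _ hπ
  have e2 := h1 N hN i P B hB0 (fun x => abs_prod_linCav_le i t θs x) _ hπ
  have e3 := h2 N hN (fun x => ∏ j ∈ t, lin p q (θs j) x - P x) K₃ hK₃ fun x => (h3 N i x).1
  have e4 := cavNu_zero_mul β h D p q i (prod_linCav_indepSite (S := S) (p := p) (q := q) t i θs)
    fun ε => quad (pairForm k₁ k₂ a b) ε * quad θ ε
  rw [nu0Avg_pair_mul_quad hd ha hb, ← hc] at e4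
  rw [cavNu_pi_div_two] at e1 e2
  rw [nuAvg_sub hN] at e3
  have e5 : |c * (nuAvg S N β h D P - cavNu β h D p q i 0 P)| ≤ |c| * (B * K₁ * fluct N ^ (t.card + 1)) := by
    rw [abs_mul]; gcongr
  have e6 : |c * (nuAvg S N β h D (fun x : κ → Config S N => ∏ j ∈ t, lin p q (θs j) x)
      - nuAvg S N β h D P)| ≤ |c| * (K₃ * K₂ * fluct N ^ (t.card + 1)) := by
    rw [abs_mul]; gcongr
  rw [e4] at e1
  rw [abs_le] at *
  constructor <;> linarith [e1.1, e1.2, e5.1, e5.2, e6.1, e6.2]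

/-- The leading contribution of the product of the other factors with the site `i` removed: its
decoupled average vanishes, and the derivative at the decoupled system reproduces the mixed
moment. -/
theorem HighTemp.exists_site_main (H : HighTemp S β h D p q) {k₁ k₂ a b : κ}
    (hd : Distinct k₁ k₂ a b) (t : Finset J) (θs : J → κ → κ → ℝ) :
    ∃ K : ℝ, 0 ≤ K ∧ ∀ N : ℕ, 1 ≤ N → ∀ i : Fin N,
      |nuAvg S N β h D (fun x : κ → Config S N => (∏ j ∈ t, linCav p q i (θs j) x) *
          quad (pairForm k₁ k₂ a b) (fun k => (x k i).toReal))
        - β ^ 2 * constA S β h D p q *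
          nuAvg S N β h D (fun x : κ → Config S N =>
            (∏ j ∈ t, lin p q (θs j) x) * lin p q (pairForm k₁ k₂ a b) x)|
        ≤ K * fluct N ^ (t.card + 2) := by
  obtain ⟨K₁, hK₁, h1⟩ := H.exists_abs_cavNu_sub_le κ (t.card + 1)
  obtain ⟨K₂, hK₂, h2⟩ := H.exists_abs_nuAvg_le κ (t.card + 2)
  obtain ⟨K₃, hK₃, h3⟩ := exists_prod_lin_sub_le (S := S) (p := p) (q := q) t θs
  obtain ⟨K₄, hK₄, h4⟩ := H.exists_abs_nuAvg_sub_sub_le κ t.card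
  set A := constA S β h D p q with hA
  set θ₀ := pairForm k₁ k₂ a b with hθ₀
  set B : ℝ := formBound S t θs ^ t.card with hB
  have hB0 : 0 ≤ B := pow_nonneg (formBound_nonneg t θs) _
  set m : ℝ := (1 + (S : ℝ) ^ 2) * coefNorm θ₀ with hm
  have hm0 : 0 ≤ m := by
    have := coefNorm_nonneg θ₀
    positivity
  refine ⟨B * m * K₄ + |β ^ 2 * A| * (B * m * K₁ + (K₃ * m + B * m) * K₂), by positivity,
    fun N hN i => ?_⟩
  have hπ : Real.pi / 2 ∈ Set.Icc 0 (Real.pi / 2) := Set.right_mem_Icc.2 (by positivity)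
  set P : (κ → Config S N) → ℝ := fun x => ∏ j ∈ t, linCav p q i (θs j) x with hP
  have hPb : ∀ x, |P x| ≤ B * size p q x ^ t.card := fun x => abs_prod_linCav_le i t θs x
  have hind : IndepSite i P := prod_linCav_indepSite t i θs
  have e1 := h4 N hN i (fun x => P x * quad θ₀ fun k => (x k i).toReal) (B * m) (by positivity)
    fun x => by
      rw [abs_mul]
      calc _ ≤ (B * size p q x ^ t.card) * m := by
            have := size_nonneg (p := p) (q := q) x
            gcongr
            · exact hPb x
            · exact abs_quad_le _ i x
        _ = _ := by ring
  have e0 := cavNu_zero_mul β h D p q i hind (quad θ₀)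
  rw [nu0Avg_pair hd, mul_zero] at e0
  rw [e0, cavNu_zero_cavDeriv hd i hind, sub_zero, ← hA] at e1
  have e2 := h1 N hN i (fun x => P x * linCav p q i θ₀ x) (B * m) (by positivity) (fun x => by
    rw [abs_mul, pow_succ]
    calc _ ≤ (B * size p q x ^ t.card) * (m * size p q x) := by
          have := size_nonneg (p := p) (q := q) x
          gcongr
          · exact hPb x
          · exact abs_linCav_le i θ₀ x
      _ = _ := by ring) _ hπ
  rw [cavNu_pi_div_two] at e2
  have e3 := h2 N hN (fun x => (∏ j ∈ t, lin p q (θs j) x) * lin p q θ₀ x - P x * linCav p q i θ₀ x)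
    (K₃ * m + B * m) (by positivity) fun x => by
      have hQ := size_nonneg (p := p) (q := q) x
      have := (h3 N i x).1
      calc _ = |(∏ j ∈ t, lin p q (θs j) x - P x) * lin p q θ₀ x
            + P x * (lin p q θ₀ x - linCav p q i θ₀ x)| := by congr 1; ring
        _ ≤ |∏ j ∈ t, lin p q (θs j) x - P x| * |lin p q θ₀ x|
            + |P x| * |lin p q θ₀ x - linCav p q i θ₀ x| := by
            rw [← abs_mul, ← abs_mul]; exact abs_add_le _ _
        _ ≤ (K₃ * size p q x ^ (t.card + 1)) * (m * size p q x)
            + (B * size p q x ^ t.card) * (m * size p q x ^ 2) := by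
            gcongr
            · exact abs_lin_le θ₀ x
            · exact hPb x
            · exact abs_lin_sub_linCav_le i θ₀ x
        _ = _ := by ring
  rw [nuAvg_sub hN] at e3
  have e5 : |β ^ 2 * A * (nuAvg S N β h D (fun x => P x * linCav p q i θ₀ x)
      - cavNu β h D p q i 0 fun x => P x * linCav p q i θ₀ x)|
      ≤ |β ^ 2 * A| * (B * m * K₁ * fluct N ^ (t.card + 2)) := by
    rw [abs_mul]; gcongr
  have e6 : |β ^ 2 * A * (nuAvg S N β h D
        (fun x : κ → Config S N => (∏ j ∈ t, lin p q (θs j) x) * lin p q θ₀ x)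
      - nuAvg S N β h D fun x => P x * linCav p q i θ₀ x)|
      ≤ |β ^ 2 * A| * ((K₃ * m + B * m) * K₂ * fluct N ^ (t.card + 2)) := by
    rw [abs_mul]; gcongr
  rw [abs_le] at *
  constructor <;> linarith [e1.1, e1.2, e5.1, e5.2, e6.1, e6.2]

/-- The recursion for mixed moments: a factor `T_{k₁,k₂}`, with private replicas `a` and `b`, may be
contracted with each of the other factors, or reproduced with the factor `β ^ 2 * A`. -/
theorem HighTemp.exists_recursion (H : HighTemp S β h D p q) {k₁ k₂ a b : κ}
    (hd : Distinct k₁ k₂ a b) (t : Finset J) (θ : J → κ → κ → ℝ)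
    (ha : ∀ j ∈ t, ∀ k, θ j a k = 0 ∧ θ j k a = 0) (hb : ∀ j ∈ t, ∀ k, θ j b k = 0 ∧ θ j k b = 0) :
    ∃ K : ℝ, 0 ≤ K ∧ ∀ N : ℕ, 1 ≤ N →
      |(1 - β ^ 2 * constA S β h D p q) * nuAvg S N β h D (fun x : κ → Config S N =>
            (∏ j ∈ t, lin p q (θ j) x) * lin p q (pairForm k₁ k₂ a b) x)
        - constA S β h D p q / N * ∑ j ∈ t, (θ j k₁ k₂ + θ j k₂ k₁) *
          nuAvg S N β h D (fun x : κ → Config S N => ∏ l ∈ t.erase j, lin p q (θ l) x)|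
        ≤ K * fluct N ^ (t.card + 2) := by
  obtain ⟨K₁, hK₁, h1⟩ := H.exists_site_main hd t θ
  have hcor : ∀ j : J, ∃ K : ℝ, 0 ≤ K ∧ ∀ N : ℕ, 1 ≤ N → ∀ i : Fin N, j ∈ t →
      |nuAvg S N β h D (fun x : κ → Config S N => (∏ l ∈ t.erase j, linCav p q i (θ l) x) *
          (quad (pairForm k₁ k₂ a b) (fun k => (x k i).toReal) * quad (θ j) fun k => (x k i).toReal))
        - constA S β h D p q * (θ j k₁ k₂ + θ j k₂ k₁) *
          nuAvg S N β h D (fun x : κ → Config S N => ∏ l ∈ t.erase j, lin p q (θ l) x)|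
        ≤ K * fluct N ^ t.card := by
    intro j
    by_cases hj : j ∈ t
    · obtain ⟨K, hK, hh⟩ := H.exists_site_correction hd (t.erase j) θ (ha j hj) (hb j hj)
      refine ⟨K, hK, fun N hN i _ => ?_⟩
      have := hh N hN i
      rwa [Finset.card_erase_add_one hj] at this
    · exact ⟨0, le_rfl, fun _ _ _ hj' => absurd hj' hj⟩
  choose L hL hcor using hcor
  obtain ⟨K₂, hK₂, h2⟩ := H.exists_abs_nuAvg_le κ (t.card + 2)
  obtain ⟨K₃, hK₃, h3⟩ := exists_prod_lin_sub_le (S := S) (p := p) (q := q) t θ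
  set A := constA S β h D p q with hA
  set θ₀ := pairForm k₁ k₂ a b with hθ₀
  set m : ℝ := (1 + (S : ℝ) ^ 2) * coefNorm θ₀ with hm
  have hm0 : 0 ≤ m := by
    have := coefNorm_nonneg θ₀
    positivity
  refine ⟨K₁ + ∑ j ∈ t, L j + K₃ * m * K₂, add_nonneg (add_nonneg hK₁
    (Finset.sum_nonneg fun j _ => hL j)) (by positivity), fun N hN => ?_⟩
  have hN0 : (0 : ℝ) < N := by exact_mod_cast hN
  set X := nuAvg S N β h D (fun x : κ → Config S N =>
            (∏ j ∈ t, lin p q (θ j) x) * lin p q θ₀ x) with hX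
  set Y : J → ℝ := fun j => nuAvg S N β h D
    (fun x : κ → Config S N => ∏ l ∈ t.erase j, lin p q (θ l) x) with hY
  -- each site contributes the same amount; the other factors are expanded to first order in the
  -- dependence on the site
  have hsite : ∀ i : Fin N, |nuAvg S N β h D (fun x : κ → Config S N =>
        (∏ j ∈ t, lin p q (θ j) x) * quad θ₀ fun k => (x k i).toReal)
      - (β ^ 2 * A * X + A / N * ∑ j ∈ t, (θ j k₁ k₂ + θ j k₂ k₁) * Y j)|
      ≤ (K₁ + ∑ j ∈ t, L j + K₃ * m * K₂) * fluct N ^ (t.card + 2) := by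
    intro i
    have e1 := h1 N hN i
    set u : (κ → Config S N) → ℝ := fun x => quad θ₀ fun k => (x k i).toReal with hu
    set P : J → (κ → Config S N) → ℝ := fun j x => (∏ l ∈ t.erase j, linCav p q i (θ l) x) *
          (u x * quad (θ j) fun k => (x k i).toReal) with hP
    have e2 := h2 N hN (fun x => (∏ j ∈ t, lin p q (θ j) x) * u x
      - (∏ j ∈ t, linCav p q i (θ j) x) * u x - 1 / N * ∑ j ∈ t, P j x) (K₃ * m) (by positivity)
      fun x => by
        have hQ := size_nonneg (p := p) (q := q) x
        have hsum : 1 / (N : ℝ) * ∑ j ∈ t, P j x = (∑ j ∈ t, (1 / (N : ℝ) *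
            quad (θ j) fun k => (x k i).toReal) * ∏ l ∈ t.erase j, linCav p q i (θ l) x) * u x := by
          rw [Finset.mul_sum, Finset.sum_mul]
          exact Finset.sum_congr rfl fun j _ => by simp only [hP]; ring
        rw [hsum, ← sub_mul, ← sub_mul, abs_mul]
        calc _ ≤ (K₃ * size p q x ^ (t.card + 2)) * m := by
              gcongr
              · exact (h3 N i x).2
              · exact abs_quad_le θ₀ i x
          _ = _ := by ring
    rw [nuAvg_sub hN, nuAvg_sub hN, nuAvg_const_mul, nuAvg_sum hN] at e2
    have e3 : |1 / (N : ℝ) * ∑ j ∈ t, nuAvg S N β h D (P j)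
        - A / N * ∑ j ∈ t, (θ j k₁ k₂ + θ j k₂ k₁) * Y j| ≤ (∑ j ∈ t, L j) * fluct N ^ (t.card + 2) := by
      have : 1 / (N : ℝ) * ∑ j ∈ t, nuAvg S N β h D (P j)
          - A / N * ∑ j ∈ t, (θ j k₁ k₂ + θ j k₂ k₁) * Y j
          = 1 / (N : ℝ) * ∑ j ∈ t, (nuAvg S N β h D (P j) - A * (θ j k₁ k₂ + θ j k₂ k₁) * Y j) := by
        simp only [Finset.mul_sum, ← Finset.sum_sub_distrib]
        exact Finset.sum_congr rfl fun j _ => by ring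
      rw [this, abs_mul, abs_of_nonneg (by positivity : 0 ≤ 1 / (N : ℝ)), ← fluct_sq]
      calc _ ≤ fluct N ^ 2 * ∑ j ∈ t, L j * fluct N ^ t.card := by
            refine mul_le_mul_of_nonneg_left ((Finset.abs_sum_le_sum_abs _ _).trans
              (Finset.sum_le_sum fun j hj => hcor j N hN i hj)) (sq_nonneg _)
        _ = _ := by rw [← Finset.sum_mul]; ring
    rw [abs_le] at *
    constructor <;> linarith [e1.1, e1.2, e2.1, e2.2, e3.1, e3.2]
  have hXs : X = 1 / N * ∑ i : Fin N, nuAvg S N β h D (fun x : κ → Config S N =>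
        (∏ j ∈ t, lin p q (θ j) x) * quad θ₀ fun k => (x k i).toReal) := by
    rw [hX, ← nuAvg_sum hN, ← nuAvg_const_mul]
    congr 1
    funext x
    rw [hθ₀, lin_pairForm_eq hd, ← Finset.mul_sum]
    ring
  have hfin : (1 - β ^ 2 * A) * X - A / N * ∑ j ∈ t, (θ j k₁ k₂ + θ j k₂ k₁) * Y j
      = 1 / N * ∑ i : Fin N, (nuAvg S N β h D (fun x : κ → Config S N =>
        (∏ j ∈ t, lin p q (θ j) x) * quad θ₀ fun k => (x k i).toReal)
      - (β ^ 2 * A * X + A / N * ∑ j ∈ t, (θ j k₁ k₂ + θ j k₂ k₁) * Y j)) := by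
    rw [Finset.sum_sub_distrib, mul_sub, ← hXs, Finset.sum_const, Finset.card_univ,
      Fintype.card_fin, nsmul_eq_mul, ← mul_assoc (1 / (N : ℝ)), one_div, inv_mul_cancel₀ hN0.ne']
    ring
  rw [hfin, abs_mul, abs_of_nonneg (by positivity : 0 ≤ 1 / (N : ℝ)), one_div,
    inv_mul_le_iff₀ hN0]
  refine (Finset.abs_sum_le_sum_abs _ _).trans ((Finset.sum_le_sum fun i _ => hsite i).trans
    (le_of_eq ?_))
  rw [Finset.sum_const, Finset.card_univ, Fintype.card_fin, nsmul_eq_mul]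

end Recursion

/-! ### Averaging out private replicas -/

section Collapse

variable {α : Type} [Fintype α]

theorem gibbsAvg_const [Nonempty α] (E : α → ℝ) (c : ℝ) : gibbsAvg E (fun _ => c) = c := by
  rw [gibbsAvg, ← Finset.mul_sum, sum_gibbsProb, mul_one]

theorem gibbsAvg_sub (E : α → ℝ) (f g : α → ℝ) :
    gibbsAvg E (fun x => f x - g x) = gibbsAvg E f - gibbsAvg E g := by
  simp only [gibbsAvg, sub_mul, Finset.sum_sub_distrib]

theorem gibbsAvg_const_mul (E : α → ℝ) (c : ℝ) (f : α → ℝ) :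
    gibbsAvg E (fun x => c * f x) = c * gibbsAvg E f := by
  simp only [gibbsAvg, Finset.mul_sum, mul_assoc]

theorem gibbsAvg_mul_const (E : α → ℝ) (c : ℝ) (f : α → ℝ) :
    gibbsAvg E (fun x => f x * c) = gibbsAvg E f * c := by
  simp only [mul_comm _ c, gibbsAvg_const_mul]

theorem gibbsAvg_sum {ι : Type*} (s : Finset ι) (E : α → ℝ) (f : ι → α → ℝ) :
    gibbsAvg E (fun x => ∑ i ∈ s, f i x) = ∑ i ∈ s, gibbsAvg E (f i) := by
  simp only [gibbsAvg, Finset.sum_mul]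
  exact Finset.sum_comm

theorem gibbsAvg_gibbsAvg [Nonempty α] {N : ℕ} (E : α → ℝ) (φ ψ : Fin N → α → ℝ) (c : ℝ) :
    gibbsAvg E (fun y => gibbsAvg E fun z => 1 / (N : ℝ) * ∑ i, φ i y * ψ i z - c)
      = 1 / (N : ℝ) * ∑ i, gibbsAvg E (φ i) * gibbsAvg E (ψ i) - c := by
  simp only [gibbsAvg_sub, gibbsAvg_const, gibbsAvg_const_mul, gibbsAvg_sum, gibbsAvg_mul_const]

theorem avg_sum_type {κ₁ κ₂ : Type} [Fintype κ₁] [DecidableEq κ₁] [Fintype κ₂] [DecidableEq κ₂]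
    (E : α → ℝ) (F : (κ₁ → α) → (κ₂ → α) → ℝ) :
    avg E (fun x : κ₁ ⊕ κ₂ → α => F (fun k => x (Sum.inl k)) fun k => x (Sum.inr k))
      = avg E fun u => avg E (F u) := by
  unfold avg
  rw [Fintype.sum_equiv (Equiv.sumArrowEquivProdArrow κ₁ κ₂ α) _ (fun z => F z.1 z.2 *
    ((∏ k, gibbsProb E (z.1 k)) * ∏ k, gibbsProb E (z.2 k)))]
  · rw [Fintype.sum_prod_type]
    refine Finset.sum_congr rfl fun u _ => ?_
    rw [Finset.sum_mul]
    exact Finset.sum_congr rfl fun y _ => by ring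
  · intro x
    rw [Fintype.prod_sum_type]
    rfl

/-- If every factor of a product has two replicas of its own, the average of the product is the
product of the averages. -/
theorem avg_prod_private [Nonempty α] {J : Type} [Fintype J] [DecidableEq J] (E : α → ℝ)
    (s : Finset J) (f : J → α → α → ℝ) :
    avg E (fun y : J × Bool → α => ∏ j ∈ s, f j (y (j, false)) (y (j, true)))
      = ∏ j ∈ s, gibbsAvg E fun y => gibbsAvg E (f j y) := by
  have hone : ∀ (g : α → α → ℝ) (j : J),
      (if j ∈ s then gibbsAvg E fun y => gibbsAvg E (g y) else 1)
        = ∑ w : α × α, (if j ∈ s then g w.1 w.2 else 1) * (gibbsProb E w.1 * gibbsProb E w.2) := by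
    intro g j
    rw [Fintype.sum_prod_type]
    split_ifs
    · simp only [gibbsAvg, Finset.sum_mul]
      exact Finset.sum_congr rfl fun _ _ => Finset.sum_congr rfl fun _ _ => by ring
    · simp only [one_mul, ← Finset.mul_sum, sum_gibbsProb, mul_one]
  rw [← Finset.univ_inter s, Finset.univ_inter, ← Fintype.prod_ite_mem s]
  simp only [hone, Finset.prod_univ_sum, Fintype.piFinset_univ]
  unfold avg
  let e : (J × Bool → α) ≃ (J → α × α) :=
    { toFun := fun y j => (y (j, false), y (j, true))
      invFun := fun w b => if b.2 then (w b.1).2 else (w b.1).1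
      left_inv := fun y => by funext ⟨j, b⟩; cases b <;> rfl
      right_inv := fun w => rfl }
  refine Fintype.sum_equiv e _ _ fun y => ?_
  rw [Finset.prod_mul_distrib, Fintype.prod_ite_mem, Fintype.prod_prod_type]
  simp only [Fintype.prod_bool, e, Equiv.coe_fn_mk]
  congr 1
  exact Finset.prod_congr rfl fun j _ => mul_comm _ _

end Collapse

/-! ### The basis variables as averaged linear forms -/

/-- The basis variables: `T_{k,l}` for `k < l`, then `T_k`, `S_k`, `T` and `S`. -/
abbrev Factor (n : ℕ) : Type := pairs n ⊕ (Fin n ⊕ (Fin n ⊕ (Unit ⊕ Unit)))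

/-- The exponent of a basis variable. -/
def expo {n : ℕ} (m : Exponents n) : Factor n → ℕ
  | Sum.inl e => m.pair e
  | Sum.inr (Sum.inl k) => m.T₁ k
  | Sum.inr (Sum.inr (Sum.inl k)) => m.S₁ k
  | Sum.inr (Sum.inr (Sum.inr (Sum.inl _))) => m.T₀
  | Sum.inr (Sum.inr (Sum.inr (Sum.inr _))) => m.S₀

/-- The coefficient `1` at `(k, l)`. -/
def single {κ : Type} [DecidableEq κ] (k l k' l' : κ) : ℝ := if k' = k ∧ l' = l then 1 else 0

/-- The linear form in the overlaps whose average over the private replicas `a` and `b` is a given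
basis variable; the original replicas are embedded by `u`. -/
def factorForm {n : ℕ} {κ : Type} [DecidableEq κ] (u : Fin n → κ) (a b : κ) :
    Factor n → κ → κ → ℝ
  | Sum.inl e => pairForm (u e.1.1) (u e.1.2) a b
  | Sum.inr (Sum.inl k) => fun k' l' => single (u k) b k' l' - single a b k' l'
  | Sum.inr (Sum.inr (Sum.inl k)) => fun k' l' => single (u k) (u k) k' l' - single a a k' l'
  | Sum.inr (Sum.inr (Sum.inr (Sum.inl _))) => single a b
  | Sum.inr (Sum.inr (Sum.inr (Sum.inr _))) => single a a

/-- The value of a basis variable. -/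
def factorMean {S N n : ℕ} (E : Config S N → ℝ) (p q : ℝ) (σ : Fin n → Config S N) :
    Factor n → ℝ
  | Sum.inl e => Tpair E e.1.1 e.1.2 σ
  | Sum.inr (Sum.inl k) => Tone E k σ
  | Sum.inr (Sum.inr (Sum.inl k)) => Sone E k σ
  | Sum.inr (Sum.inr (Sum.inr (Sum.inl _))) => Tzero E q
  | Sum.inr (Sum.inr (Sum.inr (Sum.inr _))) => Szero E p

section Factor

variable {S N n : ℕ} {p q : ℝ} {κ : Type} [DecidableEq κ]

theorem sum_single_mul [Fintype κ] (k l : κ) (W : κ → κ → ℝ) :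
    ∑ k', ∑ l', single k l k' l' * W k' l' = W k l := by
  simp [single, ite_and]

theorem factorForm_eq_zero {u : Fin n → κ} {a b v : κ} (hu : ∀ k, v ≠ u k) (ha : v ≠ a)
    (hb : v ≠ b) (c : Factor n) (w : κ) : factorForm u a b c v w = 0 ∧ factorForm u a b c w v = 0 := by
  rcases c with e | k | k | _ | _ <;> simp [factorForm, pairForm, chi, single, hu, ha, hb]

/-- On the original replicas, the form of `T_{k,l}` is the only one with a nonzero coefficient. -/
theorem factorForm_add {u : Fin n → κ} (hinj : Function.Injective u) {a b : κ}
    (ha : ∀ k, u k ≠ a) (hb : ∀ k, u k ≠ b) (e : pairs n) (c : Factor n) :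
    factorForm u a b c (u e.1.1) (u e.1.2) + factorForm u a b c (u e.1.2) (u e.1.1)
      = if c = Sum.inl e then 1 else 0 := by
  have he : e.1.1 < e.1.2 := (Finset.mem_filter.1 e.2).2
  rcases c with e' | k | k | _ | _
  · have he' : e'.1.1 < e'.1.2 := (Finset.mem_filter.1 e'.2).2
    simp only [factorForm, pairForm, chi, ha, hb, hinj.eq_iff, if_false, sub_zero, Sum.inl.injEq]
    by_cases h : e' = e
    · subst h
      simp [he.ne, he.ne']
    · have h1 : ¬(e.1.1 = e'.1.1 ∧ e.1.2 = e'.1.2) := fun h' =>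
        h (Subtype.ext (Prod.ext h'.1.symm h'.2.symm))
      have h2 : ¬(e.1.2 = e'.1.1 ∧ e.1.1 = e'.1.2) := fun h' => by
        have := h'.1; have := h'.2; omega
      simp only [ite_zero_mul_ite_zero, h1, h2, h, if_false, add_zero]
  · simp [factorForm, single, ha, hb]
  · simp only [factorForm, single, ha, hinj.eq_iff, false_and, if_false, sub_zero, reduceCtorEq]
    rw [if_neg, if_neg, add_zero]
    · rintro ⟨h1, h2⟩; omega
    · rintro ⟨h1, h2⟩; omega
  · simp [factorForm, single, ha]
  · simp [factorForm, single, ha]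

/-- Averaging over its two private replicas turns a linear form into a basis variable. -/
theorem gibbsAvg_lin_factorForm [Fintype κ] (E : Config S N → ℝ) (u : Fin n → κ) {a b : κ}
    (hab : a ≠ b) (ha : ∀ k, u k ≠ a) (hb : ∀ k, u k ≠ b) (hinj : Function.Injective u)
    (c : Factor n) : ∃ f : (Fin n → Config S N) → Config S N → Config S N → ℝ,
      (∀ x : κ → Config S N, lin p q (factorForm u a b c) x = f (x ∘ u) (x a) (x b)) ∧
      ∀ σ, gibbsAvg E (fun y => gibbsAvg E (f σ y)) = factorMean E p q σ c := by
  have hlin : ∀ (k l k' l' : κ) (x : κ → Config S N),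
      lin p q (fun i j => single k l i j - single k' l' i j) x = rho p q k l x - rho p q k' l' x := by
    intro k l k' l' x
    simp only [lin, sub_mul, Finset.sum_sub_distrib, sum_single_mul]
  have hone : gibbsAvg E (fun _ => (1 : ℝ)) = 1 := gibbsAvg_const E 1
  rcases c with e | k | k | _ | _
  · have he : e.1.1 < e.1.2 := (Finset.mem_filter.1 e.2).2
    refine ⟨fun σ y z => 1 / (N : ℝ) * ∑ i, ((σ e.1.1 i).toReal - (y i).toReal) *
      ((σ e.1.2 i).toReal - (z i).toReal) - 0, fun x => ?_, fun σ => ?_⟩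
    · simp only [factorForm]
      rw [lin_pairForm_eq ⟨hinj.ne he.ne, ha _, hb _, ha _, hb _, hab⟩, sub_zero]
      simp only [quad_pairForm, Function.comp]
    · rw [gibbsAvg_gibbsAvg E (fun i y => (σ e.1.1 i).toReal - (y i).toReal)
        (fun i z => (σ e.1.2 i).toReal - (z i).toReal)]
      simp only [gibbsAvg_sub, gibbsAvg_const, sub_zero]
      rfl
  · refine ⟨fun σ y z => 1 / (N : ℝ) * ∑ i, ((σ k i).toReal - (y i).toReal) *
      (z i).toReal - 0, fun x => ?_, fun σ => ?_⟩
    · simp only [factorForm, hlin, rho, overlap, overlapLimit, hb, hab, if_false, Function.comp,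
        sub_mul, Finset.sum_sub_distrib]
      ring
    · rw [gibbsAvg_gibbsAvg E (fun i y => (σ k i).toReal - (y i).toReal) (fun i z => (z i).toReal)]
      simp only [gibbsAvg_sub, gibbsAvg_const, sub_zero]
      rfl
  · refine ⟨fun σ y z => 1 / (N : ℝ) * ∑ i, ((σ k i).toReal ^ 2 - (y i).toReal ^ 2) * 1 - 0,
      fun x => ?_, fun σ => ?_⟩
    · simp only [factorForm, hlin, rho, overlap, overlapLimit, if_true, Function.comp,
        mul_one, Finset.sum_sub_distrib, sq]
      ring
    · rw [gibbsAvg_gibbsAvg E (fun i y => (σ k i).toReal ^ 2 - (y i).toReal ^ 2) (fun _ _ => 1)]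
      simp only [gibbsAvg_sub, gibbsAvg_const, sub_zero, hone, mul_one]
      rfl
  · refine ⟨fun σ y z => 1 / (N : ℝ) * ∑ i, (y i).toReal * (z i).toReal - q,
      fun x => ?_, fun σ => ?_⟩
    · simp only [factorForm, lin, sum_single_mul, rho, overlap, overlapLimit, hab, if_false]
    · rw [gibbsAvg_gibbsAvg E (fun i y => (y i).toReal) (fun i z => (z i).toReal)]
      simp only [factorMean, Tzero, sq]
      rfl
  · refine ⟨fun σ y z => 1 / (N : ℝ) * ∑ i, (y i).toReal ^ 2 * 1 - p,
      fun x => ?_, fun σ => ?_⟩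
    · simp only [factorForm, lin, sum_single_mul, rho, overlap, overlapLimit, if_true, sq, mul_one]
    · rw [gibbsAvg_gibbsAvg E (fun i y => (y i).toReal ^ 2) (fun _ _ => 1)]
      simp only [hone, mul_one]
      rfl

end Factor

/-! ### Mixed moments as averages of products of linear forms -/

section Mixed

variable {S N n : ℕ} {β h D p q : ℝ}

/-- The factors of a mixed moment, with multiplicity. -/
abbrev Factors {n : ℕ} (m : Exponents n) : Type := Σ c : Factor n, Fin (expo m c)

instance Factors.instDecidableEq {n : ℕ} (m : Exponents n) : DecidableEq (Factors m) := inferInstance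

/-- The original replicas together with two private replicas for each factor. -/
abbrev Replicas {n : ℕ} (m : Exponents n) : Type := Fin n ⊕ Factors m × Bool

instance Replicas.instDecidableEq {n : ℕ} (m : Exponents n) : DecidableEq (Replicas m) :=
  instDecidableEqSum

/-- The linear form of a factor of a mixed moment. -/
def mixedForm {n : ℕ} (m : Exponents n) (j : Factors m) : Replicas m → Replicas m → ℝ :=
  factorForm Sum.inl (Sum.inr (j, false)) (Sum.inr (j, true)) j.1

theorem card_factors (m : Exponents n) : Fintype.card (Factors m) = m.total := by
  rw [Fintype.card_sigma]
  simp only [Fintype.card_fin]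
  simp only [Fintype.sum_sum_type, expo, Finset.univ_unique, Finset.sum_singleton, Exponents.total]
  rw [Finset.sum_coe_sort (pairs n) m.pair]
  ring

theorem avg_prod_mixedForm (m : Exponents n) (E : Config S N → ℝ) (s : Finset (Factors m)) :
    avg E (fun x : Replicas m → Config S N => ∏ j ∈ s, lin p q (mixedForm m j) x)
      = replicaAvg E n fun σ => ∏ j ∈ s, factorMean E p q σ j.1 := by
  choose f hf hf' using fun j : Factors m => gibbsAvg_lin_factorForm (p := p) (q := q) E
    (Sum.inl : Fin n → Replicas m) (a := Sum.inr (j, false)) (b := Sum.inr (j, true))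
    (by simp) (by simp) (by simp) Sum.inl_injective j.1
  have h1 : ∀ x : Replicas m → Config S N, ∏ j ∈ s, lin p q (mixedForm m j) x
      = (fun (σ : Fin n → Config S N) (y : Factors m × Bool → Config S N) =>
          ∏ j ∈ s, f j σ (y (j, false)) (y (j, true))) (fun k => x (Sum.inl k))
            fun k => x (Sum.inr k) :=
    fun x => Finset.prod_congr rfl fun j _ => hf j x
  simp only [h1]
  rw [avg_sum_type E fun (σ : Fin n → Config S N) (y : Factors m × Bool → Config S N) =>
          ∏ j ∈ s, f j σ (y (j, false)) (y (j, true))]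
  simp only [avg_prod_private E s fun j => f j _, hf']
  rfl

theorem prod_factorMean (m : Exponents n) (E : Config S N → ℝ) (σ : Fin n → Config S N) :
    ∏ j : Factors m, factorMean E p q σ j.1 = pairMonomial E m σ * restMonomial E p q m σ := by
  simp only [Fintype.prod_sigma, Finset.prod_const, Finset.card_univ, Fintype.card_fin]
  simp only [Fintype.prod_sum_type, expo, factorMean, Finset.univ_unique, Finset.prod_singleton]
  rw [Finset.prod_coe_sort (pairs n) fun e => Tpair E e.1 e.2 σ ^ m.pair e, pairMonomial, restMonomial]
  ring

theorem prod_factorMean_isRight (m : Exponents n) (E : Config S N → ℝ) (σ : Fin n → Config S N) :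
    ∏ j : Factors m with j.1.isRight, factorMean E p q σ j.1 = restMonomial E p q m σ := by
  rw [Finset.prod_filter]
  simp only [Fintype.prod_sigma, Finset.prod_const, Finset.card_univ, Fintype.card_fin]
  simp only [Fintype.prod_sum_type, expo, factorMean, Finset.univ_unique, Finset.prod_singleton,
    Sum.isRight_inl, Sum.isRight_inr, if_true, Bool.false_eq_true, if_false, one_pow,
    Finset.prod_const_one, one_mul]
  rw [restMonomial]
  ring

theorem nuAvg_prod_mixedForm (m : Exponents n) :
    nuAvg S N β h D (fun x : Replicas m → Config S N => ∏ j, lin p q (mixedForm m j) x)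
      = nu S N β h D n fun g σ => pairMonomial (hamiltonian S N β h D g) m σ
          * restMonomial (hamiltonian S N β h D g) p q m σ := by
  simp only [nuAvg, avg_prod_mixedForm, prod_factorMean]
  rfl

theorem nuAvg_prod_mixedForm_isRight (m : Exponents n) :
    nuAvg S N β h D (fun x : Replicas m → Config S N =>
        ∏ j : Factors m with j.1.isRight, lin p q (mixedForm m j) x)
      = nu S N β h D n fun g σ => restMonomial (hamiltonian S N β h D g) p q m σ := by
  simp only [nuAvg, avg_prod_mixedForm, prod_factorMean_isRight]
  rfl

end Mixed

/-! ### Factorization of the mixed moments -/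

section Factorization

variable {S N n : ℕ} {β h D p q : ℝ} {m : Exponents n}

/-- The number of factors `T_{k,l}` in a family of factors, for the pair `e = (k, l)`. -/
def multiplicity (e : pairs n) (s : Finset (Factors m)) : ℕ := (s.filter fun j => j.1 = Sum.inl e).card

/-- The product of the moments of independent centered Gaussian variables of standard deviation
`r`, one variable for each pair of replicas. -/
def gaussProd (r : ℝ) (s : Finset (Factors m)) : ℝ :=
  ∏ e : pairs n, gaussMoment (multiplicity e s) * r ^ multiplicity e s

theorem multiplicity_univ (e : pairs n) : multiplicity e (Finset.univ : Finset (Factors m)) = m.pair e := by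
  rw [multiplicity, Finset.card_filter, Fintype.sum_sigma]
  rw [Finset.sum_eq_single (Sum.inl e) (fun c _ hc => Finset.sum_eq_zero fun _ _ => if_neg hc)
    fun h => absurd (Finset.mem_univ _) h]
  simp only [if_true, Finset.sum_const, smul_eq_mul, mul_one]
  exact Fintype.card_fin _

theorem multiplicity_erase (e e' : pairs n) {s : Finset (Factors m)} {j : Factors m} (hj : j ∈ s)
    (he : j.1 = Sum.inl e) :
    multiplicity e' s = multiplicity e' (s.erase j) + if e' = e then 1 else 0 := by
  unfold multiplicity
  rw [Finset.filter_erase]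
  split_ifs with h
  · rw [Finset.card_erase_add_one]
    exact Finset.mem_filter.2 ⟨hj, by rw [he, h]⟩
  · rw [Finset.erase_eq_of_notMem, add_zero]
    intro h'
    have := (Finset.mem_filter.1 h').2
    rw [he] at this
    exact h (Sum.inl_injective this).symm

/-- The recursion of the Gaussian moments: one factor is paired with each of its other copies. -/
theorem gaussProd_eq (r : ℝ) {s : Finset (Factors m)} {j₀ : Factors m} (hj₀ : j₀ ∈ s)
    {e : pairs n} (he : j₀.1 = Sum.inl e) :
    gaussProd r s = r ^ 2 * ∑ j ∈ s.erase j₀, (if j.1 = Sum.inl e then 1 else 0) *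
      gaussProd r ((s.erase j₀).erase j) := by
  set t := s.erase j₀ with ht
  set c := multiplicity e t with hc
  set P := ∏ e' ∈ Finset.univ.erase e, gaussMoment (multiplicity e' s) * r ^ multiplicity e' s with hP
  have h1 : gaussProd r s = gaussMoment (c + 1) * r ^ (c + 1) * P := by
    rw [gaussProd, ← Finset.mul_prod_erase _ _ (Finset.mem_univ e), multiplicity_erase e e hj₀ he,
      if_pos rfl]
  have h2 : ∀ j ∈ t.filter (fun j => j.1 = Sum.inl e),
      gaussProd r (t.erase j) = gaussMoment (c - 1) * r ^ (c - 1) * P := by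
    intro j hj
    obtain ⟨hjt, hje⟩ := Finset.mem_filter.1 hj
    rw [gaussProd, ← Finset.mul_prod_erase _ _ (Finset.mem_univ e), hc,
      multiplicity_erase e e hjt hje, if_pos rfl, Nat.add_sub_cancel, hP]
    congr 1
    refine Finset.prod_congr rfl fun e' he' => ?_
    rw [multiplicity_erase e e' hj₀ he, multiplicity_erase e e' hjt hje,
      if_neg (Finset.ne_of_mem_erase he'), add_zero, add_zero]
  simp only [ite_mul, one_mul, zero_mul]
  rw [← Finset.sum_filter, Finset.sum_congr rfl h2, Finset.sum_const, nsmul_eq_mul, h1]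
  change _ = r ^ 2 * ((c : ℝ) * _)
  rcases c with _ | c
  · simp [gaussMoment_one]
  · rw [gaussMoment_add_two, Nat.add_sub_cancel]
    push_cast
    ring

theorem A₂_sq (hA : 0 ≤ constA S β h D p q) (hA1 : β ^ 2 * constA S β h D p q < 1) (hN : 1 ≤ N) :
    (1 - β ^ 2 * constA S β h D p q) * A₂ S N β h D p q ^ 2 = constA S β h D p q / N := by
  have hN' : (0 : ℝ) < N := by exact_mod_cast hN
  have h1 : 0 < 1 - β ^ 2 * constA S β h D p q := by linarith
  rw [A₂, Real.sq_sqrt (by positivity)]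
  field_simp

/-- Every sub-product of a mixed moment factorizes to leading order. -/
theorem HighTemp.exists_factorization (H : HighTemp S β h D p q) (hA : 0 ≤ constA S β h D p q)
    (hA1 : β ^ 2 * constA S β h D p q < 1) (s : Finset (Factors m)) :
    ∃ K : ℝ, 0 ≤ K ∧ ∀ N : ℕ, 1 ≤ N →
      |nuAvg S N β h D (fun x : Replicas m → Config S N => ∏ j ∈ s, lin p q (mixedForm m j) x)
        - gaussProd (A₂ S N β h D p q) s * nuAvg S N β h D (fun x : Replicas m → Config S N =>
            ∏ j ∈ s.filter fun j => j.1.isRight, lin p q (mixedForm m j) x)|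
        ≤ K * fluct N ^ (s.card + 1) := by
  induction s using Finset.strongInduction with
  | H s ih =>
  by_cases hs : ∀ j ∈ s, j.1.isRight
  · refine ⟨0, le_rfl, fun N _ => ?_⟩
    have h0 : ∀ e : pairs n, multiplicity e s = 0 := fun e =>
      Finset.card_eq_zero.2 (Finset.filter_eq_empty_iff.2 fun j hj he => by
        have := hs j hj
        simp [he] at this)
    rw [Finset.filter_true_of_mem hs]
    simp [gaussProd, h0, gaussMoment_zero]
  push Not at hs
  obtain ⟨j₀, hj₀, hr⟩ := hs
  obtain ⟨e, he⟩ : ∃ e, j₀.1 = Sum.inl e := by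
    rcases hc : j₀.1 with e | c
    · exact ⟨e, rfl⟩
    · simp [hc] at hr
  have hee : e.1.1 < e.1.2 := (Finset.mem_filter.1 e.2).2
  set t := s.erase j₀ with ht
  have hcard : s.card = t.card + 1 := (Finset.card_erase_add_one hj₀).symm
  -- the two private replicas of the factor `j₀` do not occur in the other factors
  have hz : ∀ c : Bool, ∀ j ∈ t, ∀ k, mixedForm m j (Sum.inr (j₀, c)) k = 0 ∧
      mixedForm m j k (Sum.inr (j₀, c)) = 0 := by
    intro c j hj k
    have hne : j₀ ≠ j := (Finset.ne_of_mem_erase hj).symm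
    exact factorForm_eq_zero (by simp) (by simp [hne]) (by simp [hne]) j.1 k
  obtain ⟨K, hK, hrec⟩ := H.exists_recursion
    (k₁ := (Sum.inl e.1.1 : Replicas m)) (k₂ := Sum.inl e.1.2) (a := Sum.inr (j₀, false))
    (b := Sum.inr (j₀, true)) ⟨by simp [hee.ne], by simp, by simp, by simp, by simp, by simp⟩ t
    (mixedForm m) (hz false) (hz true)
  have hK' : ∀ j : Factors m, ∃ K : ℝ, 0 ≤ K ∧ (j ∈ t → ∀ N : ℕ, 1 ≤ N →
      |nuAvg S N β h D (fun x : Replicas m → Config S N => ∏ l ∈ t.erase j, lin p q (mixedForm m l) x)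
        - gaussProd (A₂ S N β h D p q) (t.erase j) *
          nuAvg S N β h D (fun x : Replicas m → Config S N =>
            ∏ l ∈ (t.erase j).filter fun l => l.1.isRight, lin p q (mixedForm m l) x)|
        ≤ K * fluct N ^ t.card) := by
    intro j
    by_cases hj : j ∈ t
    · obtain ⟨K, hK, h⟩ := ih (t.erase j) (((Finset.erase_subset j t).trans_ssubset
        (Finset.erase_ssubset hj₀)))
      refine ⟨K, hK, fun _ => ?_⟩
      rwa [Finset.card_erase_add_one hj] at h
    · exact ⟨0, le_rfl, fun h => absurd h hj⟩
  choose K' hK'0 hK' using hK'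
  set A := constA S β h D p q with hAdef
  have hpos : 0 < 1 - β ^ 2 * A := by linarith
  refine ⟨(K + A * ∑ j ∈ t, K' j) / (1 - β ^ 2 * A),
    div_nonneg (add_nonneg hK (mul_nonneg hA (Finset.sum_nonneg fun j _ => hK'0 j))) hpos.le,
    fun N hN => ?_⟩
  have hδ := fluct_pos hN
  set M : Finset (Factors m) → ℝ := fun u =>
    nuAvg S N β h D fun x : Replicas m → Config S N => ∏ j ∈ u, lin p q (mixedForm m j) x with hM
  set M₀ := M (s.filter fun j => j.1.isRight) with hM₀
  set r := A₂ S N β h D p q with hr'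
  let χ : Factors m → ℝ := fun j => if j.1 = Sum.inl e then 1 else 0
  have hrec' : |(1 - β ^ 2 * A) * M s - A / N * ∑ j ∈ t, χ j * M (t.erase j)|
      ≤ K * fluct N ^ (t.card + 2) := by
    have h1 : ∀ x : Replicas m → Config S N, (∏ j ∈ t, lin p q (mixedForm m j) x) *
        lin p q (pairForm (Sum.inl e.1.1) (Sum.inl e.1.2) (Sum.inr (j₀, false)) (Sum.inr (j₀, true))) x
        = ∏ j ∈ s, lin p q (mixedForm m j) x := by
      intro x
      rw [← Finset.prod_erase_mul _ _ hj₀]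
      congr 2
      rw [mixedForm, he]
      rfl
    have h2 := hrec N hN
    simp only [h1] at h2
    convert h2 using 6 with j hj
    exact (factorForm_add (a := (Sum.inr (j, false) : Replicas m)) (b := Sum.inr (j, true))
      Sum.inl_injective (by simp) (by simp) e j.1).symm
  have hfilter : ∀ j ∈ t, j.1 = Sum.inl e →
      (t.erase j).filter (fun l => l.1.isRight) = s.filter fun l => l.1.isRight := by
    intro j _ hje
    rw [Finset.filter_erase, ht, Finset.filter_erase, Finset.erase_eq_of_notMem,
      Finset.erase_eq_of_notMem] <;> simp [he, hje]
  -- the Gaussian moments satisfy the same recursion without an error term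
  have hG : (1 - β ^ 2 * A) * (gaussProd r s * M₀)
      = A / N * ∑ j ∈ t, χ j * (gaussProd r (t.erase j) * M₀) := by
    rw [gaussProd_eq r hj₀ he, ← A₂_sq hA hA1 hN]
    simp only [← mul_assoc, ← Finset.sum_mul]
    rfl
  have hsum : |∑ j ∈ t, χ j * (M (t.erase j) - gaussProd r (t.erase j) * M₀)|
      ≤ (∑ j ∈ t, K' j) * fluct N ^ t.card := by
    rw [Finset.sum_mul]
    refine (Finset.abs_sum_le_sum_abs _ _).trans (Finset.sum_le_sum fun j hj => ?_)
    have h0 : 0 ≤ K' j * fluct N ^ t.card := mul_nonneg (hK'0 j) (pow_nonneg hδ.le _)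
    simp only [χ]
    split_ifs with hje
    · have := hK' j hj N hN
      rw [hfilter j hj hje] at this
      rwa [one_mul]
    · simpa using h0
  have hmain : (1 - β ^ 2 * A) * |M s - gaussProd r s * M₀|
      ≤ (K + A * ∑ j ∈ t, K' j) * fluct N ^ (s.card + 1) := by
    calc _ = |(1 - β ^ 2 * A) * (M s - gaussProd r s * M₀)| := by rw [abs_mul, abs_of_pos hpos]
      _ = |((1 - β ^ 2 * A) * M s - A / N * ∑ j ∈ t, χ j * M (t.erase j))
          + A / N * ∑ j ∈ t, χ j * (M (t.erase j) - gaussProd r (t.erase j) * M₀)| := by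
          congr 1
          rw [mul_sub, hG]
          simp only [mul_sub, Finset.sum_sub_distrib]
          ring
      _ ≤ K * fluct N ^ (t.card + 2) + A / N * ((∑ j ∈ t, K' j) * fluct N ^ t.card) := by
          refine (abs_add_le _ _).trans (add_le_add hrec' ?_)
          rw [abs_mul, abs_of_nonneg (by positivity)]
          exact mul_le_mul_of_nonneg_left hsum (by positivity)
      _ = _ := by
          rw [hcard, div_eq_mul_one_div, ← fluct_sq]
          ring
  rw [div_mul_eq_mul_div, le_div_iff₀ hpos, mul_comm]
  exact hmain

theorem HighTemp.exists_mixed_moment (H : HighTemp S β h D p q) (hA : 0 ≤ constA S β h D p q)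
    (hA1 : β ^ 2 * constA S β h D p q < 1) (m : Exponents n) :
    ∃ K : ℝ, ∀ N : ℕ, 1 ≤ N →
      |nu S N β h D n (fun g σ => pairMonomial (hamiltonian S N β h D g) m σ
            * restMonomial (hamiltonian S N β h D g) p q m σ)
        - (∏ e ∈ pairs n, gaussMoment (m.pair e) * A₂ S N β h D p q ^ m.pair e)
          * nu S N β h D n (fun g σ => restMonomial (hamiltonian S N β h D g) p q m σ)|
        ≤ K * (N : ℝ) ^ (-((m.total : ℝ) + 1) / 2) := by
  obtain ⟨K, -, hK⟩ := H.exists_factorization (m := m) hA hA1 Finset.univ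
  refine ⟨K, fun N hN => ?_⟩
  have h1 := hK N hN
  have hN0 : (0 : ℝ) ≤ N := Nat.cast_nonneg N
  have h2 : fluct N ^ (m.total + 1) = (N : ℝ) ^ (-((m.total : ℝ) + 1) / 2) := by
    rw [fluct, Real.sqrt_eq_rpow, one_div, ← Real.rpow_neg hN0, ← Real.rpow_natCast,
      ← Real.rpow_mul hN0]
    congr 1
    push_cast
    ring
  rw [nuAvg_prod_mixedForm, nuAvg_prod_mixedForm_isRight, Finset.card_univ, card_factors, h2] at h1
  simp only [gaussProd, multiplicity_univ] at h1
  rwa [Finset.prod_coe_sort (pairs n) fun e => gaussMoment (m.pair e) * A₂ S N β h D p q ^ m.pair e]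
    at h1

end Factorization

/-! ### The constant `A` -/

section ConstA

variable {S : ℕ} {β h D p q : ℝ}

/-- The function of four replicas that defines `A` averages to the square of a variance. -/
theorem replicaAvg_quartic {α : Type} [Fintype α] [Nonempty α] (E : α → ℝ) (X : α → ℝ) :
    replicaAvg E 4 (fun x => (X (x 0) - X (x 2)) * (X (x 1) - X (x 3)) * (X (x 0) * X (x 1)))
      = (gibbsAvg E (fun x => X x ^ 2) - gibbsAvg E X ^ 2) ^ 2 := by
  have hp : ∀ f : Fin 4 → α → ℝ, avg E (fun x : Fin 4 → α => f 0 (x 0) * f 1 (x 1) * f 2 (x 2) * f 3 (x 3))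
      = gibbsAvg E (f 0) * gibbsAvg E (f 1) * gibbsAvg E (f 2) * gibbsAvg E (f 3) := fun f => by
    have := avg_prod E f
    simpa only [Fin.prod_univ_four] using this
  let X2 : α → ℝ := fun x => X x ^ 2
  let one : α → ℝ := fun _ => 1
  have h1 : gibbsAvg E one = 1 := gibbsAvg_const E 1
  have e1 := hp ![X2, X2, one, one]
  have e2 := hp ![X2, X, one, X]
  have e3 := hp ![X, X2, X, one]
  have e4 := hp ![X, X, X, X]
  simp only [Matrix.cons_val, h1] at e1 e2 e3 e4
  calc _ = avg E (fun x : Fin 4 → α => X2 (x 0) * X2 (x 1) * one (x 2) * one (x 3)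
        - X2 (x 0) * X (x 1) * one (x 2) * X (x 3) - X (x 0) * X2 (x 1) * X (x 2) * one (x 3)
        + X (x 0) * X (x 1) * X (x 2) * X (x 3)) := by
        unfold replicaAvg avg
        refine Finset.sum_congr rfl fun x _ => ?_
        simp only [X2, one]
        ring
    _ = _ := by
        rw [avg_add, avg_sub, avg_sub, e1, e2, e3, e4]
        ring

theorem constA_nonneg : 0 ≤ constA S β h D p q := by
  refine integral_nonneg fun η => ?_
  rw [replicaAvg_quartic (cavityEnergy S β h D p q η) Spin.toReal]
  positivity

theorem abs_nu0Avg_le {κ : Type} [Fintype κ] [DecidableEq κ] {φ : (κ → ℝ) → ℝ} {C : ℝ}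
    (hφ : ∀ ε : κ → Spin S, |φ fun k => (ε k).toReal| ≤ C) : |nu0Avg S β h D p q φ| ≤ C := by
  have := norm_integral_le_of_norm_le_const (μ := gaussianReal 0 1)
    (f := fun η => avg (cavityEnergy S β h D p q η) (fun ε : κ → Spin S => φ fun k => (ε k).toReal))
    (C := C) (Filter.Eventually.of_forall fun η => abs_avg_le_of_abs_le hφ)
  rwa [probReal_univ, mul_one] at this

theorem constA_le : constA S β h D p q ≤ 4 * (S : ℝ) ^ 4 := by
  refine (le_abs_self _).trans (abs_nu0Avg_le (κ := Fin 4)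
    (φ := fun ε => (ε 0 - ε 2) * (ε 1 - ε 3) * (ε 0 * ε 1)) fun ε => ?_)
  have h0 : (0 : ℝ) ≤ S := Nat.cast_nonneg S
  have h1 : ∀ s t : Spin S, |s.toReal - t.toReal| ≤ 2 * S := fun s t =>
    (abs_sub _ _).trans (by linarith [s.abs_toReal_le, t.abs_toReal_le])
  have h2 := abs_spin_mul_le (ε 0) (ε 1)
  rw [abs_mul, abs_mul]
  calc _ ≤ 2 * (S : ℝ) * (2 * S) * (S : ℝ) ^ 2 := by
        gcongr
        · exact h1 _ _
        · exact h1 _ _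
    _ = _ := by ring

end ConstA

/-! ### The replica symmetric equations -/

section FixedPoint

variable {S : ℕ} {β h D : ℝ}

/-- Coefficients of the interpolation between two decoupled spins. -/
def rotCoef : Bool → ℝ → ℝ
  | true, t => Real.sin t
  | false, t => Real.cos t

/-- The derivatives of the coefficients of the interpolation. -/
def rotCoef' : Bool → ℝ → ℝ
  | true, t => Real.cos t
  | false, t => -Real.sin t

theorem integral_eval_comp_stdGaussian {ι : Type} [Fintype ι] (i : ι) {F : ℝ → ℝ} (hF : Continuous F) :
    ∫ g, F (g i) ∂stdGaussian ι = ∫ η, F η ∂gaussianReal 0 1 := by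
  have hm := measurePreserving_eval (fun _ : ι => gaussianReal 0 1) i
  rw [← hm.map_eq, integral_map hm.measurable.aemeasurable hF.measurable.aestronglyMeasurable]

/-- The constant in the Lipschitz estimate for the replica symmetric equations. -/
def lipConst (S n : ℕ) : ℝ := 4 * (S : ℝ) ^ 4 * (((n : ℝ) + 2) ^ 2 * ((n : ℝ) + 1) ^ 2)

/-- The averages at the decoupled site are Lipschitz in `(p, q)`, with a constant that is small at
high temperature: the derivative of a Gaussian interpolation between two such systems is of order
`β ^ 2`. -/
theorem abs_nu0Avg_sub_le {κ : Type} [Fintype κ] [DecidableEq κ] {φ : (κ → ℝ) → ℝ}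
    (hφ : ∀ ε : κ → Spin S, |φ fun k => (ε k).toReal| ≤ (S : ℝ) ^ 2) {p q p' q' : ℝ} (hq : 0 ≤ q)
    (hq' : 0 ≤ q') :
    |nu0Avg S β h D p' q' φ - nu0Avg S β h D p q φ|
      ≤ β ^ 2 * lipConst S (Fintype.card κ) * (|p' - p| + |q' - q|) := by
  let ψ : Bool → Spin S → ℝ := fun c s =>
    cond c (β * Real.sqrt q' * s.toReal) (β * Real.sqrt q * s.toReal)
  let b : ℝ → Spin S → ℝ := fun t s => Real.sin t ^ 2 * (β ^ 2 / 2 * (p' - q') * s.toReal ^ 2)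
    + Real.cos t ^ 2 * (β ^ 2 / 2 * (p - q) * s.toReal ^ 2) + D * s.toReal ^ 2 + h * s.toReal
  let b' : ℝ → Spin S → ℝ := fun t s =>
    Real.sin t * Real.cos t * (β ^ 2 * ((p' - p) - (q' - q)) * s.toReal ^ 2)
  let f : (κ → Spin S) → ℝ := fun ε => φ fun k => (ε k).toReal
  set δ := |p' - p| + |q' - q| with hδ
  have hδ0 : 0 ≤ δ := by positivity
  have hsc : ∀ t, |Real.sin t * Real.cos t| ≤ 1 := fun t => by
    rw [abs_mul]
    exact mul_le_one₀ (Real.abs_sin_le_one t) (abs_nonneg _) (Real.abs_cos_le_one t)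
  have hss : ∀ s : Spin S, |s.toReal ^ 2| ≤ (S : ℝ) ^ 2 := fun s => by
    rw [sq]; exact abs_spin_mul_le s s
  have hpq : |(p' - p) - (q' - q)| ≤ δ := abs_sub _ _
  have hb' : ∀ t s, |b' t s| ≤ β ^ 2 * δ * (S : ℝ) ^ 2 := by
    intro t s
    simp only [b', abs_mul (Real.sin t * Real.cos t), abs_mul _ (s.toReal ^ 2), abs_mul (β ^ 2),
      abs_of_nonneg (sq_nonneg β)]
    calc _ ≤ 1 * (β ^ 2 * δ * (S : ℝ) ^ 2) := by
          gcongr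
          · exact hsc t
          · exact hss s
      _ = _ := one_mul _
  have hd := fun t => hasDerivAt_integral_avg (c := rotCoef) (c' := rotCoef') ψ (b := b) (b' := b')
    (fun i t => by
      cases i
      · exact Real.hasDerivAt_cos t
      · exact Real.hasDerivAt_sin t)
    (fun i t => by
      cases i
      · simpa [rotCoef'] using Real.abs_sin_le_one t
      · exact Real.abs_cos_le_one t)
    (fun s t => by
      refine ((((((Real.hasDerivAt_sin t).pow 2).mul_const _).add
        (((Real.hasDerivAt_cos t).pow 2).mul_const _)).add_const _).add_const _).congr_deriv ?_
      simp only [Nat.cast_ofNat, Nat.add_one_sub_one, pow_one, b']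
      ring)
    hb' f t
  have h1 := abs_sub_le_of_abs_deriv_le hd (M := (S : ℝ) ^ 2 *
      (((Fintype.card κ : ℝ) + 2) ^ 2 * (((Fintype.card κ : ℝ) + 1) ^ 2 * (2 * (β ^ 2 * δ * (S : ℝ) ^ 2)))))
    (fun t _ => ?_) (Set.right_mem_Icc.2 (by positivity : (0 : ℝ) ≤ Real.pi / 2))
  · have hend : ∀ (t p q : ℝ) (c : Bool), (∀ (g : Bool → ℝ) s,
          gaussEnergy (fun i => rotCoef i t) ψ (b t) g s = cavityEnergy S β h D p q (g c) s) →
        ∫ g, avg (gaussEnergy (fun i => rotCoef i t) ψ (b t) g) f ∂stdGaussian Bool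
          = nu0Avg S β h D p q φ := by
      intro t p q c hc
      rw [nu0Avg, ← integral_eval_comp_stdGaussian c (continuous_avg_cavityEnergy f)]
      congr 1
      funext g
      rw [funext (hc g)]
    rw [hend (Real.pi / 2) p' q' true, hend 0 p q false] at h1
    · refine h1.trans (le_of_eq ?_)
      unfold lipConst
      ring
    · intro g s
      simp only [gaussEnergy, Fintype.sum_bool, rotCoef, ψ, b, cavityEnergy, cond_true, cond_false,
        Real.sin_zero, Real.cos_zero]
      ring
    · intro g s
      simp only [gaussEnergy, Fintype.sum_bool, rotCoef, ψ, b, cavityEnergy, cond_true, cond_false,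
        Real.sin_pi_div_two, Real.cos_pi_div_two]
      ring
  · have hbr : ∀ x y : Spin S, |∑ i, rotCoef i t * rotCoef' i t * ψ i x * ψ i y| ≤ β ^ 2 * δ * (S : ℝ) ^ 2 := by
      intro x y
      have e1 : ∑ i, rotCoef i t * rotCoef' i t * ψ i x * ψ i y
          = Real.sin t * Real.cos t * (β ^ 2 * (q' - q) * (x.toReal * y.toReal)) := by
        simp only [Fintype.sum_bool, rotCoef, rotCoef', ψ, cond_true, cond_false]
        linear_combination Real.sin t * Real.cos t * β ^ 2 * (x.toReal * y.toReal) *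
          (Real.sq_sqrt hq' - Real.sq_sqrt hq)
      rw [e1, abs_mul, abs_mul _ (x.toReal * y.toReal), abs_mul (β ^ 2), abs_of_nonneg (sq_nonneg β)]
      have e2 : |q' - q| ≤ δ := le_add_of_nonneg_left (abs_nonneg _)
      calc _ ≤ 1 * (β ^ 2 * δ * (S : ℝ) ^ 2) := by
            gcongr
            · exact hsc t
            · exact abs_spin_mul_le x y
        _ = _ := one_mul _
    have hpt : ∀ x : Option (Option κ) → Spin S, |lift₂ f x * ∑ k, ∑ l, leftCoef κ k * rightCoef κ l *
          (∑ i, rotCoef i t * rotCoef' i t * ψ i (x k) * ψ i (x l) + if k = l then b' t (x k) else 0)|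
        ≤ (S : ℝ) ^ 2 * (((Fintype.card κ : ℝ) + 2) ^ 2 *
          (((Fintype.card κ : ℝ) + 1) ^ 2 * (2 * (β ^ 2 * δ * (S : ℝ) ^ 2)))) := by
      intro x
      rw [abs_mul]
      refine mul_le_mul (hφ _) ?_ (abs_nonneg _) (by positivity)
      calc _ ≤ ∑ _k : Option (Option κ), ∑ _l : Option (Option κ),
            ((Fintype.card κ : ℝ) + 1) ^ 2 * (2 * (β ^ 2 * δ * (S : ℝ) ^ 2)) := by
            refine (Finset.abs_sum_le_sum_abs _ _).trans (Finset.sum_le_sum fun k _ =>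
              (Finset.abs_sum_le_sum_abs _ _).trans (Finset.sum_le_sum fun l _ => ?_))
            rw [abs_mul]
            refine mul_le_mul (abs_leftCoef_mul_rightCoef_le k l) ?_ (abs_nonneg _) (by positivity)
            refine (abs_add_le _ _).trans ?_
            have e3 : |if k = l then b' t (x k) else 0| ≤ β ^ 2 * δ * (S : ℝ) ^ 2 := by
              split_ifs
              · exact hb' _ _
              · rw [abs_zero]; positivity
            linarith [hbr (x k) (x l)]
        _ = _ := by
            simp only [Finset.sum_const, Finset.card_univ, Fintype.card_option, nsmul_eq_mul]
            push_cast
            ring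
    refine (norm_integral_le_of_norm_le_const (μ := stdGaussian Bool)
      (f := fun g => avg (gaussEnergy (fun i => rotCoef i t) ψ (b t) g) _)
      (Filter.Eventually.of_forall fun g => abs_avg_le_of_abs_le hpt)).trans_eq ?_
    rw [probReal_univ, mul_one]

theorem nu0_mul_nonneg (p q : ℝ) : 0 ≤ nu0 S β h D p q 2 (fun ε => ε 0 * ε 1) := by
  refine integral_nonneg fun η => ?_
  have := avg_prod (cavityEnergy S β h D p q η) fun (_ : Fin 2) s => s.toReal
  simp only [Fin.prod_univ_two] at this
  exact (mul_self_nonneg _).trans this.ge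

theorem abs_nu0_sq_le (p q : ℝ) : |nu0 S β h D p q 1 (fun ε => ε 0 ^ 2)| ≤ (S : ℝ) ^ 2 :=
  abs_nu0Avg_le (κ := Fin 1) (φ := fun ε => ε 0 ^ 2) fun _ => by
    rw [sq]; exact abs_spin_mul_le _ _

theorem abs_nu0_mul_le (p q : ℝ) : |nu0 S β h D p q 2 (fun ε => ε 0 * ε 1)| ≤ (S : ℝ) ^ 2 :=
  abs_nu0Avg_le (κ := Fin 2) (φ := fun ε => ε 0 * ε 1) fun _ => abs_spin_mul_le _ _

/-- The replica symmetric equations have exactly one solution at high temperature. -/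
theorem exists_unique_isFixedPoint
    (hβ : β ^ 2 * (lipConst S 1 + lipConst S 2) ≤ 1 / 4) :
    ∃ p q : ℝ, IsFixedPoint S β h D p q ∧
      ∀ p' q' : ℝ, IsFixedPoint S β h D p' q' → p' = p ∧ q' = q := by
  have hL : ∀ n, 0 ≤ β ^ 2 * lipConst S n := fun n => by unfold lipConst; positivity
  -- solutions have `q ≥ 0`, and negative values of `q` are cut off to make the map a contraction
  let Φ : ℝ × ℝ → ℝ × ℝ := fun z => (nu0 S β h D z.1 (max z.2 0) 1 (fun ε => ε 0 ^ 2),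
    nu0 S β h D z.1 (max z.2 0) 2 (fun ε => ε 0 * ε 1))
  have hΦ : ContractingWith (1 / 2) Φ := by
    refine ⟨by rw [← NNReal.coe_lt_coe]; norm_num, LipschitzWith.of_dist_le_mul fun z w => ?_⟩
    have h1 : |z.1 - w.1| + |max z.2 0 - max w.2 0| ≤ 2 * dist z w := by
      have e1 : |z.1 - w.1| ≤ dist z w := le_max_left (dist z.1 w.1) (dist z.2 w.2)
      have e2 : |z.2 - w.2| ≤ dist z w := le_max_right (dist z.1 w.1) (dist z.2 w.2)
      have e3 := abs_max_sub_max_le_abs z.2 w.2 0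
      linarith
    have h2 := abs_nu0Avg_sub_le (S := S) (β := β) (h := h) (D := D) (κ := Fin 1)
      (φ := fun ε => ε 0 ^ 2) (fun _ => by rw [sq]; exact abs_spin_mul_le _ _) (p := w.1)
      (p' := z.1) (le_max_right w.2 0) (le_max_right z.2 0)
    have h3 := abs_nu0Avg_sub_le (S := S) (β := β) (h := h) (D := D) (κ := Fin 2)
      (φ := fun ε => ε 0 * ε 1) (fun _ => abs_spin_mul_le _ _) (p := w.1)
      (p' := z.1) (le_max_right w.2 0) (le_max_right z.2 0)
    rw [Fintype.card_fin] at h2 h3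
    have hd : 0 ≤ dist z w := dist_nonneg
    have h4 : ∀ n, (n = 1 ∨ n = 2) → β ^ 2 * lipConst S n * (|z.1 - w.1| + |max z.2 0 - max w.2 0|)
        ≤ 1 / 2 * dist z w := by
      intro n hn
      have h5 : β ^ 2 * lipConst S n ≤ 1 / 4 := by
        rcases hn with rfl | rfl
        · linarith [hL 2]
        · linarith [hL 1]
      calc _ ≤ 1 / 4 * (2 * dist z w) := by gcongr
        _ = _ := by ring
    refine max_le ((h2.trans (h4 1 (Or.inl rfl))).trans_eq ?_)
      ((h3.trans (h4 2 (Or.inr rfl))).trans_eq ?_) <;> simp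
  have hiff : ∀ p q : ℝ, IsFixedPoint S β h D p q ↔ Function.IsFixedPt Φ (p, q) := by
    intro p q
    constructor
    · rintro ⟨h1, h2⟩
      have hq : max q 0 = q := max_eq_left (h2 ▸ nu0_mul_nonneg p q)
      refine Prod.ext ?_ ?_ <;> simp only [Φ, hq]
      exacts [h1.symm, h2.symm]
    · intro hz
      have h1 : nu0 S β h D p (max q 0) 1 (fun ε => ε 0 ^ 2) = p := congrArg Prod.fst hz
      have h2 : nu0 S β h D p (max q 0) 2 (fun ε => ε 0 * ε 1) = q := congrArg Prod.snd hz
      have hq : max q 0 = q := max_eq_left (h2 ▸ nu0_mul_nonneg p (max q 0))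
      rw [hq] at h1 h2
      exact ⟨h1.symm, h2.symm⟩
  refine ⟨(hΦ.fixedPoint Φ).1, (hΦ.fixedPoint Φ).2, (hiff _ _).2 hΦ.fixedPoint_isFixedPt,
    fun p' q' hpq => ?_⟩
  have := hΦ.fixedPoint_unique ((hiff p' q').1 hpq)
  exact ⟨congrArg Prod.fst this, congrArg Prod.snd this⟩

end FixedPoint

/-! ### The high-temperature regime -/

/-- An upper bound for all the constants that have to be compensated by a high temperature. -/
def tempConst (S : ℕ) : ℝ := 2 * growthConst S 3 + 2 * growthConst S 4
  + 2 * (momentConst S 1 + momentConst S 2) + 4 * (lipConst S 1 + lipConst S 2) + 8 * (S : ℝ) ^ 4 + 1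

theorem growthConst_nonneg (S n : ℕ) : 0 ≤ growthConst S n :=
  mul_nonneg (derivConst_nonneg _ _) (by positivity)

theorem momentConst_nonneg (S n : ℕ) : 0 ≤ momentConst S n := by
  have := derivConst_nonneg S n
  unfold momentConst; positivity

theorem lipConst_nonneg (S n : ℕ) : 0 ≤ lipConst S n := by
  unfold lipConst; positivity

theorem exists_highTemp {S : ℕ} {β : ℝ} (h D : ℝ) (hβ : β ^ 2 * tempConst S ≤ 1) :
    ∃ p q : ℝ, HighTemp S β h D p q ∧
      (∀ p' q' : ℝ, IsFixedPoint S β h D p' q' → p' = p ∧ q' = q) ∧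
      β ^ 2 * constA S β h D p q < 1 := by
  have hsq := sq_nonneg β
  have a1 := mul_nonneg hsq (growthConst_nonneg S 3)
  have a2 := mul_nonneg hsq (growthConst_nonneg S 4)
  have a3 := mul_nonneg hsq (add_nonneg (momentConst_nonneg S 1) (momentConst_nonneg S 2))
  have a4 := mul_nonneg hsq (add_nonneg (lipConst_nonneg S 1) (lipConst_nonneg S 2))
  have a5 : 0 ≤ β ^ 2 * (S : ℝ) ^ 4 := by positivity
  unfold tempConst at hβ
  obtain ⟨p, q, hpq, huniq⟩ := exists_unique_isFixedPoint (S := S) (h := h) (D := D) (β := β)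
    (by linarith)
  refine ⟨p, q, ⟨hpq, ?_, ?_, ?_, by linarith, by linarith, by linarith⟩, huniq, ?_⟩
  · rw [hpq.1]; exact abs_nu0_sq_le p q
  · rw [hpq.2]; exact abs_nu0_mul_le p q
  · rw [hpq.2]; exact nu0_mul_nonneg p q
  · have := mul_le_mul_of_nonneg_left (constA_le (S := S) (β := β) (h := h) (D := D) (p := p) (q := q)) hsq
    linarith

theorem HighTemp.exists_concentration {S : ℕ} {β h D p q : ℝ} (H : HighTemp S β h D p q) :
    ∃ C : ℝ, ∀ N : ℕ, 1 ≤ N →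
      nu S N β h D 2 (fun _ σ => (overlap (σ 0) (σ 1) - q) ^ 2) ≤ C / N ∧
      nu S N β h D 1 (fun _ σ => (overlap (σ 0) (σ 0) - p) ^ 2) ≤ C / N := by
  obtain ⟨C, -, hC⟩ := exists_moment_le H.fixed H.abs_p_le H.abs_q_le H.q_nonneg H.growth_three
    H.growth_four H.moment_le 1
  refine ⟨C, fun N hN => ?_⟩
  have h0 := hC N hN
  rw [pow_one, mul_one_div] at h0
  exact ⟨(nuAvg_rho_pow_le hN 1 (0 : Fin 2) 1).trans h0, (nuAvg_rho_pow_le hN 1 (0 : Fin 1) 0).trans h0⟩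

end GS

end

theorem mainTheorem5 (S : ℕ) (hS : 1 ≤ S) :
    ∃ β' : ℝ, 0 < β' ∧ ∀ β h D : ℝ, 0 ≤ β → β < β' → 0 ≤ h →
      ∃ p q : ℝ,
        -- `(p, q)` is the unique solution of the replica symmetric equations
        GS.IsFixedPoint S β h D p q ∧
        (∀ p' q' : ℝ, GS.IsFixedPoint S β h D p' q' → p' = p ∧ q' = q) ∧
        -- the overlap concentrates at `q` and the self-overlap at `p`
        (∃ C : ℝ, ∀ N : ℕ, 1 ≤ N →
          GS.nu S N β h D 2 (fun _ σ => (GS.overlap (σ 0) (σ 1) - q) ^ 2) ≤ C / N ∧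
          GS.nu S N β h D 1 (fun _ σ => (GS.overlap (σ 0) (σ 0) - p) ^ 2) ≤ C / N) ∧
        -- `A / (N (1 - β² A))` is nonnegative, with a positive denominator
        0 ≤ GS.constA S β h D p q ∧ β ^ 2 * GS.constA S β h D p q < 1 ∧
        -- the factorization of mixed moments up to `O(N ^ (-(H + 1) / 2))`
        ∀ (n : ℕ) (m : GS.Exponents n), ∃ K : ℝ, ∀ N : ℕ, 1 ≤ N →
          |GS.nu S N β h D n (fun g σ =>
                GS.pairMonomial (GS.hamiltonian S N β h D g) m σ
                  * GS.restMonomial (GS.hamiltonian S N β h D g) p q m σ)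
            - (∏ e ∈ GS.pairs n,
                GS.gaussMoment (m.pair e) * GS.A₂ S N β h D p q ^ m.pair e)
              * GS.nu S N β h D n (fun g σ =>
                GS.restMonomial (GS.hamiltonian S N β h D g) p q m σ)|
            ≤ K * (N : ℝ) ^ (-((m.total : ℝ) + 1) / 2) := by
  have hC : 1 ≤ GS.tempConst S := by
    unfold GS.tempConst
    have := GS.growthConst_nonneg S 3
    have := GS.growthConst_nonneg S 4
    have := GS.momentConst_nonneg S 1
    have := GS.momentConst_nonneg S 2
    have := GS.lipConst_nonneg S 1
    have := GS.lipConst_nonneg S 2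
    have : (0 : ℝ) ≤ (S : ℝ) ^ 4 := by positivity
    linarith
  have hC0 : 0 < GS.tempConst S := by linarith
  refine ⟨1 / GS.tempConst S, by positivity, fun β h D hβ0 hβ _ => ?_⟩
  have hβ2 : β ^ 2 * GS.tempConst S ≤ 1 := by
    have h1 : β * GS.tempConst S ≤ 1 := ((lt_div_iff₀ hC0).1 hβ).le
    have h2 : β ≤ 1 := hβ.le.trans ((div_le_one hC0).2 hC)
    calc _ = β * (β * GS.tempConst S) := by ring
      _ ≤ 1 * 1 := by gcongr
      _ = 1 := one_mul 1
  obtain ⟨p, q, H, huniq, hA1⟩ := GS.exists_highTemp h D hβ2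
  exact ⟨p, q, H.fixed, huniq, H.exists_concentration, GS.constA_nonneg, hA1, fun n m =>
    H.exists_mixed_moment GS.constA_nonneg hA1 m⟩
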